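/- Let $K$ be a field of characteristic $0$, let $k,d\ge 1$, and let $U_k$ be the algebra of upper triangular $k\times k$ matrices over $K$. A partition $\lambda$ in at most $d$ parts is written as $\lambda=(\lambda_1\ge\dots\ge\lambda_d\ge 0)$, and $T_d^\lambda=t_1^{\lambda_1}\cdots t_d^{\lambda_d}$. For $\lambda\vdash n$ let $\chi_\lambda$ be the corresponding irreducible character of $S_n$, $d_\lambda$ its degree, and $m_\lambda(U_k)$ its multiplicity in the $n$-th cocharacter of $U_k$, i.e. in the character of $S_n$ on the space of multilinear polynomials of degree $n$ in the noncommuting variables $x_1,\dots,x_n$ modulo the polynomial identities of $U_k$. Let $$M(U_k;T_d)=\sum_{\lambda}m_\lambda(U_k)\,T_d^{\lambda},$$ the sum being over all partitions in at most $d$ parts. For a symmetric power series $f=\sum_\lambda m_\lambda S_\lambda(T_d)\in\mathbb C[[t_1,\dots,t_d]]^{S_d}$ ($S_\lambda$ the Schur functions, $\lambda$ running over the partitions in at most $d$ parts) let $M(f;T_d)=\sum_\lambda m_\lambda T_d^\lambda$ be its multiplicity series; it lies in $\mathbb C[[V_d]]\subset\mathbb C[[T_d]]$, where $v_i=t_1\cdots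 t_i$. Let $Y$ be the linear operator on $\mathbb C[[V_d]]$ which sends the multiplicity series of a symmetric function to that of its Young-derived: $$Y(M(g);T_d)=M\Bigl(g(T_d)\prod_{i=1}^d\frac1{1-t_i};T_d\Bigr),\qquad g\in\mathbb C[[T_d]]^{S_d}.$$ Then $Y$ is a well-defined linear operator, and $$M(U_k;T_d)=\sum_{j=1}^k\sum_{q=0}^{j-1}\sum_{\lambda\vdash q}(-1)^{j-q-1}\binom kj\binom{j-1}q d_\lambda\,Y^j(T_d^\lambda),$$ where $\lambda$ runs over the partitions of $q$ in at most $d$ parts. This gives an algorithm for computing $M(U_k;T_d)$, because $Y$ is given explicitly by $$Y(h)=\prod_{i=1}^d\frac1{1-t_i}\sum_{\varepsilon_2,\dots,\varepsilon_d\in\{0,1\}}(-t_2)^{\varepsilon_2}\cdots(-t_d)^{\varepsilon_d}\,h\bigl(t_1t_2^{\varepsilon_2},\,t_2^{1-\varepsilon_2}t_3^{\varepsilon_3},\dots,t_{d-1}^{1-\varepsilon_{d-1}}t_d^{\varepsilon_d},\,t_d^{1-\varepsilon_d}\bigr)$$ for every $h\in\mathbb C[[V_d]]$. -/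

import Mathlib

noncomputable section

open MvPowerSeries

/-! ### Polynomial identities and the cocharacter of an algebra -/

section PI

variable (K : Type*) [Field K]

/-- The polynomial identities of the `K`-algebra `R` in the variables `x_i`, `i : X`: the elements
`f` of the free unital associative algebra `K⟨X⟩` that vanish under every substitution of the
variables by elements of `R`. -/
def identities (R : Type*) [Ring R] [Algebra K R] (X : Type*) : Submodule K (FreeAlgebra K X) :=
  ⨅ φ : FreeAlgebra K X →ₐ[K] R, LinearMap.ker φ.toLinearMap

/-- The left action of the symmetric group `S_n` on `K⟨x_1, …, x_n⟩` by renaming the variables,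
`(σ f)(x_1, …, x_n) = f(x_{σ(1)}, …, x_{σ(n)})`. -/
def permVars (n : ℕ) : Representation K (Equiv.Perm (Fin n)) (FreeAlgebra K (Fin n)) where
  toFun σ := (FreeAlgebra.lift K (FreeAlgebra.ι K ∘ σ)).toLinearMap
  map_one' := by
    have h : FreeAlgebra.lift K (FreeAlgebra.ι K ∘ ((1 : Equiv.Perm (Fin n)) : Fin n → Fin n)) =
        AlgHom.id K _ := by
      ext i; simp
    rw [h]; rfl
  map_mul' σ τ := by
    have h : FreeAlgebra.lift K (FreeAlgebra.ι K ∘ ((σ * τ : Equiv.Perm (Fin n)) : Fin n → Fin n)) =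
        (FreeAlgebra.lift K (FreeAlgebra.ι K ∘ σ)).comp
          (FreeAlgebra.lift K (FreeAlgebra.ι K ∘ τ)) := by
      ext i; simp
    rw [h]; rfl

/-- `P_n`: the multilinear polynomials of degree `n` in `x_1, …, x_n`, i.e. the span of the monomials
`x_{σ(1)} ⋯ x_{σ(n)}`, `σ ∈ S_n`. -/
def multilinearPart (n : ℕ) : Submodule K (FreeAlgebra K (Fin n)) :=
  Submodule.span K (Set.range fun σ : Equiv.Perm (Fin n) =>
    (List.ofFn fun i => FreeAlgebra.ι K (σ i)).prod)

theorem multilinearPart_le_comap (n : ℕ) (σ : Equiv.Perm (Fin n)) :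
    multilinearPart K n ≤ (multilinearPart K n).comap (permVars K n σ) := by
  refine Submodule.span_le.2 ?_
  rintro _ ⟨τ, rfl⟩
  refine Submodule.subset_span ⟨σ * τ, ?_⟩
  simp only [permVars, MonoidHom.coe_mk, OneHom.coe_mk, AlgHom.toLinearMap_apply, map_list_prod,
    List.map_ofFn]
  congr 2
  funext i
  simp

/-- `P_n ∩ T(R)`, as a subspace of `P_n`. -/
def multilinearIdentities (R : Type*) [Ring R] [Algebra K R] (n : ℕ) :
    Submodule K (multilinearPart K n) :=
  (identities K R (Fin n)).comap (multilinearPart K n).subtype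

theorem multilinearIdentities_le_comap (R : Type*) [Ring R] [Algebra K R] (n : ℕ)
    (σ : Equiv.Perm (Fin n)) :
    multilinearIdentities K R n ≤ (multilinearIdentities K R n).comap
      ((permVars K n).subrepresentation (multilinearPart K n)
        (multilinearPart_le_comap K n) σ) := by
  intro f hf
  simp only [multilinearIdentities, identities, Submodule.mem_comap, Submodule.mem_iInf,
    LinearMap.mem_ker, AlgHom.toLinearMap_apply] at hf ⊢
  intro φ
  exact hf (φ.comp (FreeAlgebra.lift K (FreeAlgebra.ι K ∘ σ)))

/-- The representation of `S_n` on `P_n(R) = P_n / (P_n ∩ T(R))`. Its character is the `n`-th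
cocharacter `χ_n(R)` of `R`. -/
def cocharacterRep (R : Type*) [Ring R] [Algebra K R] (n : ℕ) :
    Representation K (Equiv.Perm (Fin n)) (multilinearPart K n ⧸ multilinearIdentities K R n) :=
  ((permVars K n).subrepresentation (multilinearPart K n)
    (multilinearPart_le_comap K n)).quotient (multilinearIdentities K R n)
      (multilinearIdentities_le_comap K R n)

/-! ### The irreducible representations of the symmetric groups

A partition of `n` in at most `d` parts is an antitone map `l : Fin d → ℕ` with `∑ i, l i = n`.
Its standard tableau is obtained by writing `0, 1, …, n - 1` row by row in the diagram of `l`. -/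

/-- The row of the entry `x` in the row-by-row tableau of shape `l`. -/
def tableauRow {d : ℕ} (l : Fin d → ℕ) (x : Fin (∑ i, l i)) : ℕ :=
  (finSigmaFinEquiv.symm x).1

/-- The column of the entry `x` in the row-by-row tableau of shape `l`. -/
def tableauCol {d : ℕ} (l : Fin d → ℕ) (x : Fin (∑ i, l i)) : ℕ :=
  (finSigmaFinEquiv.symm x).2

open Classical in
/-- The Young symmetrizer `(∑ σ) (∑ sign(τ) τ)`, where `σ` runs over the row stabilizer and `τ` over
the column stabilizer of the row-by-row tableau of shape `l`. -/
def youngSymmetrizer {d : ℕ} (l : Fin d → ℕ) :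
    MonoidAlgebra K (Equiv.Perm (Fin (∑ i, l i))) :=
  (∑ σ : Equiv.Perm (Fin (∑ i, l i)) with ∀ x, tableauRow l (σ x) = tableauRow l x,
      MonoidAlgebra.single σ 1) *
    (∑ τ : Equiv.Perm (Fin (∑ i, l i)) with ∀ x, tableauCol l (τ x) = tableauCol l x,
      MonoidAlgebra.single τ ((Equiv.Perm.sign τ : ℤ) : K))

/-- The Specht module of the partition `l`: the left ideal of the group algebra generated by the
Young symmetrizer. -/
abbrev SpechtModule {d : ℕ} (l : Fin d → ℕ) :
    Ideal (MonoidAlgebra K (Equiv.Perm (Fin (∑ i, l i)))) :=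
  Ideal.span {youngSymmetrizer K l}

/-- The irreducible representation of `S_n` labelled by the partition `l` of `n`; its character is
`χ_l`. -/
def spechtRep {d : ℕ} (l : Fin d → ℕ) :
    Representation K (Equiv.Perm (Fin (∑ i, l i))) (SpechtModule K l) :=
  Representation.ofModule' (SpechtModule K l)

/-- `d_l`, the degree of the irreducible character `χ_l`. -/
def spechtDegree {d : ℕ} (l : Fin d → ℕ) : ℕ :=
  Module.finrank K (SpechtModule K l)

/-- `m_l(R)`, the multiplicity of the irreducible character `χ_l` in the cocharacter `χ_n(R)`, where
`l` is a partition of `n`. -/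
def cocharacterMultiplicity (R : Type*) [Ring R] [Algebra K R] {d : ℕ} (l : Fin d → ℕ) : ℕ :=
  Module.finrank K
    (Representation.IntertwiningMap (spechtRep K l) (cocharacterRep K R (∑ i, l i)))

/-- `U_k`, the algebra of upper triangular `k × k` matrices. -/
abbrev UpperTriangular (k : ℕ) : Subalgebra K (Matrix (Fin k) (Fin k) K) :=
  Matrix.blockTriangularSubalgebra K K (id : Fin k → Fin k)

end PI

/-! ### Symmetric functions and multiplicity series -/

/-- The partitions of `q` in at most `d` parts, completed with zeros to length `d`. -/
def partitionsOf (d q : ℕ) : Finset (Fin d → ℕ) :=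
  open Classical in (Finset.Nat.antidiagonalTuple d q).filter Antitone

/-- `C[[V_d]] ⊆ C[[T_d]]`, where `v_i = t_1 ⋯ t_i`: the series in which only the monomials
`T_d^l = v_1^{l_1 - l_2} ⋯ v_{d-1}^{l_{d-1} - l_d} v_d^{l_d}` with `l` a partition occur. -/
def partitionSeries (d : ℕ) : Submodule ℂ (MvPowerSeries (Fin d) ℂ) where
  carrier := {h | ∀ a : Fin d →₀ ℕ, ¬ Antitone a → coeff a h = 0}
  add_mem' := by
    intro f g hf hg a ha
    rw [map_add, hf a ha, hg a ha, add_zero]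
  zero_mem' := fun a _ => by simp
  smul_mem' := by
    intro c f hf a ha
    rw [map_smul, hf a ha, smul_zero]

/-- The monomial `T_d^l = t_1^{l_1} ⋯ t_d^{l_d}` of a partition `l`. -/
def partitionMonomial {d : ℕ} (l : Fin d → ℕ) (hl : Antitone l) : partitionSeries d :=
  ⟨monomial (Finsupp.equivFunOnFinite.symm l) 1, by
    classical
    intro a ha
    rw [coeff_monomial, if_neg]
    rintro rfl
    exact ha hl⟩

theorem antitone_of_mem_partitionsOf {d q : ℕ} {l : Fin d → ℕ} (hl : l ∈ partitionsOf d q) :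
    Antitone l := by
  classical
  exact (Finset.mem_filter.1 hl).2

/-- The determinant `V(μ, T_d) = det (t_j^{μ_i})`. -/
def alternant {d : ℕ} (μ : Fin d → ℕ) : MvPolynomial (Fin d) ℂ :=
  Matrix.det (Matrix.of fun i j : Fin d => MvPolynomial.X j ^ μ i)

/-- `δ = (d - 1, …, 1, 0)`. -/
def staircase (d : ℕ) (i : Fin d) : ℕ := d - 1 - i

/-- The Schur function `S_l(T_d) = V(l + δ) / V(δ)`. -/
def schurFunction {d : ℕ} (l : Fin d → ℕ) : MvPolynomial (Fin d) ℂ :=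
  Classical.epsilon fun s => s * alternant (staircase d) = alternant (l + staircase d)

/-- The series `∑_l h_l S_l(T_d)`, where `l` runs over all partitions in at most `d` parts and `h_l`
is the coefficient of `T_d^l` in `h`. As `S_l` is homogeneous of degree `|l|`, only the partitions of
`|a|` contribute to the coefficient at the exponent `a`. -/
def schurSeries {d : ℕ} (h : partitionSeries d) : MvPowerSeries (Fin d) ℂ := fun a =>
  ∑ l ∈ partitionsOf d a.degree,
    coeff (Finsupp.equivFunOnFinite.symm l) (h : MvPowerSeries (Fin d) ℂ) *
      MvPolynomial.coeff a (schurFunction l)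

/-- The multiplicity series `M(f; T_d) = ∑_l m_l T_d^l` of a symmetric function
`f = ∑_l m_l S_l(T_d)`. -/
def multiplicitySeries {d : ℕ} (f : MvPowerSeries (Fin d) ℂ) : partitionSeries d :=
  Classical.epsilon fun h => schurSeries h = f

/-- `C[[T_d]]^{S_d}`: the series that are invariant under permutations of the variables. -/
def IsSymmetricSeries {d : ℕ} (f : MvPowerSeries (Fin d) ℂ) : Prop :=
  ∀ (σ : Equiv.Perm (Fin d)) (a : Fin d →₀ ℕ), coeff (Finsupp.equivMapDomain σ a) f = coeff a f

/-- `∏_{i=1}^d 1 / (1 - t_i)`. -/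
def geomProd (d : ℕ) : MvPowerSeries (Fin d) ℂ := ∏ i, (1 - X i)⁻¹

/-- The operator `Y` on `C[[V_d]]`, which sends the multiplicity series of a symmetric function `g` to
the multiplicity series of its Young-derived `g ∏ 1 / (1 - t_i)`. -/
def youngOperator {d : ℕ} (h : partitionSeries d) : partitionSeries d :=
  multiplicitySeries (schurSeries h * geomProd d)

/-- The series `h'` in the variables `v_1, …, v_d` with `h'(v_1, …, v_d) = h(t_1, …, t_d)` for
`v_i = t_1 ⋯ t_i`: its coefficient at `v_1^{a_1} ⋯ v_d^{a_d}` is the coefficient of `h` at `T_d^l`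
with `l_i = a_i + ⋯ + a_d`. -/
def inVariablesV {d : ℕ} (h : partitionSeries d) : MvPowerSeries (Fin d) ℂ := fun a =>
  coeff (Finsupp.equivFunOnFinite.symm fun i => ∑ j ∈ Finset.Ici i, a j)
    (h : MvPowerSeries (Fin d) ℂ)

/-- For `ε_2, …, ε_d ∈ {0, 1}` with `E = {i | ε_i = 1}`, the substitution
`h(t_1 t_2^{ε_2}, t_2^{1 - ε_2} t_3^{ε_3}, …, t_d^{1 - ε_d})`, i.e.
`v_i ↦ t_1 ⋯ t_i t_{i+1}^{ε_{i+1}}` for `i < d` and `v_d ↦ t_1 ⋯ t_d`. -/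
def shiftSubst {d : ℕ} (E : Finset (Fin d)) (h : partitionSeries d) : MvPowerSeries (Fin d) ℂ :=
  MvPowerSeries.subst
    (fun i : Fin d => (∏ j ∈ Finset.Iic i, (X j : MvPowerSeries (Fin d) ℂ)) *
      ∏ j ∈ E with j.val = i.val + 1, X j)
    (inVariablesV h)

open Classical in
/-- The multiplicity series `M(R; T_d) = ∑_l m_l(R) T_d^l` of the algebra `R`, where `l` runs over the
partitions in at most `d` parts. -/
def algMultiplicitySeries (K : Type*) [Field K] (R : Type*) [Ring R] [Algebra K R] (d : ℕ) :
    partitionSeries d :=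
  ⟨fun a => if Antitone a then (cocharacterMultiplicity K R a : ℂ) else 0, fun _ ha => if_neg ha⟩

end

noncomputable section

open MvPowerSeries

/-! ### Alternants and Schur polynomials -/

section Alternants

variable {d : ℕ}

/-! Write `G = ∏ 1/(1 - t_i)`, `s = t_1 + ⋯ + t_d - 1`, and let `B_k` be the Hilbert series of the
relatively free algebra of `U_k` in `d` variables, graded by content. The theorem rests on four
facts.

(1) `M(U_k) = M(B_k)` (`algMultiplicitySeries_eq`). The coefficient of `S_l` in a symmetric series
`f` is the coefficient of `f · V(δ)` at `l + δ`, an alternating sum of coefficients of `f`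
(`coeff_schurSeries_mul`, `coeff_mul_vandermondeSeries`). The multiplicity of the Specht module of
`l` in any finite-dimensional representation `V` of `S_n` is the same alternating sum of the numbers
`dim Hom(W_β, V)`, where `W_β` is the permutation module on words of content `β`
(`finrank_intertwiningMap_eq_altCoeff`). For `V = P_n(R)`, restitution identifies `Hom(W_β, V)` with
the component of content `β` of the relatively free algebra
(`finrank_intertwiningMap_cocharacterRep`). The multiplicity formula comes from
`character_spechtRep`: the Specht character and the alternating sum of permutation characters both
have norm 1 and have inner product 1, and their values are rational, so they coincide.

(2) `B_{k+1} = B_k + G + s G B_k` (`hilbertSeries_succ`). Cutting off the first row of a triangular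
matrix shows that `f` is an identity of `U_{k+1}` exactly when its scalar values vanish and its
derivatives `∂_j f` (sums of `a(u) v` over factorizations `u j v`) are identities of `U_k`. On a
component of fixed content the scalars may be set to 1. The derivatives then obey the Fox formula `f
- ε(f) = ∑ (x_j - 1) ∂_j f`, with `ε` the sum of the coefficients. Modulo identities, the image of
`f ↦ (∂_j f)` is therefore the kernel of `(e_j) ↦ ∑ (x_j - 1) e_j`, whose own image has codimension
1. Counting dimensions gives the recursion.

(3) Consequently `1 + s B_k = (1 + s G)^k`, so `B_k = ∑_j C(k,j) s^(j-1) G^j`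
(`hilbertSeries_eq_sum`). Expanding `s^(j-1)` by the binomial theorem, using `(t_1 + ⋯ + t_d)^q = ∑
d_l S_l` and reading multiplication by `G` as `Y` yields the formula for `M(U_k)`.

(4) On multiplicity series, `Y` sums coefficients over horizontal strips (`coeff_youngOperator`).
The explicit formula is inclusion-exclusion over the interlacing inequalities that define a strip
(`sum_powerset_shiftExponent`). -/

theorem alternant_eq_sum (μ : Fin d → ℕ) :
    alternant μ = ∑ σ : Equiv.Perm (Fin d), (Equiv.Perm.sign σ : ℤ) •
      MvPolynomial.monomial (Finsupp.equivFunOnFinite.symm fun i => μ (σ i)) (1 : ℂ) := by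
  rw [alternant, Matrix.det_apply]
  refine Finset.sum_congr rfl fun σ _ => ?_
  rw [MvPolynomial.monomial_eq, Finsupp.prod_fintype _ _ (by simp)]
  simp [Units.smul_def]

theorem rename_alternant (σ : Equiv.Perm (Fin d)) (μ : Fin d → ℕ) :
    MvPolynomial.rename σ (alternant μ) = ((Equiv.Perm.sign σ : ℤ) : MvPolynomial (Fin d) ℂ) *
      alternant μ := by
  have h : MvPolynomial.rename σ (alternant μ) =
      (MvPolynomial.rename (R := ℂ) σ).toRingHom (alternant μ) := rfl
  rw [h, alternant, RingHom.map_det, ← Matrix.det_permute']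
  congr 1
  ext1 i j
  simp

/-- Modulo `X j - X i` the columns `i` and `j` of the defining matrix coincide. -/
theorem X_sub_X_dvd_alternant (μ : Fin d → ℕ) {i j : Fin d} (h : i ≠ j) :
    (MvPolynomial.X j - MvPolynomial.X i : MvPolynomial (Fin d) ℂ) ∣ alternant μ := by
  rw [← Ideal.mem_span_singleton, ← Ideal.Quotient.eq_zero_iff_mem, alternant, RingHom.map_det]
  refine Matrix.det_zero_of_column_eq h fun r => ?_
  simp only [RingHom.mapMatrix_apply, Matrix.map_apply, Matrix.of_apply, map_pow]
  congr 1
  rw [eq_comm, ← sub_eq_zero, ← map_sub, Ideal.Quotient.eq_zero_iff_mem]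
  exact Ideal.mem_span_singleton_self _

theorem alternant_staircase :
    alternant (staircase d) = ((Equiv.Perm.sign (Fin.revPerm : Equiv.Perm (Fin d)) : ℤ) :
      MvPolynomial (Fin d) ℂ) *
      ∏ p : (i : Fin d) × Set.Ioi i, (MvPolynomial.X p.2.1 - MvPolynomial.X p.1) := by
  have h : (Matrix.of fun i j : Fin d => (MvPolynomial.X j : MvPolynomial (Fin d) ℂ) ^
      staircase d i) = ((Matrix.vandermonde fun j : Fin d =>
        (MvPolynomial.X j : MvPolynomial (Fin d) ℂ)).transpose).submatrix Fin.revPerm id := by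
    ext1 i j
    simp only [Matrix.of_apply, Matrix.submatrix_apply, Matrix.transpose_apply,
      Matrix.vandermonde_apply, Fin.revPerm_apply, Fin.val_rev, staircase, id]
    congr 1
    omega
  rw [alternant, h, Matrix.det_permute, Matrix.det_transpose, Matrix.det_vandermonde]
  congr 1
  rw [Fintype.prod_sigma]
  refine Finset.prod_congr rfl fun i _ => ?_
  rw [← Finset.prod_coe_sort]
  refine Fintype.prod_equiv (Equiv.subtypeEquivRight (by simp)) _ _ fun x => rfl

theorem alternant_staircase_ne_zero : alternant (staircase d) ≠ 0 := by
  rw [alternant_staircase]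
  refine mul_ne_zero ?_ (Finset.prod_ne_zero_iff.2 fun p _ => ?_)
  · rcases Int.units_eq_one_or (Equiv.Perm.sign (Fin.revPerm : Equiv.Perm (Fin d))) with h | h <;>
      simp [h]
  · rw [sub_ne_zero]
    intro h
    exact (ne_of_gt p.2.2) (MvPolynomial.X_injective h)

theorem irreducible_X_sub_X {i j : Fin d} (h : i ≠ j) :
    Irreducible (MvPolynomial.X j - MvPolynomial.X i : MvPolynomial (Fin d) ℂ) := by
  have hc : MvPolynomial.coeff (Finsupp.single j 1)
      (MvPolynomial.X j - MvPolynomial.X i : MvPolynomial (Fin d) ℂ) = 1 := by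
    rw [MvPolynomial.coeff_sub, MvPolynomial.coeff_X, MvPolynomial.coeff_X, if_pos rfl, if_neg,
      sub_zero]
    intro h'
    exact h (Finsupp.single_left_injective one_ne_zero h')
  refine MvPolynomial.irreducible_of_totalDegree_eq_one ?_ ?_
  · refine le_antisymm ?_ ?_
    · refine (MvPolynomial.totalDegree_sub _ _).trans ?_
      simp
    · have := MvPolynomial.le_totalDegree (p := (MvPolynomial.X j - MvPolynomial.X i :
        MvPolynomial (Fin d) ℂ)) (s := Finsupp.single j 1) (by
          rw [MvPolynomial.mem_support_iff, hc]; exact one_ne_zero)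
      simpa using this
  · intro x hx
    have := hx (Finsupp.single j 1)
    rw [hc] at this
    exact isUnit_of_dvd_one this

/-- Up to a unit, `V(δ)` is a product of pairwise coprime irreducible linear forms, each of which
divides every alternant. -/
theorem alternant_staircase_dvd (μ : Fin d → ℕ) : alternant (staircase d) ∣ alternant μ := by
  have hu : IsUnit (((Equiv.Perm.sign (Fin.revPerm : Equiv.Perm (Fin d)) : ℤ) :
      MvPolynomial (Fin d) ℂ)) :=
    (Units.isUnit (Equiv.Perm.sign (Fin.revPerm : Equiv.Perm (Fin d)))).map
      (Int.castRingHom (MvPolynomial (Fin d) ℂ))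
  rw [alternant_staircase, hu.mul_left_dvd]
  refine Finset.prod_dvd_of_isRelPrime ?_ fun p _ => X_sub_X_dvd_alternant μ (ne_of_lt p.2.2)
  rintro ⟨i, j, hij⟩ - ⟨i', j', hij'⟩ - hne
  rw [Function.onFun, (irreducible_X_sub_X (ne_of_lt hij)).isRelPrime_iff_not_dvd]
  rintro ⟨q, hq⟩
  apply hne
  -- At this point every variable takes its own index as value, except that `t_j` takes the value of
  -- `t_i`. Only differences that involve this one coincidence vanish, so the two linear forms must
  -- come from the same pair.
  have h := congrArg (MvPolynomial.eval fun t : Fin d => if t = j then ((i : ℕ) : ℂ) else t) hq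
  simp only [map_sub, map_mul, MvPolynomial.eval_X, if_true, if_neg (ne_of_lt (Set.mem_Ioi.1 hij)),
    sub_self, zero_mul] at h
  rw [Set.mem_Ioi] at hij hij'
  split_ifs at h with h1 h2 h2
  · exact absurd (h1.trans h2.symm) (ne_of_gt hij')
  · subst h1
    rw [sub_eq_zero, Nat.cast_inj, Fin.val_inj] at h
    subst h; rfl
  · subst h2
    rw [sub_eq_zero, Nat.cast_inj, Fin.val_inj] at h
    subst h
    exact absurd (hij.trans hij') (lt_irrefl _)
  · rw [sub_eq_zero, Nat.cast_inj, Fin.val_inj] at h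
    exact absurd h (ne_of_gt hij')

/-- Divisibility turns the `Classical.epsilon` in the definition into a genuine quotient of
alternants. -/
theorem schurFunction_mul (l : Fin d → ℕ) :
    schurFunction l * alternant (staircase d) = alternant (l + staircase d) := by
  obtain ⟨s, hs⟩ := alternant_staircase_dvd (l + staircase d)
  exact Classical.epsilon_spec (p := fun s : MvPolynomial (Fin d) ℂ =>
    s * alternant (staircase d) = alternant (l + staircase d)) ⟨s, by rw [hs, mul_comm]⟩

theorem rename_schurFunction (σ : Equiv.Perm (Fin d)) (l : Fin d → ℕ) :
    MvPolynomial.rename σ (schurFunction l) = schurFunction l := by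
  have h := congrArg (MvPolynomial.rename σ) (schurFunction_mul l)
  rw [map_mul, rename_alternant, rename_alternant, ← schurFunction_mul, mul_left_comm] at h
  have hs : ((Equiv.Perm.sign σ : ℤ) : MvPolynomial (Fin d) ℂ) ≠ 0 := by
    rcases Int.units_eq_one_or (Equiv.Perm.sign σ) with h | h <;> simp [h]
  exact mul_right_cancel₀ alternant_staircase_ne_zero (mul_left_cancel₀ hs h)

end Alternants

/-! ### Symmetric series and multiplicity series -/

section SymmetricSeries

variable {d : ℕ}

/-- The exponent vector with the given entries. -/
abbrev expo (l : Fin d → ℕ) : Fin d →₀ ℕ := Finsupp.equivFunOnFinite.symm l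

theorem expo_coe (a : Fin d →₀ ℕ) : expo (⇑a) = a := Finsupp.equivFunOnFinite_symm_coe a

theorem expo_degree (l : Fin d → ℕ) : (expo l).degree = ∑ i, l i := by
  simp [Finsupp.degree_eq_sum]

/-- The Vandermonde determinant `V(δ)` as a power series. -/
def vandermondeSeries (d : ℕ) : MvPowerSeries (Fin d) ℂ :=
  (alternant (staircase d) : MvPolynomial (Fin d) ℂ)

theorem vandermondeSeries_ne_zero : vandermondeSeries d ≠ 0 := by
  rw [vandermondeSeries, Ne, MvPolynomial.coe_eq_zero_iff]
  exact alternant_staircase_ne_zero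

theorem vandermondeSeries_eq_sum :
    vandermondeSeries d = ∑ σ : Equiv.Perm (Fin d), (Equiv.Perm.sign σ : ℤ) •
      monomial (expo fun i => staircase d (σ i)) (1 : ℂ) := by
  rw [vandermondeSeries, alternant_eq_sum, ← MvPolynomial.coeToMvPowerSeries.ringHom_apply, map_sum]
  refine Finset.sum_congr rfl fun σ _ => ?_
  rw [map_zsmul, MvPolynomial.coeToMvPowerSeries.ringHom_apply, MvPolynomial.coe_monomial]

theorem coeff_alternant (μ : Fin d → ℕ) (a : Fin d →₀ ℕ) :
    MvPolynomial.coeff a (alternant μ) = ∑ σ : Equiv.Perm (Fin d), (Equiv.Perm.sign σ : ℤ) •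
      if (expo fun i => μ (σ i)) = a then (1 : ℂ) else 0 := by
  classical
  rw [alternant_eq_sum, MvPolynomial.coeff_sum]
  refine Finset.sum_congr rfl fun σ _ => ?_
  rw [MvPolynomial.coeff_smul, MvPolynomial.coeff_monomial]

theorem degree_eq_of_coeff_alternant_ne_zero {μ : Fin d → ℕ} {a : Fin d →₀ ℕ}
    (h : MvPolynomial.coeff a (alternant μ) ≠ 0) : a.degree = ∑ i, μ i := by
  rw [coeff_alternant] at h
  obtain ⟨σ, -, hσ⟩ := Finset.exists_ne_zero_of_sum_ne_zero h
  have : (expo fun i => μ (σ i)) = a := by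
    by_contra h'
    rw [if_neg h', smul_zero] at hσ
    exact hσ rfl
  rw [← this, expo_degree, Equiv.sum_comp σ μ]

theorem strictAnti_add_staircase {l : Fin d → ℕ} (hl : Antitone l) :
    StrictAnti (l + staircase d) := by
  intro i j hij
  have h1 := hl hij.le
  have h2 : (i : ℕ) < j := hij
  have h3 := j.2
  simp only [Pi.add_apply, staircase]
  omega

theorem exists_add_staircase {b : Fin d → ℕ} (hb : StrictAnti b) :
    ∃ l : Fin d → ℕ, Antitone l ∧ b = l + staircase d := by
  have key : ∀ k : ℕ, ∀ i j : Fin d, (j : ℕ) = i + k → b j + k ≤ b i := by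
    intro k
    induction k with
    | zero => intro i j h; have : i = j := Fin.ext (by omega); subst this; simp
    | succ k ih =>
      intro i j h
      have h1 := ih i ⟨i + k, by omega⟩ rfl
      have h2 : b j < b ⟨i + k, by omega⟩ := hb (by rw [Fin.lt_def]; simp; omega)
      omega
  refine ⟨fun i => b i - staircase d i, ?_, ?_⟩
  · intro i j hij
    have h1 := key (j - i) i j (by have : (i : ℕ) ≤ j := hij; omega)
    have h2 : (i : ℕ) ≤ j := hij
    have h3 := j.2
    simp only [staircase]
    omega
  · funext i
    have h1 := key (d - 1 - i) i ⟨d - 1, by have := i.2; omega⟩ (by have := i.2; simp; omega)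
    simp only [Pi.add_apply, staircase]
    omega

theorem eq_one_of_strictAnti_comp {b : Fin d → ℕ} (hb : StrictAnti b) {σ : Equiv.Perm (Fin d)}
    (h : StrictAnti (b ∘ σ)) : σ = 1 := by
  have hσ : StrictMono σ := fun i j hij => hb.lt_iff_gt.1 (h hij)
  have := Subsingleton.elim (hσ.orderIsoOfSurjective σ σ.surjective) (OrderIso.refl (Fin d))
  ext i
  exact congrArg Fin.val (DFunLike.congr_fun this i)

/-- Both exponents are strictly decreasing, and the only strictly decreasing rearrangement of `l +
δ` is itself. This is the orthogonality by which Schur coefficients are read off. -/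
theorem coeff_alternant_add_staircase {l μ : Fin d → ℕ} (hl : Antitone l) (hμ : Antitone μ) :
    MvPolynomial.coeff (expo (μ + staircase d)) (alternant (l + staircase d)) =
      if l = μ then 1 else 0 := by
  rw [coeff_alternant, Finset.sum_eq_single 1]
  · rw [Equiv.Perm.sign_one, Units.val_one, one_smul]
    refine if_congr ?_ rfl rfl
    rw [Equiv.apply_eq_iff_eq]
    exact add_left_inj (staircase d)
  · intro σ _ hσ
    rw [if_neg, smul_zero]
    intro h
    rw [Equiv.apply_eq_iff_eq] at h
    apply hσ
    refine eq_one_of_strictAnti_comp (strictAnti_add_staircase hl) (?_ : StrictAnti fun i => _)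
    rw [Function.comp_def, h]
    exact strictAnti_add_staircase hμ
  · simp

/-- The functions of exponent vectors that change by the sign under permutations. -/
def IsAlternatingFun (A : (Fin d → ℕ) → ℂ) : Prop :=
  ∀ (σ : Equiv.Perm (Fin d)) (b : Fin d → ℕ), A (b ∘ σ) = ((Equiv.Perm.sign σ : ℤ) : ℂ) * A b

theorem IsAlternatingFun.eq_zero_of_not_injective {A : (Fin d → ℕ) → ℂ} (hA : IsAlternatingFun A)
    {b : Fin d → ℕ} (hb : ¬ Function.Injective b) : A b = 0 := by
  simp only [Function.Injective, not_forall] at hb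
  obtain ⟨i, j, hij, hne⟩ := hb
  have h := hA (Equiv.swap i j) b
  have hb : b ∘ Equiv.swap i j = b := by
    funext x
    simp only [Function.comp, Equiv.swap_apply_def]
    split_ifs with h1 h2
    · rw [h1, hij]
    · rw [h2, hij]
    · rfl
  rw [hb, Equiv.Perm.sign_swap hne] at h
  simp only [Units.val_neg, Units.val_one, Int.cast_neg, Int.cast_one, neg_mul, one_mul] at h
  exact self_eq_neg.1 h

theorem IsAlternatingFun.eq_zero {A : (Fin d → ℕ) → ℂ} (hA : IsAlternatingFun A)
    (h : ∀ μ : Fin d → ℕ, Antitone μ → A (μ + staircase d) = 0) (b : Fin d → ℕ) : A b = 0 := by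
  by_cases hb : Function.Injective b
  · let σ : Equiv.Perm (Fin d) := Fin.revPerm.trans (Tuple.sort b)
    have hσ : StrictAnti (b ∘ σ) := by
      have hm : Monotone (b ∘ Tuple.sort b) := Tuple.monotone_sort b
      have hs : StrictMono (b ∘ Tuple.sort b) :=
        hm.strictMono_of_injective (hb.comp (Tuple.sort b).injective)
      intro i j hij
      exact hs (Fin.rev_lt_rev.2 hij)
    obtain ⟨μ, hμ, he⟩ := exists_add_staircase hσ
    have h1 := hA σ b
    rw [he, h μ hμ] at h1
    rcases Int.units_eq_one_or (Equiv.Perm.sign σ) with h2 | h2 <;> simpa [h2] using h1.symm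
  · exact hA.eq_zero_of_not_injective hb

/-! ### Series invariant under permutations of the variables. -/

theorem coeff_equivMapDomain_rename (σ : Equiv.Perm (Fin d)) (f : MvPowerSeries (Fin d) ℂ)
    (a : Fin d →₀ ℕ) : coeff (Finsupp.equivMapDomain σ a) (rename σ f) = coeff a f := by
  have h := coeff_embDomain_rename σ.toEmbedding f a
  rw [Finsupp.embDomain_eq_mapDomain] at h
  rwa [Finsupp.equivMapDomain_eq_mapDomain]

theorem isSymmetricSeries_iff {f : MvPowerSeries (Fin d) ℂ} :
    IsSymmetricSeries f ↔ ∀ σ : Equiv.Perm (Fin d), rename σ f = f := by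
  refine forall_congr' fun σ => ⟨fun h => ?_, fun h a => ?_⟩
  · ext a
    have h1 := coeff_equivMapDomain_rename σ f (Finsupp.equivMapDomain σ.symm a)
    rw [← Finsupp.equivMapDomain_trans, Equiv.symm_trans_self, Finsupp.equivMapDomain_refl] at h1
    rw [h1, ← h, ← Finsupp.equivMapDomain_trans, Equiv.symm_trans_self,
      Finsupp.equivMapDomain_refl]
  · rw [← coeff_equivMapDomain_rename σ f a, h]

theorem IsSymmetricSeries.mul {f g : MvPowerSeries (Fin d) ℂ} (hf : IsSymmetricSeries f)
    (hg : IsSymmetricSeries g) : IsSymmetricSeries (f * g) := by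
  rw [isSymmetricSeries_iff] at *
  intro σ
  rw [map_mul, hf, hg]

theorem IsSymmetricSeries.add {f g : MvPowerSeries (Fin d) ℂ} (hf : IsSymmetricSeries f)
    (hg : IsSymmetricSeries g) : IsSymmetricSeries (f + g) := by
  rw [isSymmetricSeries_iff] at *
  intro σ
  rw [map_add, hf, hg]

theorem IsSymmetricSeries.smul {f : MvPowerSeries (Fin d) ℂ} (c : ℂ) (hf : IsSymmetricSeries f) :
    IsSymmetricSeries (c • f) := by
  rw [isSymmetricSeries_iff] at *
  intro σ
  rw [map_smul, hf]

theorem isSymmetricSeries_one : IsSymmetricSeries (1 : MvPowerSeries (Fin d) ℂ) := by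
  rw [isSymmetricSeries_iff]
  intro σ
  rw [map_one]

theorem rename_vandermondeSeries (σ : Equiv.Perm (Fin d)) :
    rename σ (vandermondeSeries d) =
      ((Equiv.Perm.sign σ : ℤ) : ℂ) • vandermondeSeries d := by
  rw [vandermondeSeries, rename_coe, rename_alternant]
  rcases Int.units_eq_one_or (Equiv.Perm.sign σ) with h | h <;> simp [h, ← MvPolynomial.coeToMvPowerSeries.ringHom_apply]

theorem IsSymmetricSeries.isAlternatingFun_mul {f : MvPowerSeries (Fin d) ℂ}
    (hf : IsSymmetricSeries f) :
    IsAlternatingFun fun b => coeff (expo b) (f * vandermondeSeries d) := by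
  intro σ b
  rw [isSymmetricSeries_iff] at hf
  have h := coeff_equivMapDomain_rename σ (f * vandermondeSeries d) (expo (b ∘ σ))
  have h1 : Finsupp.equivMapDomain σ (expo (b ∘ σ)) = expo b := by
    ext i; simp [Finsupp.equivMapDomain_apply]
  beta_reduce
  rw [← h, h1, map_mul, hf, rename_vandermondeSeries, mul_smul_comm, map_smul, smul_eq_mul]

/-- The difference times `V(δ)` is alternating, hence determined by its coefficients at strictly
decreasing exponents. Power series form a domain, so `V(δ)` can be cancelled. -/
theorem IsSymmetricSeries.ext {f g : MvPowerSeries (Fin d) ℂ} (hf : IsSymmetricSeries f)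
    (hg : IsSymmetricSeries g) (h : ∀ μ : Fin d → ℕ, Antitone μ →
      coeff (expo (μ + staircase d)) (f * vandermondeSeries d) =
        coeff (expo (μ + staircase d)) (g * vandermondeSeries d)) : f = g := by
  rw [← sub_eq_zero]
  have hs : IsSymmetricSeries (f - g) := by
    rw [sub_eq_add_neg, ← neg_one_smul ℂ g]
    exact hf.add (hg.smul _)
  have h0 := hs.isAlternatingFun_mul.eq_zero fun μ hμ => by
    rw [sub_mul, map_sub, h μ hμ, sub_self]
  refine (mul_eq_zero.1 (?_ : (f - g) * vandermondeSeries d = 0)).resolve_right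
    vandermondeSeries_ne_zero
  ext a
  rw [← expo_coe a, h0, coeff_zero]

/-! ### Schur expansions and the recovery of multiplicities. -/

theorem coeff_schurSeries (h : partitionSeries d) (a : Fin d →₀ ℕ) :
    coeff a (schurSeries h) = ∑ l ∈ partitionsOf d a.degree,
      coeff (expo l) (h : MvPowerSeries (Fin d) ℂ) * MvPolynomial.coeff a (schurFunction l) := rfl

theorem mem_partitionsOf {q : ℕ} {l : Fin d → ℕ} :
    l ∈ partitionsOf d q ↔ ∑ i, l i = q ∧ Antitone l := by
  classical
  rw [partitionsOf, Finset.mem_filter, Finset.Nat.mem_antidiagonalTuple]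

theorem isSymmetricSeries_schurSeries (h : partitionSeries d) :
    IsSymmetricSeries (schurSeries h) := by
  intro σ a
  rw [coeff_schurSeries, coeff_schurSeries]
  have hd : (Finsupp.equivMapDomain σ a).degree = a.degree := by
    simp only [Finsupp.degree_eq_sum, Finsupp.equivMapDomain_apply]
    exact Equiv.sum_comp σ.symm a
  rw [hd]
  refine Finset.sum_congr rfl fun l _ => ?_
  rw [Finsupp.equivMapDomain_eq_mapDomain]
  nth_rw 1 [← rename_schurFunction σ l]
  rw [MvPolynomial.coeff_rename_mapDomain _ σ.injective]

theorem coeff_schurSeries_mul (h : partitionSeries d) {μ : Fin d → ℕ} (hμ : Antitone μ) :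
    coeff (expo (μ + staircase d)) (schurSeries h * vandermondeSeries d) =
      coeff (expo μ) (h : MvPowerSeries (Fin d) ℂ) := by
  classical
  -- As `V(δ)` is homogeneous of degree `|δ|`, every surviving pair has a first exponent of degree
  -- `|μ|`. The index set of `schurSeries`, which depends on that degree, thus becomes constant.
  have h1 : ∀ p ∈ Finset.HasAntidiagonal.antidiagonal (expo (μ + staircase d)),
      coeff p.1 (schurSeries h) * coeff p.2 (vandermondeSeries d) =
        ∑ l ∈ partitionsOf d (∑ i, μ i), coeff (expo l) (h : MvPowerSeries (Fin d) ℂ) *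
          (MvPolynomial.coeff p.1 (schurFunction l) *
            MvPolynomial.coeff p.2 (alternant (staircase d))) := by
    intro p hp
    rw [coeff_schurSeries, vandermondeSeries, MvPolynomial.coeff_coe]
    by_cases h0 : MvPolynomial.coeff p.2 (alternant (staircase d)) = 0
    · simp [h0]
    · have hdeg := degree_eq_of_coeff_alternant_ne_zero h0
      have hsum := congrArg Finsupp.degree (Finset.HasAntidiagonal.mem_antidiagonal.1 hp)
      rw [map_add, hdeg, expo_degree] at hsum
      simp only [Pi.add_apply, Finset.sum_add_distrib, add_left_inj] at hsum
      rw [hsum, Finset.sum_mul]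
      simp only [mul_assoc]
  rw [coeff_mul, Finset.sum_congr rfl h1, Finset.sum_comm]
  simp only [← Finset.mul_sum, ← MvPolynomial.coeff_mul, schurFunction_mul]
  rw [Finset.sum_eq_single μ]
  · rw [coeff_alternant_add_staircase hμ hμ, if_pos rfl, mul_one]
  · intro l hl hne
    rw [coeff_alternant_add_staircase (mem_partitionsOf.1 hl).2 hμ, if_neg hne, mul_zero]
  · intro h
    exact absurd (mem_partitionsOf.2 ⟨rfl, hμ⟩) h

theorem partitionSeries_ext {h h' : partitionSeries d}
    (H : ∀ μ : Fin d → ℕ, Antitone μ → coeff (expo μ) (h : MvPowerSeries (Fin d) ℂ) =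
      coeff (expo μ) (h' : MvPowerSeries (Fin d) ℂ)) : h = h' := by
  refine Subtype.ext (MvPowerSeries.ext fun a => ?_)
  by_cases ha : Antitone a
  · rw [← expo_coe a, H a ha]
  · rw [h.2 a ha, h'.2 a ha]

theorem schurSeries_injective : Function.Injective (schurSeries (d := d)) := by
  intro h h' H
  refine partitionSeries_ext fun μ hμ => ?_
  rw [← coeff_schurSeries_mul h hμ, H, coeff_schurSeries_mul h' hμ]

theorem schurSeries_multiplicitySeries {f : MvPowerSeries (Fin d) ℂ} (hf : IsSymmetricSeries f) :
    schurSeries (multiplicitySeries f) = f := by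
  classical
  -- The witness takes its coefficient at `μ` from `f · V(δ)` at `μ + δ`.
  refine Classical.epsilon_spec (p := fun h => schurSeries h = f) ⟨⟨fun a => if Antitone a then
    coeff (expo (⇑a + staircase d)) (f * vandermondeSeries d) else 0, fun a ha => if_neg ha⟩, ?_⟩
  refine (isSymmetricSeries_schurSeries _).ext hf fun μ hμ => ?_
  rw [coeff_schurSeries_mul _ hμ]
  exact if_pos (c := Antitone (expo μ)) hμ

theorem coeff_multiplicitySeries {f : MvPowerSeries (Fin d) ℂ} (hf : IsSymmetricSeries f)
    {μ : Fin d → ℕ} (hμ : Antitone μ) :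
    coeff (expo μ) (multiplicitySeries f : MvPowerSeries (Fin d) ℂ) =
      coeff (expo (μ + staircase d)) (f * vandermondeSeries d) := by
  rw [← coeff_schurSeries_mul _ hμ, schurSeries_multiplicitySeries hf]

theorem schurSeries_add (h h' : partitionSeries d) :
    schurSeries (h + h') = schurSeries h + schurSeries h' := by
  ext a
  simp only [map_add, coeff_schurSeries, Submodule.coe_add, add_mul, Finset.sum_add_distrib]

theorem schurSeries_smul (c : ℂ) (h : partitionSeries d) :
    schurSeries (c • h) = c • schurSeries h := by
  ext a
  simp only [map_smul, coeff_schurSeries, Submodule.coe_smul, smul_eq_mul, Finset.mul_sum,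
    mul_assoc]

end SymmetricSeries

/-! ### The Young-derived series -/

section YoungDerived

variable {d : ℕ}

theorem coeff_prod_one_sub_X_inv (s : Finset (Fin d)) (a : Fin d →₀ ℕ) :
    coeff a (∏ i ∈ s, (1 - X i : MvPowerSeries (Fin d) ℂ)⁻¹) = if a.support ⊆ s then 1 else 0 := by
  classical
  induction s using Finset.induction_on generalizing a with
  | empty => simp [coeff_one]
  | insert i s hi ih =>
    let F : MvPowerSeries (Fin d) ℂ := fun a => if a.support ⊆ insert i s then 1 else 0
    have hF : ∀ a, coeff a F = if a.support ⊆ insert i s then 1 else 0 := fun a => rfl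
    have key : F = ∏ j ∈ insert i s, (1 - X j : MvPowerSeries (Fin d) ℂ)⁻¹ := by
      rw [Finset.prod_insert hi, mul_comm, MvPowerSeries.eq_mul_inv_iff_mul_eq (by simp)]
      ext b
      rw [mul_sub, mul_one, map_sub, ih, hF, X, coeff_mul_monomial, mul_one, hF]
      have h1 : Finsupp.single i 1 ≤ b ↔ b i ≠ 0 := by
        rw [Finsupp.single_le_iff, Nat.one_le_iff_ne_zero]
      have h2 : b i ≠ 0 → ((b - Finsupp.single i 1).support ⊆ insert i s ↔
          b.support ⊆ insert i s) := by
        intro hb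
        simp only [Finset.subset_iff, Finsupp.mem_support_iff, Finset.mem_insert]
        refine forall_congr' fun x => ?_
        by_cases hx : x = i
        · simp [hx]
        · simp [hx]
      have h3 : b i = 0 → (b.support ⊆ insert i s ↔ b.support ⊆ s) := by
        intro hb
        rw [Finset.subset_insert_iff_of_notMem (by simpa using hb)]
      by_cases hb : b i = 0
      · rw [if_neg (mt h1.1 (not_not.2 hb)), sub_zero]
        exact if_congr (h3 hb) rfl rfl
      · rw [if_pos (h1.2 hb), if_congr (h2 hb) rfl rfl, sub_self, if_neg]
        exact fun h => hi (h (Finsupp.mem_support_iff.2 hb))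
    rw [← key, hF]

theorem coeff_geomProd (a : Fin d →₀ ℕ) : coeff a (geomProd d) = 1 := by
  rw [geomProd, coeff_prod_one_sub_X_inv, if_pos (Finset.subset_univ _)]

theorem isSymmetricSeries_geomProd : IsSymmetricSeries (geomProd d) := fun σ a => by
  rw [coeff_geomProd, coeff_geomProd]

theorem sum_antidiagonal_fst {M : Type*} [AddCommMonoid M] (a : Fin d →₀ ℕ)
    (F : (Fin d →₀ ℕ) → M) :
    ∑ p ∈ Finset.HasAntidiagonal.antidiagonal a, F p.1 = ∑ b ∈ Finset.Iic a, F b := by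
  refine Finset.sum_nbij Prod.fst ?_ ?_ ?_ fun _ _ => rfl
  · intro p hp
    rw [Finset.mem_Iic, ← Finset.HasAntidiagonal.mem_antidiagonal.1 hp]
    exact le_self_add
  · rintro ⟨p, q⟩ hp ⟨p', q'⟩ hp' h
    simp only [Finset.mem_coe, Finset.HasAntidiagonal.mem_antidiagonal] at hp hp' h
    subst h
    rw [Prod.mk.injEq]
    exact ⟨rfl, add_left_cancel (hp.trans hp'.symm)⟩
  · intro b hb
    refine ⟨(b, a - b), ?_, rfl⟩
    rw [Finset.mem_coe, Finset.HasAntidiagonal.mem_antidiagonal]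
    exact add_tsub_cancel_of_le (Finset.mem_Iic.1 hb)

theorem sum_Iic_expo {M : Type*} [AddCommMonoid M] (m : Fin d → ℕ) (F : (Fin d →₀ ℕ) → M) :
    ∑ b ∈ Finset.Iic (expo m), F b =
      ∑ b ∈ Fintype.piFinset fun i => Finset.Iic (m i), F (expo b) := by
  refine Finset.sum_nbij' (fun b => ⇑b) expo ?_ ?_ ?_ ?_ ?_
  · intro b hb
    simp only [Fintype.mem_piFinset, Finset.mem_Iic] at hb ⊢
    exact fun i => hb i
  · intro b hb
    simp only [Fintype.mem_piFinset, Finset.mem_Iic] at hb ⊢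
    exact fun i => hb i
  · intro b _
    exact expo_coe b
  · intro b _
    rfl
  · intro b _
    rw [expo_coe]

theorem coeff_mul_geomProd (f : MvPowerSeries (Fin d) ℂ) (a : Fin d →₀ ℕ) :
    coeff a (f * geomProd d) = ∑ b ∈ Finset.Iic a, coeff b f := by
  classical
  rw [coeff_mul, ← sum_antidiagonal_fst]
  refine Finset.sum_congr rfl fun p _ => ?_
  rw [coeff_geomProd, mul_one]

/-- The conditions `m_{i+1} < b_i` are imposed one position at a time. Terms violating the one at
position `k` have both `b_k` and `b_{k+1}` at most `m_{k+1}`, so exchanging these two entries stays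
in the box, leaves the earlier conditions alone and changes the sign of `A`. -/
theorem IsAlternatingFun.sum_filter {A : (Fin d → ℕ) → ℂ} (hA : IsAlternatingFun A)
    {m : Fin d → ℕ} (hm : Antitone m) (k : ℕ) :
    ∑ b ∈ (Fintype.piFinset fun i => Finset.Iic (m i)) with
      ∀ i : Fin d, (i : ℕ) < k → ∀ h : (i : ℕ) + 1 < d, m ⟨i + 1, h⟩ < b i, A b =
    ∑ b ∈ Fintype.piFinset fun i => Finset.Iic (m i), A b := by
  classical
  induction k with
  | zero => simp
  | succ k ih =>
    rw [← ih]
    by_cases hk : k + 1 < d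
    swap
    · refine Finset.sum_congr (Finset.filter_congr fun b _ => ?_) fun _ _ => rfl
      refine forall_congr' fun i => ⟨fun h h1 => h (by omega), fun h h1 h2 => h (by omega) h2⟩
    let x : Fin d := ⟨k, by omega⟩
    let y : Fin d := ⟨k + 1, hk⟩
    have hxy : x ≠ y := by simp [x, y, Fin.ext_iff]
    rw [← Finset.sum_filter_add_sum_filter_not (Finset.filter (fun b : Fin d → ℕ =>
      ∀ i : Fin d, (i : ℕ) < k → ∀ h : (i : ℕ) + 1 < d, m ⟨i + 1, h⟩ < b i) _)
      (fun b => m y < b x)]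
    rw [Finset.filter_filter, Finset.filter_filter]
    have h0 : ∑ b ∈ (Fintype.piFinset fun i => Finset.Iic (m i)) with
        (∀ i : Fin d, (i : ℕ) < k → ∀ h : (i : ℕ) + 1 < d, m ⟨i + 1, h⟩ < b i) ∧ ¬ m y < b x,
        A b = 0 := by
      refine Finset.sum_involution (fun b _ => b ∘ Equiv.swap x y) ?_ ?_ ?_ ?_
      · intro b _
        rw [hA, Equiv.Perm.sign_swap hxy]
        simp
      -- A fixed point of the exchange has two equal entries, where an alternating function is zero.
      · intro b _ hb h
        refine hb (hA.eq_zero_of_not_injective fun hinj => hxy ?_)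
        have := congrFun h x
        simp only [Function.comp, Equiv.swap_apply_left] at this
        exact (hinj this).symm
      · intro b hb
        simp only [Finset.mem_filter, Fintype.mem_piFinset, Finset.mem_Iic, not_lt,
          Function.comp] at hb ⊢
        obtain ⟨h1, h2, h3⟩ := hb
        refine ⟨fun i => ?_, fun i hi h => ?_, ?_⟩
        · rw [Equiv.swap_apply_def]
          split_ifs with h4 h5
          · rw [h4]
            exact (h1 y).trans (hm (by simp [x, y, Fin.le_def]))
          · rw [h5]
            exact h3
          · exact h1 i
        · rw [Equiv.swap_apply_of_ne_of_ne (by simp [x, Fin.ext_iff]; omega)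
            (by simp [y, Fin.ext_iff]; omega)]
          exact h2 i hi h
        · rw [Equiv.swap_apply_left]
          exact h1 y
      · intro b _
        funext i
        simp
    rw [h0, add_zero]
    refine Finset.sum_congr (Finset.filter_congr fun b _ => ⟨fun h => ⟨fun i hi => h i (by omega),
      h x (by simp [x]) hk⟩, fun h i hi h' => ?_⟩) fun _ _ => rfl
    by_cases hik : (i : ℕ) = k
    · have : i = x := Fin.ext hik
      subst this
      exact h.2
    · exact h.1 i (by omega) h'

/-- The partitions `ν` such that `μ / ν` is a horizontal strip. -/
def horizontalStrips (μ : Fin d → ℕ) : Finset (Fin d → ℕ) :=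
  (Fintype.piFinset fun i => Finset.Iic (μ i)).filter
    fun ν => ∀ i : Fin d, ∀ h : (i : ℕ) + 1 < d, μ ⟨i + 1, h⟩ ≤ ν i

theorem mem_horizontalStrips {μ ν : Fin d → ℕ} : ν ∈ horizontalStrips μ ↔
    (∀ i, ν i ≤ μ i) ∧ ∀ i : Fin d, ∀ h : (i : ℕ) + 1 < d, μ ⟨i + 1, h⟩ ≤ ν i := by
  simp [horizontalStrips]

theorem antitone_of_mem_horizontalStrips {μ ν : Fin d → ℕ} (h : ν ∈ horizontalStrips μ) :
    Antitone ν := by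
  rw [mem_horizontalStrips] at h
  cases d with
  | zero => exact fun i => i.elim0
  | succ d =>
    rw [Fin.antitone_iff_succ_le]
    intro i
    exact (h.1 _).trans (h.2 i.castSucc (by simp))

/-- After the cancellation `m_{i+1} < b_i ≤ m_i` with `m = μ + δ`. Since `δ_i = δ_{i+1} + 1`,
subtracting `δ` gives exactly the interlacing `μ_{i+1} ≤ ν_i ≤ μ_i`. -/
theorem IsAlternatingFun.sum_piFinset {A : (Fin d → ℕ) → ℂ} (hA : IsAlternatingFun A)
    {μ : Fin d → ℕ} (hμ : Antitone μ) :
    ∑ b ∈ Fintype.piFinset (fun i => Finset.Iic ((μ + staircase d) i)), A b =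
      ∑ ν ∈ horizontalStrips μ, A (ν + staircase d) := by
  classical
  rw [← hA.sum_filter (strictAnti_add_staircase hμ).antitone d, eq_comm]
  refine Finset.sum_nbij (fun ν => ν + staircase d) ?_ ?_ ?_ fun _ _ => rfl
  · intro ν hν
    rw [mem_horizontalStrips] at hν
    refine Finset.mem_filter.2 ⟨Fintype.mem_piFinset.2 fun i =>
      Finset.mem_Iic.2 (add_le_add_left (hν.1 i) _), fun i _ h => ?_⟩
    have := hν.2 i h
    simp only [Pi.add_apply, staircase]
    omega
  · intro ν _ ν' _ h
    exact add_right_cancel h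
  · intro b hb
    simp only [Finset.coe_filter, Set.mem_ofPred_eq, Fintype.mem_piFinset, Finset.mem_Iic] at hb
    have hb' : StrictAnti b := by
      cases d with
      | zero => exact fun i => i.elim0
      | succ d =>
        rw [Fin.strictAnti_iff_succ_lt]
        intro i
        exact (hb.1 _).trans_lt (hb.2 i.castSucc (by simp) (by simp))
    obtain ⟨ν, -, rfl⟩ := exists_add_staircase hb'
    refine ⟨ν, ?_, rfl⟩
    rw [Finset.mem_coe, mem_horizontalStrips]
    simp only [Pi.add_apply, add_le_add_iff_right, staircase] at hb
    refine ⟨hb.1, fun i h => ?_⟩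
    have := hb.2 i i.2 h
    omega

theorem IsSymmetricSeries.coeff_mul_geomProd_mul {f : MvPowerSeries (Fin d) ℂ}
    (hf : IsSymmetricSeries f) {μ : Fin d → ℕ} (hμ : Antitone μ) :
    coeff (expo (μ + staircase d)) (f * geomProd d * vandermondeSeries d) =
      ∑ ν ∈ horizontalStrips μ, coeff (expo (ν + staircase d)) (f * vandermondeSeries d) := by
  rw [mul_right_comm, coeff_mul_geomProd, sum_Iic_expo,
    hf.isAlternatingFun_mul.sum_piFinset hμ]

theorem schurSeries_youngOperator (h : partitionSeries d) :
    schurSeries (youngOperator h) = schurSeries h * geomProd d :=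
  schurSeries_multiplicitySeries ((isSymmetricSeries_schurSeries h).mul isSymmetricSeries_geomProd)

/-- The Pieri rule summed over all degrees: multiplication by `geomProd` adds up the coefficients of
`f · V(δ)` over a box, and only horizontal strips survive. -/
theorem coeff_youngOperator (h : partitionSeries d) {μ : Fin d → ℕ} (hμ : Antitone μ) :
    coeff (expo μ) (youngOperator h : MvPowerSeries (Fin d) ℂ) =
      ∑ ν ∈ horizontalStrips μ, coeff (expo ν) (h : MvPowerSeries (Fin d) ℂ) := by
  rw [← coeff_schurSeries_mul _ hμ, schurSeries_youngOperator,
    (isSymmetricSeries_schurSeries h).coeff_mul_geomProd_mul hμ]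
  exact Finset.sum_congr rfl fun ν hν =>
    coeff_schurSeries_mul h (antitone_of_mem_horizontalStrips hν)

theorem isLinearMap_youngOperator :
    IsLinearMap ℂ (youngOperator : partitionSeries d → partitionSeries d) where
  map_add h h' := schurSeries_injective (by
    rw [schurSeries_youngOperator, schurSeries_add, schurSeries_add, schurSeries_youngOperator,
      schurSeries_youngOperator, add_mul])
  map_smul c h := schurSeries_injective (by
    rw [schurSeries_youngOperator, schurSeries_smul, schurSeries_smul, schurSeries_youngOperator,
      smul_mul_assoc])

theorem youngOperator_multiplicitySeries {g : MvPowerSeries (Fin d) ℂ} (hg : IsSymmetricSeries g) :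
    youngOperator (multiplicitySeries g) = multiplicitySeries (g * geomProd d) := by
  rw [youngOperator, schurSeries_multiplicitySeries hg]

theorem schurSeries_youngOperator_iterate (h : partitionSeries d) (j : ℕ) :
    schurSeries (youngOperator^[j] h) = schurSeries h * geomProd d ^ j := by
  induction j with
  | zero => simp
  | succ j ih => rw [Function.iterate_succ_apply', schurSeries_youngOperator, ih, pow_succ, mul_assoc]

end YoungDerived

/-! ### The explicit form of the Young operator -/

section Explicit

variable {d : ℕ}

/-- The partition `l` with `v_1^{b_1} ⋯ v_d^{b_d} = T_d^l`. -/
def tailSum (b : Fin d → ℕ) (i : Fin d) : ℕ := ∑ j ∈ Finset.Ici i, b j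

theorem tailSum_eq_add (b : Fin d → ℕ) (i : Fin d) :
    tailSum b i = b i + if h : (i : ℕ) + 1 < d then tailSum b ⟨i + 1, h⟩ else 0 := by
  classical
  have h1 : Finset.Ici i = insert i (Finset.Ioi i) := by
    ext j; simp [le_iff_eq_or_lt]
  rw [tailSum, h1, Finset.sum_insert (by simp)]
  congr 1
  split_ifs with h
  · rw [tailSum]
    refine Finset.sum_congr ?_ fun _ _ => rfl
    ext j
    simp only [Finset.mem_Ioi, Finset.mem_Ici, Fin.lt_def, Fin.le_def]
    omega
  · refine Finset.sum_eq_zero fun j hj => ?_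
    have := j.2
    rw [Finset.mem_Ioi, Fin.lt_def] at hj
    omega

theorem antitone_tailSum (b : Fin d → ℕ) : Antitone (tailSum b) := fun _ _ hij =>
  Finset.sum_le_sum_of_subset (Finset.Ici_subset_Ici.2 hij)

theorem tailSum_injective : Function.Injective (tailSum (d := d)) := by
  intro b b' h
  funext i
  have h1 := tailSum_eq_add b i
  have h2 := tailSum_eq_add b' i
  rw [h] at h1
  omega

theorem exists_tailSum {l : Fin d → ℕ} (hl : Antitone l) :
    ∃ b : Fin d → ℕ, tailSum b = l := by
  refine ⟨fun i => l i - if h : (i : ℕ) + 1 < d then l ⟨i + 1, h⟩ else 0, ?_⟩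
  have key : ∀ k : ℕ, ∀ i : Fin d, (i : ℕ) + k = d → tailSum (fun i => l i -
      if h : (i : ℕ) + 1 < d then l ⟨i + 1, h⟩ else 0) i = l i := by
    intro k
    induction k with
    | zero => intro i hi; have := i.2; omega
    | succ k ih =>
      intro i hi
      rw [tailSum_eq_add]
      split_ifs with h
      · rw [ih _ (by simp only; omega)]
        have : l ⟨i + 1, h⟩ ≤ l i := hl (by simp [Fin.le_def])
        omega
      · omega
  funext i
  exact key (d - i) i (by have := i.2; omega)

/-- The exponent of the image of `T_d^l`, `l = tailSum b`, under the substitution `shiftSubst E`. -/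
def shiftExponent (E : Finset (Fin d)) (b : Fin d → ℕ) (j : Fin d) : ℕ :=
  tailSum b j + if j ∈ E then ∑ i : Fin d, if (j : ℕ) = i + 1 then b i else 0 else 0

theorem shiftSubst_monomial (E : Finset (Fin d)) (i : Fin d) :
    (∏ j ∈ Finset.Iic i, (X j : MvPowerSeries (Fin d) ℂ)) *
      ∏ j ∈ E with j.val = i.val + 1, X j =
    monomial (expo fun j => (if j ≤ i then 1 else 0) +
      if j ∈ E ∧ (j : ℕ) = i + 1 then 1 else 0) 1 := by
  classical
  have key : ∀ s : Finset (Fin d), ∏ j ∈ s, (X j : MvPowerSeries (Fin d) ℂ) =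
      monomial (expo fun j => if j ∈ s then 1 else 0) 1 := by
    intro s
    simp only [X]
    rw [prod_monomial, Finset.prod_const_one]
    congr 2
    ext j
    simp [Finsupp.finsetSum_apply, Finsupp.single_apply]
  rw [key, key, monomial_mul_monomial, mul_one]
  congr 2
  ext j
  simp

theorem coeff_shiftSubst (E : Finset (Fin d)) (h : partitionSeries d) {a e : Fin d →₀ ℕ}
    (he : e ≤ a) : coeff e (shiftSubst E h) = ∑ b ∈ Finset.Iic a,
      if shiftExponent E b = e then coeff b (inVariablesV h) else 0 := by
  classical
  have hs : HasSubst (fun i : Fin d => (∏ j ∈ Finset.Iic i, (X j : MvPowerSeries (Fin d) ℂ)) *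
      ∏ j ∈ E with j.val = i.val + 1, X j) := by
    refine hasSubst_of_constantCoeff_zero fun i => ?_
    rw [map_mul, map_prod, Finset.prod_eq_zero (Finset.mem_Iic.2 le_rfl) (constantCoeff_X i),
      zero_mul]
  rw [shiftSubst, coeff_subst hs]
  have h1 : ∀ b : Fin d →₀ ℕ, coeff b (inVariablesV h) • coeff e (b.prod fun i n =>
      ((∏ j ∈ Finset.Iic i, (X j : MvPowerSeries (Fin d) ℂ)) *
        ∏ j ∈ E with j.val = i.val + 1, X j) ^ n) =
      if shiftExponent E b = e then coeff b (inVariablesV h) else 0 := by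
    intro b
    have h2 : (b.prod fun i n => ((∏ j ∈ Finset.Iic i, (X j : MvPowerSeries (Fin d) ℂ)) *
        ∏ j ∈ E with j.val = i.val + 1, X j) ^ n) = monomial (expo (shiftExponent E b)) 1 := by
      rw [Finsupp.prod_fintype _ _ (by simp)]
      simp only [shiftSubst_monomial, monomial_pow, one_pow]
      rw [prod_monomial, Finset.prod_const_one]
      congr 2
      ext j
      rw [Finsupp.finsetSum_apply, Finsupp.equivFunOnFinite_symm_apply_apply, shiftExponent]
      simp only [Finsupp.smul_apply, Finsupp.equivFunOnFinite_symm_apply_apply, smul_eq_mul,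
        mul_add, Finset.sum_add_distrib]
      congr 1
      · simp only [mul_ite, mul_one, mul_zero]
        rw [← Finset.sum_filter, tailSum]
        refine Finset.sum_congr ?_ fun _ _ => rfl
        ext i; simp
      · by_cases hj : j ∈ E
        · simp [hj]
        · simp [hj]
    rw [h2, coeff_monomial, smul_eq_mul, mul_ite, mul_one, mul_zero]
    refine if_congr ?_ rfl rfl
    rw [eq_comm]
    exact Equiv.symm_apply_eq Finsupp.equivFunOnFinite
  rw [finsum_congr h1]
  -- The shifted exponent of `b` is at least `tailSum b`, hence at least `b`, so only `b ≤ e ≤ a`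
  -- contribute. The range is kept as `Iic a` so that one range serves all `e ≤ a`.
  refine finsum_eq_sum_of_support_subset _ fun b hb => ?_
  rw [Finset.coe_Iic, Set.mem_Iic]
  have hb' : shiftExponent E b = e := by
    by_contra h'
    exact hb (if_neg h')
  refine le_trans (fun i => ?_) he
  rw [← hb', shiftExponent, tailSum_eq_add]
  omega

/-- Adding `b_{j-1}` to the tail sum at `j` gives the tail sum at `j - 1`. Choosing `j ∈ E` thus
replaces the part `l_j` by `l_{j-1}` in the exponent. -/
theorem shiftExponent_apply (E : Finset (Fin d)) (b : Fin d → ℕ) (j : Fin d) (hj : 0 < (j : ℕ)) :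
    shiftExponent E b j = if j ∈ E then tailSum b ⟨j - 1, by omega⟩ else tailSum b j := by
  rw [shiftExponent]
  split_ifs with h
  · rw [tailSum_eq_add b ⟨j - 1, by omega⟩, Finset.sum_eq_single ⟨j - 1, by omega⟩]
    · have h1 : (j : ℕ) - 1 + 1 = j := by omega
      have h2 : ((⟨(j : ℕ) - 1 + 1, by omega⟩ : Fin d)) = j := Fin.ext h1
      simp only [h1, if_true]
      rw [dif_pos j.2, add_comm]
    · intro i _ hi
      rw [if_neg]
      intro h'
      exact hi (Fin.ext (by simp only; omega))
    · simp
  · rfl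

/-- Multiplication by `geomProd` sums over all exponents below `a`, so a monomial contributes its
coefficient exactly when its shifted exponent lies below `a`. -/
theorem coeff_geomProd_mul_shiftSubst (E : Finset (Fin d)) (h : partitionSeries d)
    (a : Fin d →₀ ℕ) :
    coeff a ((∏ i ∈ E, -(X i : MvPowerSeries (Fin d) ℂ)) * shiftSubst E h * geomProd d) =
      ∑ b ∈ Finset.Iic a, coeff b (inVariablesV h) * ((-1) ^ E.card *
        if ∀ j, shiftExponent E b j + (if j ∈ E then 1 else 0) ≤ a j then 1 else 0) := by
  classical
  have hX : (∏ i ∈ E, -(X i : MvPowerSeries (Fin d) ℂ)) =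
      monomial (expo fun j => if j ∈ E then 1 else 0) ((-1) ^ E.card) := by
    have : ∀ i : Fin d, -(X i : MvPowerSeries (Fin d) ℂ) = monomial (Finsupp.single i 1) (-1) := by
      intro i
      rw [X, ← map_neg]
    simp only [this]
    rw [prod_monomial, Finset.prod_const]
    congr 2
    ext j
    simp [Finsupp.finsetSum_apply, Finsupp.single_apply]
  set χ : Fin d →₀ ℕ := expo fun j => if j ∈ E then 1 else 0 with hχ
  rw [coeff_mul_geomProd]
  have h1 : ∀ c ∈ Finset.Iic a, coeff c ((∏ i ∈ E, -(X i : MvPowerSeries (Fin d) ℂ)) *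
      shiftSubst E h) = ∑ b ∈ Finset.Iic a, coeff b (inVariablesV h) * ((-1) ^ E.card *
        if c = expo (shiftExponent E b) + χ then 1 else 0) := by
    intro c hc
    rw [hX, coeff_monomial_mul]
    split_ifs with hle
    · rw [coeff_shiftSubst E h (tsub_le_self.trans (Finset.mem_Iic.1 hc)), Finset.mul_sum]
      refine Finset.sum_congr rfl fun b _ => ?_
      have : shiftExponent E b = ⇑(c - χ) ↔ c = expo (shiftExponent E b) + χ := by
        rw [← tsub_eq_iff_eq_add_of_le hle, eq_comm]
        exact DFunLike.coe_injective.eq_iff (a := c - χ) (b := expo (shiftExponent E b))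
      by_cases hb : c = expo (shiftExponent E b) + χ
      · rw [if_pos hb, if_pos (this.2 hb)]; ring
      · rw [if_neg hb, if_neg (mt this.1 hb)]; ring
    · rw [eq_comm]
      refine Finset.sum_eq_zero fun b _ => ?_
      rw [if_neg, mul_zero, mul_zero]
      rintro rfl
      exact hle le_add_self
  rw [Finset.sum_congr rfl h1, Finset.sum_comm]
  refine Finset.sum_congr rfl fun b _ => ?_
  rw [← Finset.mul_sum, ← Finset.mul_sum, Finset.sum_ite_eq']
  congr 2
  refine if_congr ?_ rfl rfl
  rw [Finset.mem_Iic]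
  rfl

/-- With `l = tailSum b`, the sum over `E` factors over the positions `j > 0` into `[l_j ≤ a_j] -
[l_{j-1} + 1 ≤ a_j]`. Since `l_j ≤ l_{j-1}`, this is `[l_j ≤ a_j ≤ l_{j-1}]`, the strip condition at
`j`. Position 0 contributes only its upper bound. -/
theorem sum_powerset_shiftExponent (a b : Fin d → ℕ) :
    ∑ E ∈ (Finset.univ.filter fun i : Fin d => 0 < i.val).powerset, (-1 : ℂ) ^ E.card *
      (if ∀ j, shiftExponent E b j + (if j ∈ E then 1 else 0) ≤ a j then 1 else 0) =
    if tailSum b ∈ horizontalStrips a then 1 else 0 := by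
  classical
  set P := Finset.univ.filter fun i : Fin d => 0 < i.val with hP
  -- At `j = 0` truncated subtraction gives `p 0 = tailSum b 0`. This value plays no role, since `P`
  -- contains only positive positions.
  let p : Fin d → ℕ := fun j => tailSum b ⟨j - 1, by omega⟩
  have hp : ∀ j, tailSum b j ≤ p j := fun j => antitone_tailSum b (by simp [Fin.le_def])
  have hE : ∀ E ∈ P.powerset, (-1 : ℂ) ^ E.card *
      (if ∀ j, shiftExponent E b j + (if j ∈ E then 1 else 0) ≤ a j then 1 else 0) =
      (if ∀ j : Fin d, ¬ 0 < (j : ℕ) → tailSum b j ≤ a j then 1 else 0) *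
      ((∏ j ∈ E, -(if p j + 1 ≤ a j then 1 else 0)) *
        ∏ j ∈ P \ E, if tailSum b j ≤ a j then 1 else 0) := by
    intro E hE
    rw [Finset.mem_powerset] at hE
    have hpos : ∀ j ∈ E, 0 < (j : ℕ) := fun j hj => (Finset.mem_filter.1 (hE hj)).2
    rw [Finset.prod_neg, mul_assoc, mul_left_comm]
    congr 1
    rw [Finset.prod_boole, Finset.prod_boole]
    have h1 : (∀ j, shiftExponent E b j + (if j ∈ E then 1 else 0) ≤ a j) ↔
        (∀ j : Fin d, ¬ 0 < (j : ℕ) → tailSum b j ≤ a j) ∧ (∀ j ∈ E, p j + 1 ≤ a j) ∧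
          ∀ j ∈ P \ E, tailSum b j ≤ a j := by
      have h0 : ∀ j : Fin d, (0 : ℕ) < j → shiftExponent E b j = if j ∈ E then p j else tailSum b j :=
        shiftExponent_apply E b
      have h0' : ∀ j : Fin d, ¬ (0 : ℕ) < j → shiftExponent E b j = tailSum b j := by
        intro j hj
        rw [shiftExponent, if_neg fun h => hj (hpos j h), add_zero]
      constructor
      · intro H
        refine ⟨fun j hj => ?_, fun j hj => ?_, fun j hj => ?_⟩
        · have := H j
          rwa [h0' j hj, if_neg fun h => hj (hpos j h), add_zero] at this
        · have := H j
          rwa [h0 j (hpos j hj), if_pos hj, if_pos hj] at this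
        · rw [Finset.mem_sdiff] at hj
          have := H j
          rwa [h0 j (Finset.mem_filter.1 hj.1).2, if_neg hj.2, if_neg hj.2, add_zero] at this
      · rintro ⟨H1, H2, H3⟩ j
        by_cases hj : 0 < (j : ℕ)
        · rw [h0 j hj]
          by_cases hjE : j ∈ E
          · rw [if_pos hjE, if_pos hjE]
            exact H2 j hjE
          · rw [if_neg hjE, if_neg hjE, add_zero]
            exact H3 j (Finset.mem_sdiff.2 ⟨Finset.mem_filter.2 ⟨Finset.mem_univ _, hj⟩, hjE⟩)
        · rw [h0' j hj, if_neg fun h => hj (hpos j h), add_zero]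
          exact H1 j hj
    simp only [h1, ite_and]
    split_ifs <;> simp
  rw [Finset.sum_congr rfl hE, ← Finset.mul_sum, ← Finset.prod_add]
  have h2 : ∀ j ∈ P, (-(if p j + 1 ≤ a j then 1 else 0) + if tailSum b j ≤ a j then 1 else 0 : ℂ) =
      if tailSum b j ≤ a j ∧ a j ≤ p j then 1 else 0 := by
    intro j _
    have := hp j
    split_ifs <;> first | omega | simp
  rw [Finset.prod_congr rfl h2, Finset.prod_boole]
  have h3 : tailSum b ∈ horizontalStrips a ↔
      (∀ j : Fin d, ¬ 0 < (j : ℕ) → tailSum b j ≤ a j) ∧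
        ∀ j ∈ P, tailSum b j ≤ a j ∧ a j ≤ p j := by
    rw [mem_horizontalStrips]
    constructor
    · rintro ⟨H1, H2⟩
      refine ⟨fun j _ => H1 j, fun j hj => ⟨H1 j, ?_⟩⟩
      have hj' : 0 < (j : ℕ) := (Finset.mem_filter.1 hj).2
      have := H2 ⟨j - 1, by omega⟩ (by simp only; omega)
      have h4 : (⟨(j : ℕ) - 1 + 1, by omega⟩ : Fin d) = j := Fin.ext (by simp only; omega)
      simpa only [h4] using this
    · rintro ⟨H1, H2⟩
      refine ⟨fun j => ?_, fun i h => ?_⟩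
      · by_cases hj : 0 < (j : ℕ)
        · exact (H2 j (Finset.mem_filter.2 ⟨Finset.mem_univ _, hj⟩)).1
        · exact H1 j hj
      · exact (H2 ⟨i + 1, h⟩ (Finset.mem_filter.2 ⟨Finset.mem_univ _, Nat.succ_pos _⟩)).2
  simp only [h3, ite_and]
  split_ifs <;> simp

theorem coeff_youngOperator_explicit (h : partitionSeries d) (a : Fin d →₀ ℕ) :
    coeff a (youngOperator h : MvPowerSeries (Fin d) ℂ) = ∑ b ∈ Finset.Iic a,
      coeff b (inVariablesV h) * if tailSum b ∈ horizontalStrips a then 1 else 0 := by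
  classical
  simp only [mul_ite, mul_one, mul_zero]
  rw [← Finset.sum_filter]
  by_cases ha : Antitone a
  · rw [← expo_coe a, coeff_youngOperator h ha]
    symm
    refine Finset.sum_nbij (fun b => tailSum b) ?_ ?_ ?_ ?_
    · intro b hb
      exact (Finset.mem_filter.1 hb).2
    · intro b _ b' _ hbb
      exact DFunLike.coe_injective (tailSum_injective hbb)
    · intro l hl
      obtain ⟨b, rfl⟩ := exists_tailSum (antitone_of_mem_horizontalStrips hl)
      refine ⟨expo b, ?_, rfl⟩
      simp only [Finset.coe_filter, Finset.mem_Iic, Set.mem_ofPred_eq]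
      refine ⟨fun i => ?_, hl⟩
      refine le_trans ?_ ((mem_horizontalStrips.1 hl).1 i)
      rw [tailSum_eq_add]
      exact Nat.le_add_right _ _
    · intro b _
      rfl
  -- Interlacing `a_{i+1} ≤ ν_i ≤ a_i` forces `a` to be antitone, so for other exponents the sum on
  -- the right is empty.
  · rw [(youngOperator h).2 a ha, eq_comm]
    refine Finset.sum_eq_zero fun b hb => absurd ?_ ha
    have h1 := mem_horizontalStrips.1 (Finset.mem_filter.1 hb).2
    clear hb
    cases d with
    | zero => exact fun i => i.elim0
    | succ d =>
      rw [Fin.antitone_iff_succ_le]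
      intro i
      exact (h1.2 i.castSucc (by simp)).trans (h1.1 _)

theorem youngOperator_explicit (h : partitionSeries d) :
    (youngOperator h : MvPowerSeries (Fin d) ℂ) =
      geomProd d * ∑ E ∈ (Finset.univ.filter fun i : Fin d => 0 < i.val).powerset,
        (∏ i ∈ E, -(MvPowerSeries.X i : MvPowerSeries (Fin d) ℂ)) * shiftSubst E h := by
  ext a
  rw [coeff_youngOperator_explicit, mul_comm, Finset.sum_mul, map_sum]
  simp only [coeff_geomProd_mul_shiftSubst]
  rw [Finset.sum_comm]
  simp only [← Finset.mul_sum, sum_powerset_shiftExponent]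

end Explicit

/-! ### Alternating sums over the symmetric group and the dominance order -/

section AltCoeff

variable {d : ℕ}

/-- The alternating sum `∑_σ sign(σ) f(l + δ - σ δ)`. -/
def altCoeff {A : Type*} [AddCommGroup A] (l : Fin d → ℕ) (f : (Fin d →₀ ℕ) → A) : A :=
  open Classical in ∑ σ : Equiv.Perm (Fin d), (Equiv.Perm.sign σ : ℤ) •
    if (expo fun i => staircase d (σ i)) ≤ expo (l + staircase d) then
      f (expo (l + staircase d) - expo fun i => staircase d (σ i)) else 0

/-- `altCoeff` is Schur coefficient extraction, phrased for functions with values in any abelian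
group so that it also applies to characters and dimensions. -/
theorem coeff_mul_vandermondeSeries (f : MvPowerSeries (Fin d) ℂ) (l : Fin d → ℕ) :
    coeff (expo (l + staircase d)) (f * vandermondeSeries d) = altCoeff l fun a => coeff a f := by
  classical
  rw [vandermondeSeries_eq_sum, Finset.mul_sum, map_sum, altCoeff]
  refine Finset.sum_congr rfl fun σ _ => ?_
  rw [mul_smul_comm, map_zsmul, coeff_mul_monomial, mul_one]

theorem map_altCoeff {A B : Type*} [AddCommGroup A] [AddCommGroup B] (φ : A →+ B)
    (l : Fin d → ℕ) (f : (Fin d →₀ ℕ) → A) :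
    φ (altCoeff l f) = altCoeff l fun a => φ (f a) := by
  simp only [altCoeff, map_sum, map_zsmul, apply_ite φ, map_zero]

theorem altCoeff_sum {A ι : Type*} [AddCommGroup A] (l : Fin d → ℕ) (s : Finset ι)
    (f : ι → (Fin d →₀ ℕ) → A) :
    altCoeff l (fun a => ∑ i ∈ s, f i a) = ∑ i ∈ s, altCoeff l (f i) := by
  simp only [altCoeff]
  rw [Finset.sum_comm]
  refine Finset.sum_congr rfl fun σ _ => ?_
  rw [← Finset.smul_sum]
  split_ifs <;> simp

theorem altCoeff_congr {A : Type*} [AddCommGroup A] {l : Fin d → ℕ} {f g : (Fin d →₀ ℕ) → A}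
    (h : ∀ a, a.degree = ∑ i, l i → f a = g a) : altCoeff l f = altCoeff l g := by
  simp only [altCoeff]
  refine Finset.sum_congr rfl fun σ _ => ?_
  split_ifs with hle
  · rw [h]
    have h1 := congrArg Finsupp.degree (tsub_add_cancel_of_le hle)
    rw [map_add, expo_degree, expo_degree, Equiv.sum_comp σ (staircase d)] at h1
    simpa [Finset.sum_add_distrib] using h1
  · rfl

/-- The sum of the first `m` entries. -/
def partialSum (b : Fin d → ℕ) (m : ℕ) : ℕ := ∑ i : Fin d with i.val < m, b i

theorem partialSum_zero (b : Fin d → ℕ) : partialSum b 0 = 0 := by simp [partialSum]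

theorem filter_lt_succ (k : Fin d) : Finset.univ.filter (fun i : Fin d => (i : ℕ) < k + 1) =
    insert k (Finset.univ.filter fun i : Fin d => (i : ℕ) < k) := by
  ext i
  simp only [Finset.mem_filter, Finset.mem_univ, true_and, Finset.mem_insert, Fin.ext_iff]
  omega

theorem partialSum_succ (b : Fin d → ℕ) (k : Fin d) :
    partialSum b (k + 1) = partialSum b k + b k := by
  rw [partialSum, filter_lt_succ, Finset.sum_insert (by simp), add_comm, partialSum]

theorem partialSum_eq_sum {b : Fin d → ℕ} {m : ℕ} (h : ∀ i : Fin d, m ≤ i → b i = 0) :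
    partialSum b m = ∑ i, b i := by
  rw [partialSum, Finset.sum_filter]
  refine Finset.sum_congr rfl fun i _ => ?_
  split_ifs with hi
  · rfl
  · rw [h i (by omega)]

/-- Suppose `σ` fixes all positions before `i`. Then `b` and `l` agree there, so the inequality at
`i + 1` gives `b_i ≤ l_i`, hence `σ i ≤ i`, and injectivity leaves only `σ i = i`. -/
theorem eq_one_of_partialSum_le {l b : Fin d → ℕ} {σ : Equiv.Perm (Fin d)}
    (h : ∀ i, b i + staircase d (σ i) = l i + staircase d i)
    (hb : ∀ m, partialSum b m ≤ partialSum l m) : σ = 1 := by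
  have key : ∀ k : ℕ, ∀ i : Fin d, (i : ℕ) < k → σ i = i := by
    intro k
    induction k with
    | zero => intro i hi; omega
    | succ k ih =>
      intro i hi
      by_cases hik : (i : ℕ) < k
      · exact ih i hik
      have hik' : (i : ℕ) = k := by omega
      subst hik'
      have h1 : partialSum b i = partialSum l i := by
        refine Finset.sum_congr rfl fun j hj => ?_
        have h2 := h j
        rw [ih j (Finset.mem_filter.1 hj).2] at h2
        omega
      have h2 := hb (i + 1)
      rw [partialSum_succ, partialSum_succ, h1] at h2
      have h3 := h i
      have h4 : (σ i : ℕ) ≤ i := by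
        simp only [staircase] at h3
        have := (σ i).2
        have := i.2
        omega
      rcases h4.lt_or_eq with h5 | h5
      · exact absurd (σ.injective (ih (σ i) h5)) (by simp [Fin.ext_iff]; omega)
      · exact Fin.ext h5
  ext i
  rw [key d i i.2]; rfl

/-- Unitriangularity: if `f` lives on exponents dominated by `l`, every term of the alternating sum
except the one of the identity vanishes. -/
theorem altCoeff_eq_of_partialSum_le {A : Type*} [AddCommGroup A] {l : Fin d → ℕ}
    {f : (Fin d →₀ ℕ) → A}
    (h : ∀ a, a.degree = ∑ i, l i → f a ≠ 0 → ∀ m, partialSum a m ≤ partialSum l m) :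
    altCoeff l f = f (expo l) := by
  classical
  rw [altCoeff, Finset.sum_eq_single 1]
  · have h1 : expo (l + staircase d) = expo l + expo (staircase d) := by
      ext; rfl
    have h2 : (expo fun i => staircase d ((1 : Equiv.Perm (Fin d)) i)) = expo (staircase d) := rfl
    rw [h2, h1, if_pos le_add_self, add_tsub_cancel_right]
    simp
  · intro σ _ hσ
    split_ifs with hle
    · by_contra h0
      have h1 := tsub_add_cancel_of_le hle
      have h2 := congrArg Finsupp.degree h1
      rw [map_add, expo_degree, expo_degree, Equiv.sum_comp σ (staircase d)] at h2
      refine hσ (eq_one_of_partialSum_le (fun i => DFunLike.congr_fun h1 i) (h _ ?_ ?_))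
      · simpa [Finset.sum_add_distrib] using h2
      · intro h3
        exact h0 (by rw [h3, smul_zero])
    · rw [smul_zero]
  · simp

/-- The complete symmetric function of degree `m`, as a power series. -/
def completeSeries (d m : ℕ) : MvPowerSeries (Fin d) ℂ :=
  fun a => if a.degree = m then 1 else 0

theorem coeff_completeSeries (m : ℕ) (a : Fin d →₀ ℕ) :
    coeff a (completeSeries d m) = if a.degree = m then 1 else 0 := rfl

theorem isSymmetricSeries_completeSeries (m : ℕ) : IsSymmetricSeries (completeSeries d m) := by
  intro σ a
  rw [coeff_completeSeries, coeff_completeSeries]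
  refine if_congr ?_ rfl rfl
  simp only [Finsupp.degree_eq_sum, Finsupp.equivMapDomain_apply]
  rw [Equiv.sum_comp σ.symm a]

theorem IsSymmetricSeries.prod {ι : Type*} (s : Finset ι) {f : ι → MvPowerSeries (Fin d) ℂ}
    (hf : ∀ i ∈ s, IsSymmetricSeries (f i)) : IsSymmetricSeries (∏ i ∈ s, f i) := by
  simp only [isSymmetricSeries_iff] at *
  intro σ
  rw [map_prod]
  exact Finset.prod_congr rfl fun i hi => hf i hi σ

theorem IsSymmetricSeries.coeff_mul_completeSeries_mul {f : MvPowerSeries (Fin d) ℂ}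
    (hf : IsSymmetricSeries f) (r : ℕ) {μ : Fin d → ℕ} (hμ : Antitone μ) :
    coeff (expo (μ + staircase d)) (f * completeSeries d r * vandermondeSeries d) =
      ∑ ν ∈ horizontalStrips μ, if ∑ i, ν i + r = ∑ i, μ i then
        coeff (expo (ν + staircase d)) (f * vandermondeSeries d) else 0 := by
  classical
  set D := ∑ i, (μ + staircase d) i with hD
  -- Fixing the total degree is invariant under permutations, so the truncated function is still
  -- alternating and the box cancellation applies to it.
  have hA : IsAlternatingFun fun b : Fin d → ℕ => if ∑ i, b i + r = D then
      coeff (expo b) (f * vandermondeSeries d) else 0 := by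
    intro σ b
    have h1 : ∑ i, (b ∘ σ) i = ∑ i, b i := Equiv.sum_comp σ b
    simp only [h1]
    split_ifs
    · exact hf.isAlternatingFun_mul σ b
    · rw [mul_zero]
  have h2 := hA.sum_piFinset hμ
  rw [mul_right_comm, coeff_mul]
  have h3 : ∀ p ∈ Finset.HasAntidiagonal.antidiagonal (expo (μ + staircase d)),
      coeff p.1 (f * vandermondeSeries d) * coeff p.2 (completeSeries d r) =
        if p.1.degree + r = D then coeff p.1 (f * vandermondeSeries d) else 0 := by
    intro p hp
    have h4 := congrArg Finsupp.degree (Finset.HasAntidiagonal.mem_antidiagonal.1 hp)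
    rw [map_add, expo_degree, ← hD] at h4
    rw [coeff_completeSeries, mul_ite, mul_one, mul_zero]
    exact if_congr (by omega) rfl rfl
  rw [Finset.sum_congr rfl h3, sum_antidiagonal_fst (F := fun b => if b.degree + r = D then
    coeff b (f * vandermondeSeries d) else 0), sum_Iic_expo]
  simp only [expo_degree]
  rw [h2]
  refine Finset.sum_congr rfl fun ν _ => if_congr ?_ rfl rfl
  rw [hD]
  simp only [Pi.add_apply, Finset.sum_add_distrib]
  omega

/-- The product of the first `k` of the complete symmetric functions of degrees `b i`. -/
def completeProd (b : Fin d → ℕ) (k : ℕ) : MvPowerSeries (Fin d) ℂ :=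
  ∏ i : Fin d with i.val < k, completeSeries d (b i)

theorem isSymmetricSeries_completeProd (b : Fin d → ℕ) (k : ℕ) :
    IsSymmetricSeries (completeProd b k) :=
  .prod _ fun _ _ => isSymmetricSeries_completeSeries _

theorem completeProd_succ (b : Fin d → ℕ) (k : Fin d) :
    completeProd b (k + 1) = completeProd b k * completeSeries d (b k) := by
  rw [completeProd, filter_lt_succ, Finset.prod_insert (by simp), mul_comm, completeProd]

theorem coeff_completeProd_zero (b : Fin d → ℕ) {ν : Fin d → ℕ} (hν : Antitone ν) :
    coeff (expo (ν + staircase d)) (completeProd b 0 * vandermondeSeries d) =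
      if 0 = ν then 1 else 0 := by
  have h := coeff_alternant_add_staircase (l := (0 : Fin d → ℕ)) (fun _ _ _ => le_rfl) hν
  rw [zero_add] at h
  simp only [completeProd, Nat.not_lt_zero, Finset.filter_false, Finset.prod_empty, one_mul,
    vandermondeSeries, MvPolynomial.coeff_coe]
  exact h

/-- By Pieri, `ν` is built from the empty partition by `k` horizontal strips of sizes `b_0, …,
b_{k-1}`. Each strip opens at most one new row, so the first `m` strips lie in the first `m` rows.
-/
theorem partialSum_le_of_coeff_completeProd_ne_zero (b : Fin d → ℕ) (k : ℕ) (hk : k ≤ d)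
    {ν : Fin d → ℕ} (hν : Antitone ν)
    (h : coeff (expo (ν + staircase d)) (completeProd b k * vandermondeSeries d) ≠ 0) :
    (∀ j : Fin d, k ≤ j → ν j = 0) ∧ ∀ m ≤ k, partialSum b m ≤ partialSum ν m := by
  induction k generalizing ν with
  | zero =>
    rw [coeff_completeProd_zero b hν] at h
    have h1 : 0 = ν := by
      by_contra h'
      exact h (if_neg h')
    subst h1
    refine ⟨fun _ _ => rfl, fun m hm => ?_⟩
    rw [Nat.le_zero.1 hm, partialSum_zero, partialSum_zero]
  | succ k ih =>
    let x : Fin d := ⟨k, hk⟩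
    have h1 : completeProd b (k + 1) = completeProd b k * completeSeries d (b x) :=
      completeProd_succ b x
    rw [h1, (isSymmetricSeries_completeProd b k).coeff_mul_completeSeries_mul _ hν] at h
    obtain ⟨κ, hκ, hne⟩ := Finset.exists_ne_zero_of_sum_ne_zero h
    have hsum : ∑ i, κ i + b x = ∑ i, ν i := by
      by_contra h'
      exact hne (if_neg h')
    rw [if_pos hsum] at hne
    obtain ⟨h2, h3⟩ := ih (by omega) (antitone_of_mem_horizontalStrips hκ) hne
    rw [mem_horizontalStrips] at hκ
    have h4 : ∀ j : Fin d, k + 1 ≤ j → ν j = 0 := by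
      intro j hj
      have h5 := hκ.2 ⟨j - 1, by omega⟩ (by simp only; omega)
      have h6 : (⟨(j : ℕ) - 1 + 1, by omega⟩ : Fin d) = j := Fin.ext (by simp only; omega)
      simp only [h6] at h5
      rw [h2 _ (by simp only; omega)] at h5
      omega
    refine ⟨h4, fun m hm => ?_⟩
    rcases hm.lt_or_eq with hm | rfl
    · exact (h3 m (by omega)).trans (Finset.sum_le_sum fun i _ => hκ.1 i)
    -- At `m = k + 1` the partial sum of `ν` is already its full size, so it suffices to compare
    -- sizes.
    · rw [partialSum_eq_sum h4, ← hsum, ← partialSum_eq_sum h2]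
      exact (partialSum_succ b x).le.trans (Nat.add_le_add_right (h3 k le_rfl) _)

/-- The diagonal Kostka number is 1: the only chain of strips of sizes `l_0, l_1, …` ending in `l`
consists of the truncations of `l`. -/
theorem coeff_completeProd_self {l : Fin d → ℕ} (hl : Antitone l) (k : ℕ) (hk : k ≤ d) :
    coeff (expo ((fun i : Fin d => if (i : ℕ) < k then l i else 0) + staircase d))
      (completeProd l k * vandermondeSeries d) = 1 := by
  have hanti : ∀ k : ℕ, Antitone fun i : Fin d => if (i : ℕ) < k then l i else 0 := by
    intro k i j hij
    have h1 := hl hij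
    have h2 : (i : ℕ) ≤ j := hij
    simp only
    split_ifs <;> omega
  induction k with
  | zero =>
    rw [coeff_completeProd_zero _ (hanti 0), if_pos]
    funext i
    simp
  | succ k ih =>
    let x : Fin d := ⟨k, hk⟩
    have h1 : completeProd l (k + 1) = completeProd l k * completeSeries d (l x) :=
      completeProd_succ l x
    rw [h1, (isSymmetricSeries_completeProd l k).coeff_mul_completeSeries_mul _ (hanti (k + 1)),
      Finset.sum_eq_single fun i : Fin d => if (i : ℕ) < k then l i else 0]
    · rw [if_pos, ih (by omega)]
      rw [← Finset.sum_filter, ← Finset.sum_filter]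
      exact (partialSum_succ l x).symm
    · intro κ hκ hne
      by_contra h'
      apply hne
      have h0 : coeff (expo (κ + staircase d)) (completeProd l k * vandermondeSeries d) ≠ 0 := by
        intro h0
        rw [h0, ite_self] at h'
        exact h' rfl
      obtain ⟨h2, h3⟩ := partialSum_le_of_coeff_completeProd_ne_zero l k (by omega)
        (antitone_of_mem_horizontalStrips hκ) h0
      have hle : ∀ i ∈ Finset.univ.filter (fun i : Fin d => (i : ℕ) < k), κ i ≤ l i := by
        intro i hi
        have := (mem_horizontalStrips.1 hκ).1 i
        rw [if_pos (by have := (Finset.mem_filter.1 hi).2; omega)] at this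
        exact this
      have heq := (Finset.sum_eq_sum_iff_of_le hle).1 (le_antisymm (Finset.sum_le_sum hle)
        (h3 k le_rfl))
      funext i
      split_ifs with hi
      · exact heq i (Finset.mem_filter.2 ⟨Finset.mem_univ _, hi⟩)
      · exact h2 i (by omega)
    · intro h
      refine absurd (mem_horizontalStrips.2 ⟨fun i => ?_, fun i h => ?_⟩) h
      · split_ifs <;> omega
      · simp only
        have h1 : l ⟨i + 1, h⟩ ≤ l i := hl (by simp [Fin.le_def])
        split_ifs <;> omega

/-- The norm of a Schur function in disguise. The inner alternating sum is a Kostka number, zero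
unless `l` dominates `b`, so the outer one reduces to the diagonal value 1. -/
theorem altCoeff_completeProd {l : Fin d → ℕ} (hl : Antitone l) :
    (altCoeff l fun b => altCoeff l fun a => coeff a (completeProd (d := d) b d)) = 1 := by
  rw [altCoeff_eq_of_partialSum_le]
  · rw [← coeff_mul_vandermondeSeries]
    have h := coeff_completeProd_self hl d le_rfl
    simp only [Fin.is_lt, if_true] at h
    exact h
  · intro b _ hb m
    rw [← coeff_mul_vandermondeSeries] at hb
    have h := (partialSum_le_of_coeff_completeProd_ne_zero b d le_rfl hl hb).2
    by_cases hm : m ≤ d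
    · exact h m hm
    · have h1 : ∀ f : Fin d → ℕ, partialSum f m = partialSum f d := by
        intro f
        refine Finset.sum_congr (Finset.filter_congr fun i _ => ?_) fun _ _ => rfl
        have := i.2
        omega
      rw [h1, h1]
      exact h d le_rfl

end AltCoeff

/-! ### Tableaux and words -/

section Tableaux

variable {d : ℕ}

/-- The number of occurrences of each letter in a word. -/
def wordContent {n : ℕ} (w : Fin n → Fin d) : Fin d →₀ ℕ :=
  expo fun i => (Finset.univ.filter fun x => w x = i).card

theorem wordContent_apply {n : ℕ} (w : Fin n → Fin d) (i : Fin d) :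
    wordContent w i = (Finset.univ.filter fun x => w x = i).card := rfl

theorem degree_wordContent {n : ℕ} (w : Fin n → Fin d) : (wordContent w).degree = n := by
  rw [Finsupp.degree_eq_sum]
  simp only [wordContent_apply]
  rw [← Finset.card_eq_sum_card_fiberwise (fun _ _ => Finset.mem_coe.2 (Finset.mem_univ _))]
  simp

theorem wordContent_comp {n : ℕ} (w : Fin n → Fin d) (g : Equiv.Perm (Fin n)) :
    wordContent (w ∘ g) = wordContent w := by
  ext i
  rw [wordContent_apply, wordContent_apply]
  refine Finset.card_bij (fun x _ => g x) ?_ (fun _ _ _ _ h => g.injective h) ?_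
  · intro x hx
    simpa using hx
  · intro y hy
    exact ⟨g.symm y, by simpa using hy, by simp⟩

theorem partialSum_wordContent {n : ℕ} (w : Fin n → Fin d) (m : ℕ) :
    partialSum (wordContent w) m = (Finset.univ.filter fun x => (w x : ℕ) < m).card := by
  rw [partialSum, Finset.card_eq_sum_card_fiberwise (f := w)
    (t := Finset.univ.filter fun i : Fin d => (i : ℕ) < m) (by intro x; simp)]
  refine Finset.sum_congr rfl fun i hi => ?_
  rw [wordContent_apply, Finset.filter_filter]
  congr 1
  refine Finset.filter_congr fun x _ => ⟨fun h => ⟨?_, h⟩, fun h => h.2⟩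
  rw [h]
  exact (Finset.mem_filter.1 hi).2

/-- The word that records the rows of the entries of the row-by-row tableau. -/
def rowWord (l : Fin d → ℕ) (x : Fin (∑ i, l i)) : Fin d := (finSigmaFinEquiv.symm x).1

variable {l : Fin d → ℕ}

theorem tableauRow_eq_iff {x y : Fin (∑ i, l i)} :
    tableauRow l x = tableauRow l y ↔ rowWord l x = rowWord l y := Fin.val_inj

theorem tableauCol_lt (x : Fin (∑ i, l i)) : tableauCol l x < l (rowWord l x) :=
  (finSigmaFinEquiv.symm x).2.2

theorem exists_cell {i : Fin d} {c : ℕ} (h : c < l i) :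
    ∃ x : Fin (∑ i, l i), rowWord l x = i ∧ tableauCol l x = c :=
  by
  refine ⟨finSigmaFinEquiv ⟨i, c, h⟩, ?_, ?_⟩
  · rw [rowWord, Equiv.symm_apply_apply]
  · rw [tableauCol, Equiv.symm_apply_apply]

theorem cell_ext {x y : Fin (∑ i, l i)} (h1 : rowWord l x = rowWord l y)
    (h2 : tableauCol l x = tableauCol l y) : x = y := by
  apply finSigmaFinEquiv.symm.injective
  rw [rowWord, rowWord] at h1
  rw [tableauCol, tableauCol] at h2
  exact Sigma.ext h1 ((Fin.heq_ext_iff (by rw [h1])).2 h2)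

theorem wordContent_rowWord : wordContent (rowWord l) = expo l := by
  ext i
  rw [wordContent_apply]
  have h : ((Finset.univ : Finset (Fin (l i)))).card = l i := by simp
  rw [← Finset.card_map ⟨fun c : Fin (l i) => finSigmaFinEquiv (n := l) ⟨i, c⟩, fun c c' h => by
    simpa using h⟩] at h
  rw [Finsupp.equivFunOnFinite_symm_apply_apply, ← h]
  congr 1
  ext x
  simp only [Finset.mem_filter, Finset.mem_univ, true_and, Finset.mem_map]
  constructor
  · rintro rfl
    exact ⟨(finSigmaFinEquiv.symm x).2, finSigmaFinEquiv.apply_symm_apply x⟩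
  · rintro ⟨c, rfl⟩
    exact congrArg Sigma.fst (finSigmaFinEquiv.symm_apply_apply (⟨i, c⟩ : (i : Fin d) × Fin (l i)))

/-- Words whose letters in each column of the tableau are distinct. -/
def IsColumnInjective (w : Fin (∑ i, l i) → Fin d) : Prop :=
  ∀ x y, tableauCol l x = tableauCol l y → w x = w y → x = y

/-- Distinct letters below `m` number at most the smaller of `m` and the column height, and the row
word attains this bound. The two cases are whether or not the column reaches row `m`. -/
theorem IsColumnInjective.card_le (hl : Antitone l) {w : Fin (∑ i, l i) → Fin d}
    (hw : IsColumnInjective w) (c m : ℕ) :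
    (Finset.univ.filter fun x => (w x : ℕ) < m ∧ tableauCol l x = c).card ≤
      (Finset.univ.filter fun x => (rowWord l x : ℕ) < m ∧ tableauCol l x = c).card := by
  by_cases h : ∃ x, tableauCol l x = c ∧ m ≤ rowWord l x
  · obtain ⟨x₀, hx₀, hm⟩ := h
    calc _ ≤ (Finset.univ.filter fun i : Fin d => (i : ℕ) < m).card :=
          Finset.card_le_card_of_injOn w (by intro x; simp; tauto) (by
            intro x hx y hy hxy
            simp only [Finset.coe_filter, Finset.mem_univ, true_and, Set.mem_ofPred_eq] at hx hy
            exact hw x y (hx.2.trans hy.2.symm) hxy)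
      _ ≤ _ := by
          refine Finset.card_le_card_of_surjOn (rowWord l) fun i hi => ?_
          simp only [Finset.coe_filter, Finset.mem_univ, true_and, Set.mem_ofPred_eq] at hi
          have h1 : c < l i := by
            rw [← hx₀]
            exact (tableauCol_lt x₀).trans_le (hl (by rw [Fin.le_def]; omega))
          obtain ⟨x, hx1, hx2⟩ := exists_cell h1
          exact ⟨x, by simp [hx1, hx2, hi], hx1⟩
  · push Not at h
    refine Finset.card_le_card fun x hx => ?_
    simp only [Finset.mem_filter, Finset.mem_univ, true_and] at hx ⊢
    exact ⟨h x hx.2, hx.2⟩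

theorem card_eq_sum_columns (w : Fin (∑ i, l i) → Fin d) (m : ℕ) :
    (Finset.univ.filter fun x => (w x : ℕ) < m).card =
      ∑ c ∈ Finset.univ.image (tableauCol l),
        (Finset.univ.filter fun x => (w x : ℕ) < m ∧ tableauCol l x = c).card := by
  rw [Finset.card_eq_sum_card_fiberwise (f := tableauCol l)
    (t := Finset.univ.image (tableauCol l)) (by intro x; simp)]
  simp only [Finset.filter_filter]

theorem IsColumnInjective.partialSum_le (hl : Antitone l) {w : Fin (∑ i, l i) → Fin d}
    (hw : IsColumnInjective w) (m : ℕ) : partialSum (wordContent w) m ≤ partialSum l m := by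
  have h : partialSum l m = partialSum (wordContent (rowWord l)) m := by
    rw [wordContent_rowWord]; rfl
  rw [h, partialSum_wordContent, partialSum_wordContent, card_eq_sum_columns,
    card_eq_sum_columns (rowWord l)]
  exact Finset.sum_le_sum fun c _ => hw.card_le hl c m

/-- Equal contents make the column-wise inequalities equalities, so each column of `w` carries
exactly the row indices of that column. Sending `x` to the cell of its column in row `w x` is the
required permutation. -/
theorem IsColumnInjective.exists_perm (hl : Antitone l) {w : Fin (∑ i, l i) → Fin d}
    (hw : IsColumnInjective w) (hc : wordContent w = expo l) :
    ∃ τ : Equiv.Perm (Fin (∑ i, l i)), (∀ x, tableauCol l (τ x) = tableauCol l x) ∧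
      w = rowWord l ∘ τ := by
  have hcard : ∀ c m, (Finset.univ.filter fun x => (w x : ℕ) < m ∧ tableauCol l x = c).card =
      (Finset.univ.filter fun x => (rowWord l x : ℕ) < m ∧ tableauCol l x = c).card := by
    intro c m
    by_cases hcm : c ∈ Finset.univ.image (tableauCol l)
    · refine (Finset.sum_eq_sum_iff_of_le fun c _ => hw.card_le hl c m).1 ?_ c hcm
      rw [← card_eq_sum_columns, ← card_eq_sum_columns (rowWord l), ← partialSum_wordContent,
        ← partialSum_wordContent, hc, wordContent_rowWord]
    · rw [Finset.filter_false_of_mem, Finset.filter_false_of_mem]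
      · exact fun x _ h => hcm (Finset.mem_image.2 ⟨x, Finset.mem_univ _, h.2⟩)
      · exact fun x _ h => hcm (Finset.mem_image.2 ⟨x, Finset.mem_univ _, h.2⟩)
  have hsucc : ∀ (v : Fin (∑ i, l i) → Fin d) (c : ℕ) (i : Fin d),
      (Finset.univ.filter fun x => (v x : ℕ) < i + 1 ∧ tableauCol l x = c).card =
        (Finset.univ.filter fun x => (v x : ℕ) < i ∧ tableauCol l x = c).card +
          (Finset.univ.filter fun x => v x = i ∧ tableauCol l x = c).card := by
    intro v c i
    rw [← Finset.card_union_of_disjoint]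
    · congr 1
      ext x
      simp only [Finset.mem_filter, Finset.mem_univ, true_and, Finset.mem_union, Fin.ext_iff]
      omega
    · rw [Finset.disjoint_left]
      intro x h1 h2
      simp only [Finset.mem_filter, Finset.mem_univ, true_and, Fin.ext_iff] at h1 h2
      omega
  have hlt : ∀ x, tableauCol l x < l (w x) := by
    intro x
    have h1 := hcard (tableauCol l x) (w x)
    have h2 := hcard (tableauCol l x) (w x + 1)
    rw [hsucc, hsucc, h1, add_right_inj] at h2
    have h3 : 0 < (Finset.univ.filter fun y => rowWord l y = w x ∧
        tableauCol l y = tableauCol l x).card := by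
      rw [← h2, Finset.card_pos]
      exact ⟨x, by simp⟩
    obtain ⟨y, hy⟩ := Finset.card_pos.1 h3
    simp only [Finset.mem_filter, Finset.mem_univ, true_and] at hy
    rw [← hy.1, ← hy.2]
    exact tableauCol_lt y
  choose τ hτ1 hτ2 using fun x => exists_cell (hlt x)
  have hinj : Function.Injective τ := by
    intro x y hxy
    refine hw x y ?_ ?_
    · rw [← hτ2, hxy, hτ2]
    · rw [← hτ1, hxy, hτ1]
  refine ⟨Equiv.ofBijective τ (Finite.injective_iff_bijective.1 hinj), hτ2, ?_⟩
  funext x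
  exact (hτ1 x).symm

end Tableaux

/-! ### The Young symmetrizer -/

section YoungSymmetrizer

variable {d : ℕ} (F : Type*) [Field F] (l : Fin d → ℕ)

/-- The sum of the row stabilizer. -/
def rowSum : MonoidAlgebra F (Equiv.Perm (Fin (∑ i, l i))) :=
  open Classical in ∑ σ : Equiv.Perm (Fin (∑ i, l i)) with
    ∀ x, tableauRow l (σ x) = tableauRow l x, MonoidAlgebra.single σ 1

/-- The signed sum of the column stabilizer. -/
def colSum : MonoidAlgebra F (Equiv.Perm (Fin (∑ i, l i))) :=
  open Classical in ∑ τ : Equiv.Perm (Fin (∑ i, l i)) with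
    ∀ x, tableauCol l (τ x) = tableauCol l x,
      MonoidAlgebra.single τ ((Equiv.Perm.sign τ : ℤ) : F)

theorem youngSymmetrizer_eq : youngSymmetrizer F l = rowSum F l * colSum F l := rfl

variable {l}

theorem sign_mul_sign_cast {n : ℕ} (σ : Equiv.Perm (Fin n)) :
    ((Equiv.Perm.sign σ : ℤ) : F) * ((Equiv.Perm.sign σ : ℤ) : F) = 1 := by
  rcases Int.units_eq_one_or (Equiv.Perm.sign σ) with h | h <;> simp [h]

theorem single_mul_rowSum {ρ : Equiv.Perm (Fin (∑ i, l i))}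
    (hρ : ∀ x, tableauRow l (ρ x) = tableauRow l x) :
    MonoidAlgebra.single ρ 1 * rowSum F l = rowSum F l := by
  rw [rowSum, Finset.mul_sum]
  refine Finset.sum_equiv (Equiv.mulLeft ρ) (fun σ => ?_) fun σ _ => ?_
  · simp [hρ]
  · simp

theorem rowSum_mul_single {ρ : Equiv.Perm (Fin (∑ i, l i))}
    (hρ : ∀ x, tableauRow l (ρ x) = tableauRow l x) :
    rowSum F l * MonoidAlgebra.single ρ 1 = rowSum F l := by
  rw [rowSum, Finset.sum_mul]
  refine Finset.sum_equiv (Equiv.mulRight ρ) (fun σ => ?_) fun σ _ => ?_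
  · simp only [Finset.mem_filter, Finset.mem_univ, true_and, Equiv.coe_mulRight,
      Equiv.Perm.coe_mul, Function.comp]
    refine ⟨fun h x => by rw [h, hρ], fun h x => ?_⟩
    have h1 := h (ρ.symm x)
    have h2 := hρ (ρ.symm x)
    rw [Equiv.apply_symm_apply] at h1 h2
    rw [h1, ← h2]
  · simp

theorem single_mul_colSum {τ : Equiv.Perm (Fin (∑ i, l i))}
    (hτ : ∀ x, tableauCol l (τ x) = tableauCol l x) :
    MonoidAlgebra.single τ 1 * colSum F l = ((Equiv.Perm.sign τ : ℤ) : F) • colSum F l := by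
  rw [colSum, Finset.mul_sum, Finset.smul_sum]
  refine Finset.sum_equiv (Equiv.mulLeft τ) (fun σ => ?_) fun σ _ => ?_
  · simp [hτ]
  · simp only [MonoidAlgebra.single_mul_single, one_mul, Equiv.coe_mulLeft, map_mul,
      Units.val_mul, Int.cast_mul, MonoidAlgebra.smul_single, smul_eq_mul]
    rw [← mul_assoc, sign_mul_sign_cast, one_mul]

theorem colSum_mul_single {τ : Equiv.Perm (Fin (∑ i, l i))}
    (hτ : ∀ x, tableauCol l (τ x) = tableauCol l x) :
    colSum F l * MonoidAlgebra.single τ 1 = ((Equiv.Perm.sign τ : ℤ) : F) • colSum F l := by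
  rw [colSum, Finset.sum_mul, Finset.smul_sum]
  refine Finset.sum_equiv (Equiv.mulRight τ) (fun σ => ?_) fun σ _ => ?_
  · simp only [Finset.mem_filter, Finset.mem_univ, true_and, Equiv.coe_mulRight,
      Equiv.Perm.coe_mul, Function.comp]
    refine ⟨fun h x => by rw [h, hτ], fun h x => ?_⟩
    have h1 := h (τ.symm x)
    have h2 := hτ (τ.symm x)
    rw [Equiv.apply_symm_apply] at h1 h2
    rw [h1, ← h2]
  · simp only [MonoidAlgebra.single_mul_single, mul_one, Equiv.coe_mulRight, map_mul,
      Units.val_mul, Int.cast_mul, MonoidAlgebra.smul_single, smul_eq_mul]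
    rw [mul_comm (Int.cast (Equiv.Perm.sign σ : ℤ) : F), ← mul_assoc, sign_mul_sign_cast, one_mul]

theorem swap_tableauRow {x y : Fin (∑ i, l i)} (h : tableauRow l x = tableauRow l y)
    (z : Fin (∑ i, l i)) : tableauRow l (Equiv.swap x y z) = tableauRow l z := by
  rw [Equiv.swap_apply_def]
  split_ifs with h1 h2
  · rw [h1, h]
  · rw [h2, h]
  · rfl

theorem swap_tableauCol {x y : Fin (∑ i, l i)} (h : tableauCol l x = tableauCol l y)
    (z : Fin (∑ i, l i)) : tableauCol l (Equiv.swap x y z) = tableauCol l z := by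
  rw [Equiv.swap_apply_def]
  split_ifs with h1 h2
  · rw [h1, h]
  · rw [h2, h]
  · rfl

/-- The combinatorial lemma behind Young symmetrizers, applied to the word recording the row of `g
x`: either it is a column rearrangement of the row word, or it repeats a letter in some column. -/
theorem exists_eq_mul_or_swap (hl : Antitone l) (g : Equiv.Perm (Fin (∑ i, l i))) :
    (∃ ρ τ : Equiv.Perm (Fin (∑ i, l i)), (∀ x, tableauRow l (ρ x) = tableauRow l x) ∧
      (∀ x, tableauCol l (τ x) = tableauCol l x) ∧ g = ρ * τ) ∨
    ∃ x y, x ≠ y ∧ tableauCol l x = tableauCol l y ∧ tableauRow l (g x) = tableauRow l (g y) := by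
  by_cases h : IsColumnInjective (rowWord l ∘ g)
  · left
    obtain ⟨τ, hτ, hw⟩ := h.exists_perm hl (by rw [wordContent_comp, wordContent_rowWord])
    refine ⟨g * τ⁻¹, τ, fun x => ?_, hτ, by group⟩
    rw [tableauRow_eq_iff]
    have h1 := congrFun hw (τ⁻¹ x)
    simpa using h1
  · right
    simp only [IsColumnInjective, not_forall] at h
    obtain ⟨x, y, h1, h2, h3⟩ := h
    exact ⟨x, y, h3, h1, tableauRow_eq_iff.2 h2⟩

variable [CharZero F]

theorem eq_zero_of_eq_neg {M : Type*} [AddCommGroup M] [Module F M] {x : M} (h : x = -x) :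
    x = 0 := by
  have h1 : (2 : F) • x = 0 := by
    rw [two_smul]
    nth_rw 2 [h]
    exact add_neg_cancel x
  exact (smul_eq_zero.1 h1).resolve_left two_ne_zero

theorem rowSum_mul_single_mul_colSum (hl : Antitone l) (g : Equiv.Perm (Fin (∑ i, l i))) :
    ∃ κ : F, rowSum F l * MonoidAlgebra.single g 1 * colSum F l = κ • youngSymmetrizer F l := by
  rcases exists_eq_mul_or_swap hl g with ⟨ρ, τ, hρ, hτ, rfl⟩ | ⟨x, y, hxy, hc, hr⟩
  · refine ⟨((Equiv.Perm.sign τ : ℤ) : F), ?_⟩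
    have h : (MonoidAlgebra.single (ρ * τ) 1 : MonoidAlgebra F (Equiv.Perm (Fin (∑ i, l i)))) =
        MonoidAlgebra.single ρ 1 * MonoidAlgebra.single τ 1 := by simp
    rw [h, ← mul_assoc, rowSum_mul_single F hρ, mul_assoc, single_mul_colSum F hτ, mul_smul_comm,
      youngSymmetrizer_eq]
  · refine ⟨0, ?_⟩
    -- Conjugation by `g` carries a column transposition to a row transposition. The row sum absorbs
    -- the latter and the column sum changes sign under the former, so the product equals its
    -- negative.
    have h1 : (MonoidAlgebra.single g 1 : MonoidAlgebra F (Equiv.Perm (Fin (∑ i, l i)))) *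
        MonoidAlgebra.single (Equiv.swap x y) 1 =
        MonoidAlgebra.single (Equiv.swap (g x) (g y)) 1 * MonoidAlgebra.single g 1 := by
      rw [MonoidAlgebra.single_mul_single, MonoidAlgebra.single_mul_single,
        Equiv.mul_swap_eq_swap_mul]
    have h2 := single_mul_colSum F (swap_tableauCol hc)
    rw [Equiv.Perm.sign_swap hxy] at h2
    have h3 : rowSum F l * MonoidAlgebra.single g 1 * colSum F l =
        -(rowSum F l * MonoidAlgebra.single g 1 * colSum F l) := by
      nth_rw 1 [← rowSum_mul_single F (swap_tableauRow hr)]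
      rw [mul_assoc (rowSum F l), ← h1, ← mul_assoc, mul_assoc _ _ (colSum F l), h2]
      simp
    rw [zero_smul]
    exact eq_zero_of_eq_neg F h3

theorem rowSum_mul_mul_colSum (hl : Antitone l)
    (x : MonoidAlgebra F (Equiv.Perm (Fin (∑ i, l i)))) :
    ∃ κ : F, rowSum F l * x * colSum F l = κ • youngSymmetrizer F l := by
  induction x using MonoidAlgebra.induction_linear with
  | zero => exact ⟨0, by simp⟩
  | add x y hx hy =>
    obtain ⟨κ, hκ⟩ := hx
    obtain ⟨κ', hκ'⟩ := hy
    exact ⟨κ + κ', by rw [mul_add, add_mul, hκ, hκ', add_smul]⟩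
  | single g r =>
    obtain ⟨κ, hκ⟩ := rowSum_mul_single_mul_colSum F hl g
    refine ⟨r * κ, ?_⟩
    have : (MonoidAlgebra.single g r : MonoidAlgebra F (Equiv.Perm (Fin (∑ i, l i)))) =
      r • MonoidAlgebra.single g 1 := by simp
    rw [this, mul_smul_comm, smul_mul_assoc, hκ, smul_smul]

theorem youngSymmetrizer_mul_mul (hl : Antitone l)
    (x : MonoidAlgebra F (Equiv.Perm (Fin (∑ i, l i)))) :
    ∃ κ : F, youngSymmetrizer F l * x * youngSymmetrizer F l = κ • youngSymmetrizer F l := by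
  obtain ⟨κ, hκ⟩ := rowSum_mul_mul_colSum F hl (colSum F l * x * rowSum F l)
  refine ⟨κ, ?_⟩
  rw [← hκ, youngSymmetrizer_eq]
  simp only [mul_assoc]

/-- A permutation preserving both rows and columns fixes every cell, so the identity arises only as
`1 * 1`. -/
theorem coeff_youngSymmetrizer_one : (youngSymmetrizer F l).coeff 1 = 1 := by
  classical
  rw [youngSymmetrizer_eq, rowSum, colSum, Finset.sum_mul, MonoidAlgebra.coeff_sum,
    Finsupp.finsetSum_apply, Finset.sum_eq_single 1]
  · rw [← MonoidAlgebra.one_def, one_mul, MonoidAlgebra.coeff_sum, Finsupp.finsetSum_apply,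
      Finset.sum_eq_single 1]
    · simp
    · intro τ _ h
      simp [MonoidAlgebra.coeff_single, h]
    · simp
  · intro ρ hρ hne
    rw [Finset.mul_sum, MonoidAlgebra.coeff_sum, Finsupp.finsetSum_apply]
    refine Finset.sum_eq_zero fun τ hτ => ?_
    rw [MonoidAlgebra.single_mul_single, MonoidAlgebra.coeff_single, Finsupp.single_apply, if_neg]
    intro h
    apply hne
    simp only [Finset.mem_filter, Finset.mem_univ, true_and] at hρ hτ
    have h1 : ρ⁻¹ = τ := inv_eq_of_mul_eq_one_right h
    ext1 x
    have h2 := hτ (ρ x)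
    rw [← h1, ← Equiv.Perm.mul_apply, inv_mul_cancel, Equiv.Perm.one_apply] at h2
    exact cell_ext (tableauRow_eq_iff.1 (hρ x)) h2.symm
  · simp

end YoungSymmetrizer

/-! ### The characters of the Specht modules -/

section GroupAlgebra

variable {F : Type*} [Field F] {G : Type*}

theorem trace_monoidAlgebra [Fintype G]
    (f : MonoidAlgebra F G →ₗ[F] MonoidAlgebra F G) :
    LinearMap.trace F _ f = ∑ h : G, (f (MonoidAlgebra.single h 1)).coeff h := by
  classical
  rw [LinearMap.trace_eq_matrix_trace F (MonoidAlgebra.basis G F), Matrix.trace]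
  refine Finset.sum_congr rfl fun h _ => ?_
  rw [Matrix.diag_apply, LinearMap.toMatrix_apply, MonoidAlgebra.basis_apply]
  rfl

instance [Finite G] : Module.Finite F (MonoidAlgebra F G) :=
  .of_basis (MonoidAlgebra.basis G F)

end GroupAlgebra

section Specht

variable {d : ℕ} {F : Type*} [Field F] {l : Fin d → ℕ}

theorem spechtRep_apply (g : Equiv.Perm (Fin (∑ i, l i))) (x : SpechtModule F l) :
    (spechtRep F l g x : MonoidAlgebra F (Equiv.Perm (Fin (∑ i, l i)))) =
      MonoidAlgebra.single g 1 * (x : MonoidAlgebra F (Equiv.Perm (Fin (∑ i, l i)))) := by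
  simp [spechtRep, Representation.ofModule']

variable (F l) in
/-- The inclusion of the Specht module into the group algebra. -/
def spechtInclusion : SpechtModule F l →ₗ[F] MonoidAlgebra F (Equiv.Perm (Fin (∑ i, l i))) :=
  (Submodule.subtype (SpechtModule F l)).restrictScalars F

instance : Module.Finite F (SpechtModule F l) :=
  Module.Finite.of_injective (spechtInclusion F l) Subtype.val_injective

theorem youngSymmetrizer_mem : youngSymmetrizer F l ∈ SpechtModule F l :=
  Ideal.mem_span_singleton_self _

theorem mem_spechtModule {x : MonoidAlgebra F (Equiv.Perm (Fin (∑ i, l i)))} :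
    x ∈ SpechtModule F l ↔ ∃ y, y * youngSymmetrizer F l = x :=
  Ideal.mem_span_singleton'

variable (F l) in
theorem exists_map_eq_youngSymmetrizer :
    ∃ x : MonoidAlgebra ℤ (Equiv.Perm (Fin (∑ i, l i))),
      MonoidAlgebra.mapRingHom _ (Int.castRingHom F) x = youngSymmetrizer F l := by
  rw [youngSymmetrizer_eq]
  refine (Subsemiring.mul_mem (RingHom.rangeS _) (Subsemiring.sum_mem _ fun σ _ => ?_)
    (Subsemiring.sum_mem _ fun τ _ => ?_) : _ ∈ RingHom.rangeS
      (MonoidAlgebra.mapRingHom (Equiv.Perm (Fin (∑ i, l i))) (Int.castRingHom F)))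
  · exact ⟨MonoidAlgebra.single σ 1, by simp⟩
  · exact ⟨MonoidAlgebra.single τ (Equiv.Perm.sign τ : ℤ), by simp⟩

variable [CharZero F]

/-- If the square were zero, right multiplication by the symmetrizer would be nilpotent with trace
0, yet its trace is the group order because the coefficient of 1 is 1. The scalar is the coefficient
of 1 in the square, an integer. -/
theorem exists_youngSymmetrizer_mul_self (hl : Antitone l) : ∃ z : ℤ, z ≠ 0 ∧
    youngSymmetrizer F l * youngSymmetrizer F l = (z : F) • youngSymmetrizer F l := by
  obtain ⟨κ, hκ⟩ := youngSymmetrizer_mul_mul F hl 1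
  rw [mul_one] at hκ
  have hκ0 : κ ≠ 0 := by
    rintro rfl
    rw [zero_smul] at hκ
    have hn : IsNilpotent (LinearMap.mulRight F (youngSymmetrizer F l)) := by
      refine ⟨2, ?_⟩
      refine LinearMap.ext fun x => ?_
      rw [pow_two, Module.End.mul_apply, LinearMap.mulRight_apply, LinearMap.mulRight_apply,
        mul_assoc, hκ, mul_zero, LinearMap.zero_apply]
    have h := (LinearMap.isNilpotent_trace_of_isNilpotent hn).eq_zero
    rw [trace_monoidAlgebra] at h
    have h1 : ∀ g : Equiv.Perm (Fin (∑ i, l i)), (LinearMap.mulRight F (youngSymmetrizer F l)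
        (MonoidAlgebra.single g 1)).coeff g = 1 := by
      intro g
      rw [LinearMap.mulRight_apply, MonoidAlgebra.coeff_single_mul_apply, one_mul, inv_mul_cancel,
        coeff_youngSymmetrizer_one]
    simp only [h1, Finset.sum_const, nsmul_eq_mul, mul_one, Nat.cast_eq_zero] at h
    exact Finset.card_ne_zero_of_mem (Finset.mem_univ 1) h
  have h2 := congrArg (fun x => x.coeff 1) hκ
  simp only [MonoidAlgebra.coeff_smul, Finsupp.smul_apply, coeff_youngSymmetrizer_one,
    smul_eq_mul, mul_one] at h2
  obtain ⟨x, hx⟩ := exists_map_eq_youngSymmetrizer F l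
  rw [← hx, ← map_mul, MonoidAlgebra.coeff_mapRingHom, eq_intCast] at h2
  refine ⟨(x * x).coeff 1, fun h => hκ0 ?_, ?_⟩
  · rw [← h2, h, Int.cast_zero]
  · rw [hκ, ← h2]

variable (l) in
/-- The intertwining maps from a Specht module correspond to the image of the Young symmetrizer. -/
theorem finrank_intertwiningMap_spechtRep (hl : Antitone l) {V : Type*} [AddCommGroup V]
    [Module F V] (ρ : Representation F (Equiv.Perm (Fin (∑ i, l i))) V) :
    Module.finrank F (Representation.IntertwiningMap (spechtRep F l) ρ) =
      Module.finrank F (LinearMap.range (ρ.asAlgebraHom (youngSymmetrizer F l))) := by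
  obtain ⟨z, hz, hc⟩ := exists_youngSymmetrizer_mul_self (F := F) hl
  have hz' : (z : F) ≠ 0 := Int.cast_ne_zero.2 hz
  have hf : ∀ (f : Representation.IntertwiningMap (spechtRep F l) ρ)
      (x : MonoidAlgebra F (Equiv.Perm (Fin (∑ i, l i)))) (s : SpechtModule F l),
      ρ.asAlgebraHom x (f s) = f (x • s) := by
    intro f x s
    induction x using MonoidAlgebra.induction_linear with
    | zero => rw [map_zero, zero_smul, LinearMap.zero_apply, map_zero]
    | add x y hx hy => rw [map_add, LinearMap.add_apply, hx, hy, add_smul, map_add]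
    | single g r =>
      rw [Representation.asAlgebraHom_single, LinearMap.smul_apply, ← f.isIntertwining, ← map_smul]
      congr 1
      refine Subtype.ext ?_
      rw [Submodule.coe_smul_of_tower, spechtRep_apply, ← smul_mul_assoc,
        MonoidAlgebra.smul_single, smul_eq_mul, mul_one]
      rfl
  let c : SpechtModule F l := ⟨youngSymmetrizer F l, youngSymmetrizer_mem⟩
  have hcc : youngSymmetrizer F l • c = (z : F) • c := Subtype.ext hc
  let T : Representation.IntertwiningMap (spechtRep F l) ρ →ₗ[F] V :=
    { toFun := fun f => f c
      map_add' := fun f g => rfl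
      map_smul' := fun r f => rfl }
  have hT : Function.Injective T := by
    intro f g hfg
    refine Representation.IntertwiningMap.ext (LinearMap.ext fun s => ?_)
    obtain ⟨y, hy⟩ := mem_spechtModule.1 s.2
    have hs : s = y • c := Subtype.ext hy.symm
    change f s = g s
    rw [hs, ← hf, ← hf]
    exact congrArg _ hfg
  have hrange : LinearMap.range T = LinearMap.range (ρ.asAlgebraHom (youngSymmetrizer F l)) := by
    ext v
    constructor
    · rintro ⟨f, rfl⟩
      -- Acting with `c` on `f c` gives `f (c * c) = z • f c`.
      refine ⟨(z : F)⁻¹ • f c, ?_⟩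
      rw [map_smul, hf, hcc, map_smul, smul_smul, inv_mul_cancel₀ hz', one_smul]
      rfl
    · rintro ⟨u, rfl⟩
      -- The map `s ↦ z⁻¹ s (c u)` is equivariant and sends `c` to `c u`, because `c * c = z • c`.
      let f₀ : SpechtModule F l →ₗ[F] V :=
        (z : F)⁻¹ • (LinearMap.applyₗ (ρ.asAlgebraHom (youngSymmetrizer F l) u)) ∘ₗ
          ρ.asAlgebraHom.toLinearMap ∘ₗ spechtInclusion F l
      have hf₀ : ∀ s, f₀ s = (z : F)⁻¹ • ρ.asAlgebraHom
          (s : MonoidAlgebra F (Equiv.Perm (Fin (∑ i, l i))))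
          (ρ.asAlgebraHom (youngSymmetrizer F l) u) := fun s => rfl
      refine ⟨⟨f₀, fun g => ?_⟩, ?_⟩
      · refine LinearMap.ext fun s => ?_
        rw [LinearMap.comp_apply, LinearMap.comp_apply, hf₀, hf₀, spechtRep_apply, map_mul,
          Representation.asAlgebraHom_single_one, map_smul, Module.End.mul_apply]
      · change f₀ c = _
        rw [hf₀, ← Module.End.mul_apply, ← map_mul, hc, map_smul, LinearMap.smul_apply, smul_smul,
          inv_mul_cancel₀ hz', one_smul]
  rw [← hrange, LinearMap.finrank_range_of_inj hT]

/-- Endomorphisms correspond to the image of the symmetrizer `c` on the left ideal `A c`, and `c A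
c` is the line through `c`. -/
theorem finrank_end_spechtRep (hl : Antitone l) :
    Module.finrank F (Representation.IntertwiningMap (spechtRep F l) (spechtRep F l)) = 1 := by
  obtain ⟨z, hz, hc⟩ := exists_youngSymmetrizer_mul_self (F := F) hl
  have hz' : (z : F) ≠ 0 := Int.cast_ne_zero.2 hz
  let c : SpechtModule F l := ⟨youngSymmetrizer F l, youngSymmetrizer_mem⟩
  have hc0 : c ≠ 0 := by
    intro h
    have h1 := coeff_youngSymmetrizer_one F (l := l)
    rw [show youngSymmetrizer F l = 0 from congrArg Subtype.val h] at h1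
    exact zero_ne_one h1
  have hact : ∀ (x : MonoidAlgebra F (Equiv.Perm (Fin (∑ i, l i)))) (s : SpechtModule F l),
      (spechtRep F l).asAlgebraHom x s = x • s := by
    intro x s
    induction x using MonoidAlgebra.induction_linear with
    | zero => rw [map_zero, zero_smul, LinearMap.zero_apply]
    | add x y hx hy => rw [map_add, LinearMap.add_apply, hx, hy, add_smul]
    | single g r =>
      rw [Representation.asAlgebraHom_single, LinearMap.smul_apply]
      refine Subtype.ext ?_
      rw [Submodule.coe_smul_of_tower, spechtRep_apply, ← smul_mul_assoc,
        MonoidAlgebra.smul_single, smul_eq_mul, mul_one]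
      rfl
  rw [finrank_intertwiningMap_spechtRep l hl]
  have hrange : LinearMap.range ((spechtRep F l).asAlgebraHom (youngSymmetrizer F l)) =
      Submodule.span F {c} := by
    refine le_antisymm ?_ ?_
    · rintro _ ⟨s, rfl⟩
      obtain ⟨y, hy⟩ := mem_spechtModule.1 s.2
      obtain ⟨κ, hκ⟩ := youngSymmetrizer_mul_mul F hl y
      rw [hact, Submodule.mem_span_singleton]
      refine ⟨κ, Subtype.ext ?_⟩
      change κ • youngSymmetrizer F l = youngSymmetrizer F l * (s : MonoidAlgebra F _)
      rw [← hκ, ← hy, mul_assoc]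
    · rw [Submodule.span_singleton_le_iff_mem]
      refine ⟨(z : F)⁻¹ • c, ?_⟩
      rw [map_smul, hact]
      refine Subtype.ext ?_
      change (z : F)⁻¹ • (youngSymmetrizer F l * youngSymmetrizer F l) = youngSymmetrizer F l
      rw [hc, smul_smul, inv_mul_cancel₀ hz', one_smul]
  rw [hrange, finrank_span_singleton hc0]

/-- Right multiplication by `z⁻¹ c` retracts the group algebra onto the Specht module, so the
character is the trace of `x ↦ z⁻¹ g x c`, visibly rational. Rationality will let a vanishing sum of
squares be concluded termwise over an arbitrary field of characteristic 0. -/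
theorem exists_rat_character_spechtRep (hl : Antitone l) (g : Equiv.Perm (Fin (∑ i, l i))) :
    ∃ r : ℚ, (spechtRep F l).character g = r := by
  obtain ⟨z, hz, hc⟩ := exists_youngSymmetrizer_mul_self (F := F) hl
  have hz' : (z : F) ≠ 0 := Int.cast_ne_zero.2 hz
  let π : MonoidAlgebra F (Equiv.Perm (Fin (∑ i, l i))) →ₗ[F] SpechtModule F l :=
    { toFun := fun x => ⟨(z : F)⁻¹ • (x * youngSymmetrizer F l), by
        rw [← smul_mul_assoc]
        exact mem_spechtModule.2 ⟨_, rfl⟩⟩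
      map_add' := fun x y => Subtype.ext (by simp [add_mul])
      map_smul' := fun r x => Subtype.ext (by
        change (z : F)⁻¹ • (r • x * youngSymmetrizer F l) =
          r • ((z : F)⁻¹ • (x * youngSymmetrizer F l))
        rw [smul_mul_assoc, smul_comm]) }
  have hπ : ∀ x, (π x : MonoidAlgebra F (Equiv.Perm (Fin (∑ i, l i)))) =
    (z : F)⁻¹ • (x * youngSymmetrizer F l) := fun x => rfl
  have h1 : spechtRep F l g = π ∘ₗ
      (LinearMap.mulLeft F (MonoidAlgebra.single g 1) ∘ₗ spechtInclusion F l) := by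
    refine LinearMap.ext fun s => Subtype.ext ?_
    rw [spechtRep_apply, LinearMap.comp_apply, hπ, LinearMap.comp_apply, LinearMap.mulLeft_apply]
    change _ = (z : F)⁻¹ • (MonoidAlgebra.single g 1 * (s : MonoidAlgebra F _) * _)
    obtain ⟨y, hy⟩ := mem_spechtModule.1 s.2
    rw [← hy, mul_assoc, mul_assoc, hc, mul_smul_comm, mul_smul_comm, smul_smul,
      inv_mul_cancel₀ hz', one_smul]
  obtain ⟨x, hx⟩ := exists_map_eq_youngSymmetrizer F l
  refine ⟨(z : ℚ)⁻¹ * ∑ h : Equiv.Perm (Fin (∑ i, l i)), (x.coeff (h⁻¹ * g⁻¹ * h) : ℚ), ?_⟩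
  rw [Representation.character, h1, LinearMap.trace_comp_comm', trace_monoidAlgebra, Rat.cast_mul,
    Rat.cast_inv, Rat.cast_intCast, Rat.cast_sum, Finset.mul_sum]
  refine Finset.sum_congr rfl fun h _ => ?_
  change (MonoidAlgebra.single g 1 * ((z : F)⁻¹ • (MonoidAlgebra.single h 1 *
    youngSymmetrizer F l))).coeff h = _
  rw [mul_smul_comm, ← mul_assoc, MonoidAlgebra.single_mul_single, MonoidAlgebra.coeff_smul,
    Finsupp.smul_apply, one_mul, MonoidAlgebra.coeff_single_mul_apply, one_mul, ← hx,
    MonoidAlgebra.coeff_mapRingHom, eq_intCast, smul_eq_mul, mul_inv_rev, Rat.cast_intCast]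

end Specht

/-! ### The permutation representations on words -/

section Words

variable {d : ℕ}

/-- The words of length `n` with content `β`. -/
abbrev Words (n : ℕ) (β : Fin d →₀ ℕ) : Type := {w : Fin n → Fin d // wordContent w = β}

instance (n : ℕ) (β : Fin d →₀ ℕ) : MulAction (Equiv.Perm (Fin n)) (Words n β) where
  smul g w := ⟨w.1 ∘ ⇑g⁻¹, by rw [wordContent_comp, w.2]⟩
  one_smul w := rfl
  mul_smul g h w := Subtype.ext (by
    change w.1 ∘ ⇑(g * h)⁻¹ = (w.1 ∘ ⇑h⁻¹) ∘ ⇑g⁻¹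
    rw [mul_inv_rev]; rfl)

theorem words_smul_coe {n : ℕ} {β : Fin d →₀ ℕ} (g : Equiv.Perm (Fin n)) (w : Words n β) :
    (g • w).1 = w.1 ∘ ⇑g⁻¹ := rfl

/-- The permutation representation on the words with content `β`. -/
abbrev wordRep (F : Type*) [Field F] (n : ℕ) (β : Fin d →₀ ℕ) :
    Representation F (Equiv.Perm (Fin n)) (MonoidAlgebra F (Words n β)) :=
  Representation.ofMulAction F (Equiv.Perm (Fin n)) (Words n β)

/-- The number of words with content `β` that are fixed by `g`. -/
def fixCount (n : ℕ) (β : Fin d →₀ ℕ) (g : Equiv.Perm (Fin n)) : ℕ :=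
  Nat.card (MulAction.fixedBy (Words n β) g)

theorem character_wordRep (F : Type*) [Field F] (n : ℕ) (β : Fin d →₀ ℕ)
    (g : Equiv.Perm (Fin n)) : (wordRep F n β).character g = fixCount n β g := by
  classical
  rw [Representation.character, trace_monoidAlgebra, fixCount, Nat.card_eq_fintype_card,
    Fintype.card_subtype, Finset.card_filter, Nat.cast_sum]
  refine Finset.sum_congr rfl fun w _ => ?_
  rw [Representation.ofMulAction_single, MonoidAlgebra.coeff_single, Finsupp.single_apply]
  simp [MulAction.mem_fixedBy]

theorem exists_comp_eq_of_card_fiber {n : ℕ} {ι : Type*} [DecidableEq ι] {u v : Fin n → ι}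
    (h : ∀ i, (Finset.univ.filter fun x => u x = i).card =
      (Finset.univ.filter fun x => v x = i).card) :
    ∃ σ : Equiv.Perm (Fin n), v ∘ σ = u := by
  have e : ∀ i, Nonempty ({x // u x = i} ≃ {x // v x = i}) := fun i =>
    ⟨Fintype.equivOfCardEq (by rw [Fintype.card_subtype, Fintype.card_subtype, h i])⟩
  refine ⟨Equiv.ofFiberEquiv fun i => (e i).some, ?_⟩
  funext x
  exact Equiv.ofFiberEquiv_map _ x

theorem exists_card_fiber_eq {n : ℕ} {ι : Type*} [Fintype ι] [DecidableEq ι] {k : ι → ℕ}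
    (h : ∑ i, k i = n) :
    ∃ u : Fin n → ι, ∀ i, (Finset.univ.filter fun x => u x = i).card = k i := by
  let e : Fin n ≃ (i : ι) × Fin (k i) := Fintype.equivOfCardEq (by simp [h])
  refine ⟨fun x => (e x).1, fun i => ?_⟩
  rw [← Fintype.card_subtype]
  have e' : {x // (e x).1 = i} ≃ Fin (k i) :=
    (e.subtypeEquiv fun x => Iff.rfl).trans (Equiv.sigmaSubtype i)
  rw [Fintype.card_congr e', Fintype.card_fin]

theorem exists_word {n : ℕ} {β : Fin d →₀ ℕ} (h : β.degree = n) :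
    ∃ w : Fin n → Fin d, wordContent w = β := by
  obtain ⟨u, hu⟩ := exists_card_fiber_eq (n := n) (k := β) (by rw [← Finsupp.degree_eq_sum, h])
  exact ⟨u, Finsupp.ext hu⟩

/-- The joint content of two words. -/
def jointContent {n : ℕ} (u v : Fin n → Fin d) (i : Fin d) : Fin d →₀ ℕ :=
  expo fun j => (Finset.univ.filter fun x => (u x, v x) = (j, i)).card

theorem jointContent_apply {n : ℕ} (u v : Fin n → Fin d) (i j : Fin d) :
    jointContent u v i j = (Finset.univ.filter fun x => (u x, v x) = (j, i)).card := rfl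

theorem sum_jointContent {n : ℕ} (u v : Fin n → Fin d) :
    ∑ i, jointContent u v i = wordContent u := by
  ext j
  rw [Finsupp.finsetSum_apply, wordContent_apply,
    Finset.card_eq_sum_card_fiberwise (f := v) (t := Finset.univ) (by intro x; simp)]
  refine Finset.sum_congr rfl fun i _ => ?_
  rw [jointContent_apply, Finset.filter_filter]
  simp only [Prod.mk.injEq]

theorem degree_jointContent {n : ℕ} (u v : Fin n → Fin d) (i : Fin d) :
    (jointContent u v i).degree = wordContent v i := by
  rw [Finsupp.degree_eq_sum, wordContent_apply,
    Finset.card_eq_sum_card_fiberwise (f := u) (t := Finset.univ) (by intro x; simp)]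
  refine Finset.sum_congr rfl fun j _ => ?_
  rw [jointContent_apply, Finset.filter_filter]
  simp only [Prod.mk.injEq, and_comm]

/-- The matrices of natural numbers with column sums `α` and row sums `β`. -/
def contingencyTables (α β : Fin d →₀ ℕ) : Finset (Fin d →₀ Fin d →₀ ℕ) :=
  open Classical in (Finset.univ.finsuppAntidiag α).filter fun m => ∀ i, (m i).degree = β i

theorem mem_contingencyTables {α β : Fin d →₀ ℕ} {m : Fin d →₀ Fin d →₀ ℕ} :
    m ∈ contingencyTables α β ↔ ∑ i, m i = α ∧ ∀ i, (m i).degree = β i := by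
  classical
  rw [contingencyTables, Finset.mem_filter, Finset.mem_finsuppAntidiag]
  simp

theorem coeff_completeProd (α β : Fin d →₀ ℕ) :
    coeff α (completeProd β d) = ((contingencyTables α β).card : ℂ) := by
  classical
  rw [completeProd, Finset.filter_true_of_mem (fun i _ => i.2), coeff_prod, contingencyTables,
    Finset.card_filter, Nat.cast_sum]
  refine Finset.sum_congr rfl fun m _ => ?_
  simp only [coeff_completeSeries, Finset.prod_boole, Finset.mem_univ, true_imp_iff]
  split_ifs <;> simp

/-- A pair of words up to simultaneous rearrangement is determined by how often each pair of letters
occurs, and every table with the right margins is realized. -/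
theorem card_orbits_words {n : ℕ} {α β : Fin d →₀ ℕ} (hα : α.degree = n) :
    Nat.card (MulAction.orbitRel.Quotient (Equiv.Perm (Fin n)) (Words n α × Words n β)) =
      (contingencyTables α β).card := by
  classical
  have hinv : ∀ (g : Equiv.Perm (Fin n)) (p : Words n α × Words n β),
      jointContent (g • p).1.1 (g • p).2.1 = jointContent p.1.1 p.2.1 := by
    intro g p
    funext i
    ext j
    rw [jointContent_apply, jointContent_apply]
    refine Finset.card_equiv (Equiv.symm g) fun x => ?_
    simp only [Finset.mem_filter, Finset.mem_univ, true_and]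
    rfl
  let f : MulAction.orbitRel.Quotient (Equiv.Perm (Fin n)) (Words n α × Words n β) →
      contingencyTables α β := Quotient.lift (fun p => ⟨Finsupp.equivFunOnFinite.symm
        (jointContent p.1.1 p.2.1), mem_contingencyTables.2 ⟨by
          simp only [Finsupp.equivFunOnFinite_symm_apply_apply, sum_jointContent, p.1.2], by
          intro i
          rw [Finsupp.equivFunOnFinite_symm_apply_apply, degree_jointContent, p.2.2]⟩⟩) (by
      intro p q hpq
      obtain ⟨g, rfl⟩ := MulAction.orbitRel_apply.1 hpq
      simp only [hinv])
  have hf : Function.Bijective f := by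
    constructor
    · intro a b
      refine Quotient.inductionOn₂ a b fun p q hpq => ?_
      have h : jointContent p.1.1 p.2.1 = jointContent q.1.1 q.2.1 :=
        Finsupp.equivFunOnFinite.symm.injective (congrArg Subtype.val hpq)
      obtain ⟨σ, hσ⟩ := exists_comp_eq_of_card_fiber (u := fun x => (p.1.1 x, p.2.1 x))
        (v := fun x => (q.1.1 x, q.2.1 x)) fun ⟨j, i⟩ => DFunLike.congr_fun (congrFun h i) j
      refine Quotient.sound (MulAction.orbitRel_apply.2 ⟨σ⁻¹, ?_⟩)
      refine Prod.ext (Subtype.ext (funext fun x => ?_)) (Subtype.ext (funext fun x => ?_))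
      · exact congrArg Prod.fst (congrFun hσ x)
      · exact congrArg Prod.snd (congrFun hσ x)
    · rintro ⟨m, hm⟩
      rw [mem_contingencyTables] at hm
      obtain ⟨u, hu⟩ := exists_card_fiber_eq (n := n) (k := fun p : Fin d × Fin d => m p.2 p.1) (by
        rw [← hα, ← hm.1, Finsupp.degree_eq_sum, Fintype.sum_prod_type]
        simp only [Finsupp.finsetSum_apply])
      have hj : jointContent (fun x => (u x).1) (fun x => (u x).2) = m := by
        funext i
        ext j
        exact hu (j, i)
      refine ⟨Quotient.mk _ (⟨fun x => (u x).1, ?_⟩, ⟨fun x => (u x).2, ?_⟩), Subtype.ext ?_⟩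
      · rw [← sum_jointContent _ (fun x => (u x).2), hj, hm.1]
      · ext i
        rw [← degree_jointContent (fun x => (u x).1), hj, hm.2]
      · change Finsupp.equivFunOnFinite.symm (jointContent (fun x => (u x).1)
          (fun x => (u x).2)) = m
        rw [hj]
        exact Finsupp.equivFunOnFinite_symm_coe m
  rw [Nat.card_eq_of_bijective f hf, Nat.card_eq_fintype_card, Fintype.card_coe]

/-- Burnside's lemma for the action on pairs of words. With `coeff_completeProd`, inner products of
permutation characters become coefficients of products of complete symmetric functions. -/
theorem sum_fixCount_mul {n : ℕ} {α β : Fin d →₀ ℕ} (hα : α.degree = n) :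
    ∑ g : Equiv.Perm (Fin n), fixCount n α g * fixCount n β g =
      (contingencyTables α β).card * Nat.card (Equiv.Perm (Fin n)) := by
  classical
  rw [← card_orbits_words hα, Nat.card_eq_fintype_card, Nat.card_eq_fintype_card,
    ← MulAction.sum_card_fixedBy_eq_card_orbits_mul_card_group]
  refine Finset.sum_congr rfl fun g _ => ?_
  rw [fixCount, fixCount, ← Nat.card_prod, ← Nat.card_eq_fintype_card]
  refine Nat.card_congr ⟨fun p => ⟨(p.1.1, p.2.1), Prod.ext p.1.2 p.2.2⟩, fun p =>
    (⟨p.1.1, congrArg Prod.fst p.2⟩, ⟨p.1.2, congrArg Prod.snd p.2⟩), fun _ => rfl, fun _ => rfl⟩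

end Words

/-! ### The irreducible characters as alternating sums of permutation characters -/

section Characters

variable {d : ℕ}

theorem altCoeff_mul_left {A : Type*} [Ring A] (l : Fin d → ℕ) (c : A) (f : (Fin d →₀ ℕ) → A) :
    (altCoeff l fun a => c * f a) = c * altCoeff l f :=
  (map_altCoeff (AddMonoidHom.mulLeft c) l f).symm

theorem isConj_inv {n : ℕ} (g : Equiv.Perm (Fin n)) : IsConj g g⁻¹ := by
  rw [Equiv.Perm.isConj_iff_cycleType_eq, Equiv.Perm.cycleType_inv]

variable {F : Type*} [Field F] {l : Fin d → ℕ}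

theorem character_inv {n : ℕ} {V : Type*} [AddCommGroup V] [Module F V]
    (ρ : Representation F (Equiv.Perm (Fin n)) V) (g : Equiv.Perm (Fin n)) :
    ρ.character g⁻¹ = ρ.character g := by
  obtain ⟨c, hc⟩ := isConj_iff.1 (isConj_inv g)
  rw [← hc, Representation.char_conj]

theorem wordRep_single {n : ℕ} {β : Fin d →₀ ℕ} (g : Equiv.Perm (Fin n)) (w : Words n β) :
    wordRep F n β g (MonoidAlgebra.single w 1) = MonoidAlgebra.single (g • w) 1 :=
  Representation.ofMulAction_single ..

theorem asAlgebraHom_wordRep_coeff {n : ℕ} {β : Fin d →₀ ℕ}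
    (x : MonoidAlgebra F (Equiv.Perm (Fin n))) (u w : Words n β) :
    ((wordRep F n β).asAlgebraHom x (MonoidAlgebra.single w 1)).coeff u =
      ∑ g : Equiv.Perm (Fin n), if g • w = u then x.coeff g else 0 := by
  classical
  induction x using MonoidAlgebra.induction_linear with
  | zero => simp
  | add x y hx hy =>
    rw [map_add, LinearMap.add_apply, MonoidAlgebra.coeff_add, Finsupp.add_apply, hx, hy,
      ← Finset.sum_add_distrib]
    refine Finset.sum_congr rfl fun g _ => ?_
    split_ifs <;> simp
  | single h r =>
    rw [Representation.asAlgebraHom_single, LinearMap.smul_apply, wordRep_single,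
      MonoidAlgebra.smul_single, MonoidAlgebra.coeff_single, MonoidAlgebra.coeff_single,
      Finset.sum_eq_single h]
    · simp [Finsupp.single_apply]
    · intro g _ hg
      simp [hg.symm]
    · simp

variable [CharZero F]

/-- A repeated letter in a column is fixed by a transposition under which the signed column sum
changes sign. -/
theorem isColumnInjective_of_colSum_ne_zero {β : Fin d →₀ ℕ} {w : Words (∑ i, l i) β}
    (h : (wordRep F (∑ i, l i) β).asAlgebraHom (colSum F l) (MonoidAlgebra.single w 1) ≠ 0) :
    IsColumnInjective w.1 := by
  intro x y hc hw
  by_contra hxy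
  refine h (eq_zero_of_eq_neg F ?_)
  have h1 : Equiv.swap x y • w = w := by
    refine Subtype.ext (funext fun z => ?_)
    rw [words_smul_coe, Equiv.swap_inv, Function.comp_apply, Equiv.swap_apply_def]
    split_ifs with h1 h2
    · rw [h1, hw]
    · rw [h2, hw]
    · rfl
  have h2 := colSum_mul_single F (swap_tableauCol hc)
  rw [Equiv.Perm.sign_swap hxy] at h2
  have h3 := congrArg (fun x => (wordRep F (∑ i, l i) β).asAlgebraHom x
    (MonoidAlgebra.single w 1)) h2
  simpa [Representation.asAlgebraHom_single_one, wordRep_single, h1, -Representation.asAlgebraHom_single] using h3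

theorem partialSum_le_of_finrank_ne_zero (hl : Antitone l) {β : Fin d →₀ ℕ}
    (h : Module.finrank F (Representation.IntertwiningMap (spechtRep F l)
      (wordRep F (∑ i, l i) β)) ≠ 0) (m : ℕ) : partialSum β m ≤ partialSum l m := by
  obtain ⟨w, hw⟩ : ∃ w : Words (∑ i, l i) β, IsColumnInjective w.1 := by
    by_contra! hno
    refine h ?_
    have h0 : (wordRep F (∑ i, l i) β).asAlgebraHom (colSum F l) = 0 := by
      refine MonoidAlgebra.lhom_ext' fun w => LinearMap.ext_ring ?_
      by_contra h1
      exact hno w (isColumnInjective_of_colSum_ne_zero (F := F) h1)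
    rw [finrank_intertwiningMap_spechtRep l hl, youngSymmetrizer_eq, map_mul, h0, mul_zero,
      LinearMap.range_zero, finrank_bot]
  rw [← w.2]
  exact hw.partialSum_le hl m

theorem finrank_intertwiningMap_wordRep_self (hl : Antitone l) :
    Module.finrank F (Representation.IntertwiningMap (spechtRep F l)
      (wordRep F (∑ i, l i) (expo l))) = 1 := by
  classical
  let w₀ : Words (∑ i, l i) (expo l) := ⟨rowWord l, wordContent_rowWord⟩
  set ρ := wordRep F (∑ i, l i) (expo l) with hρ
  let v₀ := ρ.asAlgebraHom (youngSymmetrizer F l) (MonoidAlgebra.single w₀ 1)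
  have hfix : ∀ g : Equiv.Perm (Fin (∑ i, l i)), g • w₀ = w₀ →
      ∀ x, tableauRow l (g x) = tableauRow l x := by
    intro g hg x
    have h1 := congrFun (congrArg Subtype.val hg) (g x)
    rw [words_smul_coe, Function.comp_apply, ← Equiv.Perm.mul_apply, inv_mul_cancel,
      Equiv.Perm.one_apply] at h1
    exact tableauRow_eq_iff.2 h1.symm
  have hv₀ : v₀ ≠ 0 := by
    intro h
    have h1 := congrArg (fun x => x.coeff w₀) h
    simp only [v₀] at h1
    rw [asAlgebraHom_wordRep_coeff, MonoidAlgebra.coeff_zero, Finsupp.zero_apply] at h1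
    -- The stabilizer of the row word preserves rows, and there the symmetrizer has coefficient 1.
    -- The coefficient of `w₀` in `v₀` is hence the order of this stabilizer, nonzero in
    -- characteristic 0.
    have h2 : ∀ g : Equiv.Perm (Fin (∑ i, l i)), (if g • w₀ = w₀ then
        (youngSymmetrizer F l).coeff g else 0) = if g • w₀ = w₀ then 1 else 0 := by
      intro g
      split_ifs with hg
      · have h3 : MonoidAlgebra.single g 1 * youngSymmetrizer F l = youngSymmetrizer F l := by
          rw [youngSymmetrizer_eq, ← mul_assoc, single_mul_rowSum F (hfix g hg)]
        rw [← h3, MonoidAlgebra.coeff_single_mul_apply, one_mul, inv_mul_cancel,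
          coeff_youngSymmetrizer_one]
      · rfl
    simp only [h2, Finset.sum_boole, Nat.cast_eq_zero] at h1
    exact Finset.card_ne_zero_of_mem
      (Finset.mem_filter.2 ⟨Finset.mem_univ 1, one_smul _ w₀⟩) h1
  have hrange : LinearMap.range (ρ.asAlgebraHom (youngSymmetrizer F l)) =
      Submodule.span F {v₀} := by
    refine le_antisymm ?_ ?_
    · rintro _ ⟨x, rfl⟩
      induction x using MonoidAlgebra.induction_linear with
      | zero => rw [map_zero]; exact zero_mem _
      | add x y hx hy => rw [map_add]; exact add_mem hx hy
      | single w r =>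
        have : (MonoidAlgebra.single w r : MonoidAlgebra F (Words (∑ i, l i) (expo l))) =
          r • MonoidAlgebra.single w 1 := by simp
        rw [this, map_smul]
        refine Submodule.smul_mem _ _ ?_
        by_cases hw : ρ.asAlgebraHom (colSum F l) (MonoidAlgebra.single w 1) = 0
        · rw [youngSymmetrizer_eq, map_mul, Module.End.mul_apply, hw, map_zero]
          exact zero_mem _
        -- A word not killed by the column sum is a column rearrangement of the row word, so the
        -- symmetrizer sends it to `v₀` up to sign.
        · obtain ⟨τ, hτ, hwτ⟩ := (isColumnInjective_of_colSum_ne_zero hw).exists_perm hl w.2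
          have hτ' : ∀ x, tableauCol l (τ⁻¹ x) = tableauCol l x := by
            intro x
            rw [← hτ (τ⁻¹ x), ← Equiv.Perm.mul_apply, mul_inv_cancel, Equiv.Perm.one_apply]
          have h1 : w = τ⁻¹ • w₀ := by
            refine Subtype.ext ?_
            rw [hwτ, words_smul_coe, inv_inv]
          rw [h1, ← wordRep_single, ← hρ, ← Representation.asAlgebraHom_single_one,
            ← Module.End.mul_apply, ← map_mul, youngSymmetrizer_eq, mul_assoc,
            colSum_mul_single F hτ', mul_smul_comm, map_smul, LinearMap.smul_apply]
          exact Submodule.smul_mem _ _ (Submodule.mem_span_singleton_self _)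
    · rw [Submodule.span_singleton_le_iff_mem]
      exact ⟨_, rfl⟩
  rw [finrank_intertwiningMap_spechtRep l hl, hrange, finrank_span_singleton hv₀]

/-- The alternating sum of permutation characters that gives the irreducible character. -/
def altFix (l : Fin d → ℕ) (g : Equiv.Perm (Fin (∑ i, l i))) : ℤ :=
  altCoeff l fun β => (fixCount (∑ i, l i) β g : ℤ)

theorem cast_altFix {A : Type*} [Ring A] (l : Fin d → ℕ) (g : Equiv.Perm (Fin (∑ i, l i))) :
    (altFix l g : A) = altCoeff l fun β => (fixCount (∑ i, l i) β g : A) := by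
  have h := map_altCoeff (Int.castAddHom A) l fun β => (fixCount (∑ i, l i) β g : ℤ)
  simpa [altFix] using h

theorem sum_altFix_mul_self (hl : Antitone l) :
    ∑ g, altFix l g * altFix l g = Nat.card (Equiv.Perm (Fin (∑ i, l i))) := by
  have h : ∑ g, (altFix l g : ℂ) * altFix l g = Nat.card (Equiv.Perm (Fin (∑ i, l i))) := by
    simp only [cast_altFix, ← altCoeff_mul_left]
    rw [← altCoeff_sum]
    have h1 : ∀ β : Fin d →₀ ℕ, β.degree = ∑ i, l i →
        (∑ g, (altCoeff l fun α => (fixCount (∑ i, l i) α g : ℂ)) * fixCount (∑ i, l i) β g) =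
        Nat.card (Equiv.Perm (Fin (∑ i, l i))) *
          altCoeff l fun α => coeff α (completeProd (d := d) β d) := by
      intro β hβ
      rw [← altCoeff_mul_left]
      simp only [mul_comm _ (fixCount _ β _ : ℂ), ← altCoeff_mul_left]
      rw [← altCoeff_sum]
      refine altCoeff_congr fun α hα => ?_
      rw [coeff_completeProd, mul_comm]
      have := sum_fixCount_mul (β := β) hα
      rw [← Nat.cast_mul, ← this, Nat.cast_sum]
      refine Finset.sum_congr rfl fun g _ => ?_
      rw [Nat.cast_mul, mul_comm]
    rw [altCoeff_congr h1, altCoeff_mul_left, altCoeff_completeProd hl, mul_one]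
  exact_mod_cast h

theorem sum_character_mul {n : ℕ} {V W : Type*} [AddCommGroup V] [Module F V]
    [Module.Finite F V] [AddCommGroup W] [Module F W] [Module.Finite F W]
    (ρ : Representation F (Equiv.Perm (Fin n)) V) (σ : Representation F (Equiv.Perm (Fin n)) W) :
    ∑ g, ρ.character g * σ.character g = Nat.card (Equiv.Perm (Fin n)) *
      (Module.finrank F (Representation.IntertwiningMap ρ σ) : F) := by
  have h0 : (Nat.card (Equiv.Perm (Fin n)) : F) ≠ 0 := Nat.cast_ne_zero.2 Nat.card_pos.ne'
  have := invertibleOfNonzero h0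
  rw [← Representation.card_inv_mul_sum_char_mul_char_eq_finrank, ← mul_assoc,
    mul_inv_cancel₀ h0, one_mul]
  refine Finset.sum_congr rfl fun g _ => ?_
  rw [character_inv, mul_comm]

/-- Both class functions have norm 1 and their inner product is 1, so the squares of their
differences sum to zero. The values are rational, so each difference vanishes. -/
theorem character_spechtRep (hl : Antitone l) (g : Equiv.Perm (Fin (∑ i, l i))) :
    (spechtRep F l).character g = altFix l g := by
  choose χ hχ using exists_rat_character_spechtRep (F := F) hl
  have h1 : ∑ g, χ g * χ g = Nat.card (Equiv.Perm (Fin (∑ i, l i))) := by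
    have h := sum_character_mul (spechtRep F l) (spechtRep F l)
    rw [finrank_end_spechtRep hl] at h
    simp only [hχ, Nat.cast_one, mul_one] at h
    exact_mod_cast h
  have h2 : ∑ g, χ g * altFix l g = Nat.card (Equiv.Perm (Fin (∑ i, l i))) := by
    have h : ∑ g, (spechtRep F l).character g * (altFix l g : F) =
        Nat.card (Equiv.Perm (Fin (∑ i, l i))) := by
      simp only [cast_altFix, ← altCoeff_mul_left, ← character_wordRep]
      rw [← altCoeff_sum]
      simp only [sum_character_mul]
      -- The multiplicities of the Specht module in the word modules are unitriangular for
      -- dominance, so the alternating sum collapses to the diagonal one.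
      rw [altCoeff_mul_left, altCoeff_eq_of_partialSum_le,
        finrank_intertwiningMap_wordRep_self hl, Nat.cast_one, mul_one]
      exact fun a _ ha => partialSum_le_of_finrank_ne_zero (F := F) hl (Nat.cast_ne_zero.1 ha)
    simp only [hχ] at h
    exact_mod_cast h
  have h3 : ∑ g, (altFix l g : ℚ) * altFix l g = Nat.card (Equiv.Perm (Fin (∑ i, l i))) := by
    exact_mod_cast sum_altFix_mul_self hl
  have h4 : ∑ g, (χ g - altFix l g) * (χ g - altFix l g) = 0 := by
    have : ∀ g, (χ g - altFix l g) * (χ g - altFix l g) =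
        χ g * χ g - χ g * altFix l g - (χ g * altFix l g - (altFix l g : ℚ) * altFix l g) := by
      intro g; ring
    simp only [this, Finset.sum_sub_distrib, h1, h2, h3, sub_self]
  have h5 := (Finset.sum_eq_zero_iff_of_nonneg fun g _ => mul_self_nonneg _).1 h4 g
    (Finset.mem_univ g)
  rw [hχ, sub_eq_zero.1 (mul_self_eq_zero.1 h5), Rat.cast_intCast]

/-- The multiplicity of an irreducible character in a representation. -/
theorem finrank_intertwiningMap_eq_altCoeff (hl : Antitone l) {V : Type*} [AddCommGroup V]
    [Module F V] [Module.Finite F V] (ρ : Representation F (Equiv.Perm (Fin (∑ i, l i))) V) :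
    (Module.finrank F (Representation.IntertwiningMap (spechtRep F l) ρ) : ℤ) =
      altCoeff l fun β => (Module.finrank F
        (Representation.IntertwiningMap (wordRep F (∑ i, l i) β) ρ) : ℤ) := by
  have h0 : (Nat.card (Equiv.Perm (Fin (∑ i, l i))) : F) ≠ 0 :=
    Nat.cast_ne_zero.2 Nat.card_pos.ne'
  have h : (Module.finrank F (Representation.IntertwiningMap (spechtRep F l) ρ) : F) =
      altCoeff l fun β => (Module.finrank F
        (Representation.IntertwiningMap (wordRep F (∑ i, l i) β) ρ) : F) := by
    refine mul_left_cancel₀ h0 ?_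
    rw [← sum_character_mul, ← altCoeff_mul_left]
    simp only [character_spechtRep hl, cast_altFix, ← sum_character_mul, character_wordRep]
    rw [altCoeff_sum]
    refine Finset.sum_congr rfl fun g _ => ?_
    rw [mul_comm, ← altCoeff_mul_left]
    simp only [mul_comm]
  have h' := map_altCoeff (Int.castAddHom F) l fun β => (Module.finrank F
        (Representation.IntertwiningMap (wordRep F (∑ i, l i) β) ρ) : ℤ)
  simp only [Int.coe_castAddHom, Int.cast_natCast] at h'
  rw [← h'] at h
  exact_mod_cast h

theorem wordContent_eq_sum {n : ℕ} (w : Fin n → Fin d) :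
    wordContent w = ∑ j, Finsupp.single (w j) 1 := by
  classical
  ext i
  rw [wordContent_apply, Finsupp.finsetSum_apply, Finset.card_filter]
  exact Finset.sum_congr rfl fun j _ => (Finsupp.single_apply).symm

theorem coeff_sum_X_pow (n : ℕ) (β : Fin d →₀ ℕ) :
    coeff β ((∑ i : Fin d, (X i : MvPowerSeries (Fin d) ℂ)) ^ n) =
      (Fintype.card (Words n β) : ℂ) := by
  classical
  have h : (∑ i : Fin d, (X i : MvPowerSeries (Fin d) ℂ)) ^ n =
      ∑ w : Fin n → Fin d, monomial (wordContent w) 1 := by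
    rw [← Fin.prod_const, Finset.prod_univ_sum, Fintype.piFinset_univ]
    refine Finset.sum_congr rfl fun w _ => ?_
    have h1 : (monomial (wordContent w) 1 : MvPowerSeries (Fin d) ℂ) =
        ∏ j, X (w j) := by
      simp only [wordContent_eq_sum, X, prod_monomial, Finset.prod_const_one]
    exact h1.symm
  rw [h, map_sum, Fintype.card_subtype, Finset.card_filter, Nat.cast_sum]
  refine Finset.sum_congr rfl fun w _ => ?_
  rw [coeff_monomial]
  simp only [eq_comm, Nat.cast_ite, Nat.cast_one, Nat.cast_zero]

variable (F) in
-- At the identity every word is fixed, and the number of words of content `β` is the coefficient of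
-- `t^β` in the power of the sum of the variables.
theorem spechtDegree_eq_coeff (hl : Antitone l) :
    (spechtDegree F l : ℂ) = coeff (expo (l + staircase d))
      ((∑ i : Fin d, (X i : MvPowerSeries (Fin d) ℂ)) ^ (∑ i, l i) * vandermondeSeries d) := by
  have h : (spechtDegree F l : ℤ) = altFix l 1 := by
    have h1 := character_spechtRep (F := F) hl 1
    rw [Representation.char_one] at h1
    exact_mod_cast h1
  have h2 : ((spechtDegree F l : ℤ) : ℂ) = altFix l 1 := by rw [h]
  rw [Int.cast_natCast] at h2
  rw [h2, cast_altFix, coeff_mul_vandermondeSeries]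
  refine altCoeff_congr fun β _ => ?_
  rw [coeff_sum_X_pow, fixCount, MulAction.fixedBy_one_eq_univ, Nat.card_univ,
    Nat.card_eq_fintype_card]

end Characters

/-! ### Identities as linear combinations of words -/

section WordPolynomials

variable {K X : Type*} [Field K]

/-- The number of occurrences of each letter in a list. -/
def content (w : List X) : X →₀ ℕ := (w.map fun i => Finsupp.single i 1).sum

@[simp] theorem content_nil : content ([] : List X) = 0 := rfl

@[simp] theorem content_cons (i : X) (w : List X) :
    content (i :: w) = Finsupp.single i 1 + content w := by
  rw [content, List.map_cons, List.sum_cons, content]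

theorem content_append (u v : List X) : content (u ++ v) = content u + content v := by
  rw [content, List.map_append, List.sum_append, content, content]

theorem content_ofFn {n : ℕ} (w : Fin n → X) :
    content (List.ofFn w) = ∑ i, Finsupp.single (w i) 1 := by
  rw [content, List.map_ofFn, List.sum_ofFn]
  rfl

theorem degree_content (w : List X) : (content w).degree = w.length := by
  induction w with
  | nil => simp
  | cons i w ih => rw [content_cons, map_add, ih, Finsupp.degree_single, List.length_cons, add_comm]

/-! ### Evaluation of words and the grading of identities by content. -/

section Eval

variable {R : Type*} [Ring R] [Algebra K R]

variable (K) in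
/-- Evaluation of linear combinations of words. -/
def evalWords (A : X → R) : (List X →₀ K) →ₗ[K] R :=
  Finsupp.linearCombination K fun w => (w.map A).prod

@[simp] theorem evalWords_single (A : X → R) (w : List X) (r : K) :
    evalWords K A (Finsupp.single w r) = r • (w.map A).prod :=
  Finsupp.linearCombination_single ..

variable (K X R) in
/-- The identities of `R`, as linear combinations of words. -/
def wordIdentities : Submodule K (List X →₀ K) := ⨅ A : X → R, LinearMap.ker (evalWords K A)

theorem mem_wordIdentities {f : List X →₀ K} :
    f ∈ wordIdentities K X R ↔ ∀ A : X → R, evalWords K A f = 0 := by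
  simp [wordIdentities]

variable (K) in
/-- Multiplication by a word from the left. -/
def appendWord (u : List X) : (List X →₀ K) →ₗ[K] (List X →₀ K) :=
  Finsupp.lmapDomain K K (u ++ ·)

@[simp] theorem appendWord_single (u w : List X) (r : K) :
    appendWord K u (Finsupp.single w r) = Finsupp.single (u ++ w) r := by
  rw [appendWord, Finsupp.lmapDomain_apply, Finsupp.mapDomain_single]

theorem evalWords_appendWord (A : X → R) (u : List X) (f : List X →₀ K) :
    evalWords K A (appendWord K u f) = (u.map A).prod * evalWords K A f := by
  induction f using Finsupp.induction_linear with
  | zero => simp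
  | add f g hf hg => simp only [map_add, hf, hg, mul_add]
  | single w r => simp

theorem appendWord_mem {f : List X →₀ K} (hf : f ∈ wordIdentities K X R) (u : List X) :
    appendWord K u f ∈ wordIdentities K X R := by
  rw [mem_wordIdentities] at hf ⊢
  intro A
  rw [evalWords_appendWord, hf, mul_zero]

variable (K) in
/-- The component of a given content. -/
def component (α : X →₀ ℕ) : (List X →₀ K) →ₗ[K] (List X →₀ K) :=
  open Classical in
  Finsupp.linearCombination K fun w => if content w = α then Finsupp.single w 1 else 0

theorem component_single_of_eq {α : X →₀ ℕ} {w : List X} (h : content w = α) (r : K) :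
    component K α (Finsupp.single w r) = Finsupp.single w r := by
  simp [component, h]

theorem component_single_of_ne {α : X →₀ ℕ} {w : List X} (h : content w ≠ α) (r : K) :
    component K α (Finsupp.single w r) = 0 := by
  simp [component, h]

theorem component_apply (α : X →₀ ℕ) (f : List X →₀ K) (w : List X) [Decidable (content w = α)] :
    component K α f w = if content w = α then f w else 0 := by
  classical
  induction f using Finsupp.induction_linear with
  | zero => simp
  | add f g hf hg => rw [map_add, Finsupp.add_apply, hf, hg]; split_ifs <;> simp
  | single v r =>
    by_cases hv : content v = α
    · rw [component_single_of_eq hv, Finsupp.single_apply]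
      split_ifs with h1 h2 h2
      · rfl
      · exact absurd (h1 ▸ hv) h2
      · rfl
      · rfl
    · rw [component_single_of_ne hv, Finsupp.single_apply]
      split_ifs with h1 h2
      · exact absurd (h2 ▸ h1) hv
      · rfl
      · rfl

theorem sum_component {f : List X →₀ K} (s : Finset (X →₀ ℕ))
    (hs : ∀ w ∈ f.support, content w ∈ s) : ∑ α ∈ s, component K α f = f := by
  classical
  ext w
  simp only [Finsupp.finsetSum_apply, component_apply, Finset.sum_ite_eq]
  split_ifs with h
  · rfl
  · by_contra h0
    exact h (hs w (Finsupp.mem_support_iff.2 (Ne.symm h0)))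

/-- Over an infinite field the identities are graded by content. -/
theorem component_mem [Infinite K] {f : List X →₀ K} (hf : f ∈ wordIdentities K X R)
    (α : X →₀ ℕ) : component K α f ∈ wordIdentities K X R := by
  rw [mem_wordIdentities] at hf ⊢
  intro A
  rw [← Module.forall_dual_apply_eq_zero_iff K]
  intro ψ
  -- Rescale the substitution to `c i • A i` and apply a functional `ψ`. The result is a polynomial
  -- in `c` whose coefficient at `α` is the value of the component; it vanishes at all points over
  -- an infinite field, hence identically.
  let P : (List X →₀ K) →ₗ[K] MvPolynomial X K := Finsupp.linearCombination K fun w =>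
    MvPolynomial.monomial (content w) (ψ (w.map A).prod)
  have hP : ∀ w r, P (Finsupp.single w r) =
      r • MvPolynomial.monomial (content w) (ψ (w.map A).prod) := fun w r =>
    Finsupp.linearCombination_single ..
  have h1 : ∀ (c : X → K) (g : List X →₀ K),
      MvPolynomial.eval c (P g) = ψ (evalWords K (fun i => c i • A i) g) := by
    intro c g
    induction g using Finsupp.induction_linear with
    | zero => simp
    | add f g hf hg => simp only [map_add, hf, hg]
    | single w r =>
      have h2 : (w.map fun i => c i • A i).prod =
          ((content w).prod fun i n => c i ^ n) • (w.map A).prod := by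
        induction w with
        | nil => simp
        | cons i w ih =>
          rw [List.map_cons, List.prod_cons, ih, content_cons, List.map_cons, List.prod_cons,
            Finsupp.prod_add_index' (by simp) (by intro a b c; exact pow_add _ _ _),
            Finsupp.prod_single_index (by simp), pow_one, smul_mul_smul_comm]
      rw [hP, MvPolynomial.smul_eval, MvPolynomial.eval_monomial, evalWords_single, h2, map_smul,
        map_smul, smul_eq_mul, smul_eq_mul]
      ring
  have h2 : ∀ g : List X →₀ K, (P g).coeff α = ψ (evalWords K A (component K α g)) := by
    intro g
    induction g using Finsupp.induction_linear with
    | zero => simp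
    | add f g hf hg => simp only [map_add, MvPolynomial.coeff_add, hf, hg]
    | single w r =>
      classical
      rw [hP, MvPolynomial.coeff_smul, MvPolynomial.coeff_monomial]
      by_cases h : content w = α
      · rw [component_single_of_eq h, evalWords_single, if_pos h, map_smul]
      · rw [component_single_of_ne h, if_neg h, map_zero, map_zero, smul_zero]
  have h3 : P f = 0 := MvPolynomial.funext fun c => by rw [h1, hf, map_zero, map_zero]
  rw [← h2, h3, MvPolynomial.coeff_zero]

end Eval

/-! ### The identities of the algebras of upper triangular matrices -/

section Bordered

variable {k : ℕ}

/-- The matrix with the first row `(x, y)`, with `M` below `y` and zeros below `x`. -/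
def bordered (x : K) (y : Fin k → K) (M : Matrix (Fin k) (Fin k) K) :
    Matrix (Fin (k + 1)) (Fin (k + 1)) K :=
  Matrix.of (Fin.cons (Fin.cons x y) fun t => Fin.cons 0 (M t))

@[simp] theorem bordered_zero_zero (x : K) (y : Fin k → K) (M : Matrix (Fin k) (Fin k) K) :
    bordered x y M 0 0 = x := rfl

@[simp] theorem bordered_zero_succ (x : K) (y : Fin k → K) (M : Matrix (Fin k) (Fin k) K)
    (s : Fin k) : bordered x y M 0 s.succ = y s := rfl

@[simp] theorem bordered_succ_zero (x : K) (y : Fin k → K) (M : Matrix (Fin k) (Fin k) K)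
    (t : Fin k) : bordered x y M t.succ 0 = 0 := rfl

@[simp] theorem bordered_succ_succ (x : K) (y : Fin k → K) (M : Matrix (Fin k) (Fin k) K)
    (t s : Fin k) : bordered x y M t.succ s.succ = M t s := rfl

theorem matrix_ext_succ {S : Type*} {M N : Matrix (Fin (k + 1)) (Fin (k + 1)) S} (h00 : M 0 0 = N 0 0)
    (h0 : ∀ s : Fin k, M 0 s.succ = N 0 s.succ) (h1 : ∀ t : Fin k, M t.succ 0 = N t.succ 0)
    (h : ∀ t s : Fin k, M t.succ s.succ = N t.succ s.succ) : M = N := by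
  ext r s
  refine Fin.cases ?_ (fun r => ?_) r <;> refine Fin.cases ?_ (fun s => ?_) s
  exacts [h00, h0 s, h1 r, h r s]

theorem bordered_mul (x x' : K) (y y' : Fin k → K) (M M' : Matrix (Fin k) (Fin k) K) :
    bordered x y M * bordered x' y' M' =
      bordered (x * x') (fun s => x * y' s + ∑ t, y t * M' t s) (M * M') := by
  apply matrix_ext_succ <;> intros <;> simp [Matrix.mul_apply, Fin.sum_univ_succ]

theorem bordered_one : bordered (1 : K) 0 (1 : Matrix (Fin k) (Fin k) K) = 1 := by
  apply matrix_ext_succ <;> intros <;>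
    simp [Matrix.one_apply, Fin.succ_ne_zero, (Fin.succ_ne_zero _).symm]

theorem bordered_add (x x' : K) (y y' : Fin k → K) (M M' : Matrix (Fin k) (Fin k) K) :
    bordered x y M + bordered x' y' M' = bordered (x + x') (y + y') (M + M') := by
  apply matrix_ext_succ <;> intros <;> simp

theorem smul_bordered (r x : K) (y : Fin k → K) (M : Matrix (Fin k) (Fin k) K) :
    r • bordered x y M = bordered (r * x) (r • y) (r • M) := by
  apply matrix_ext_succ <;> intros <;> simp

theorem bordered_blockTriangular (x : K) (y : Fin k → K) {M : Matrix (Fin k) (Fin k) K}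
    (hM : M.BlockTriangular id) : (bordered x y M).BlockTriangular id := by
  intro r s hrs
  induction r using Fin.cases with
  | zero => exact absurd hrs (Fin.not_lt_zero _)
  | succ r =>
    induction s using Fin.cases with
    | zero => rfl
    | succ s => exact hM (Fin.succ_lt_succ_iff.1 hrs)

theorem exists_eq_bordered {M : Matrix (Fin (k + 1)) (Fin (k + 1)) K}
    (hM : M.BlockTriangular id) : ∃ x y N, N.BlockTriangular id ∧ M = bordered x y N := by
  refine ⟨M 0 0, fun s => M 0 s.succ, Matrix.of fun t s => M t.succ s.succ, ?_, ?_⟩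
  · intro t s hts
    exact hM (Fin.succ_lt_succ_iff.2 hts)
  · apply matrix_ext_succ <;> intros <;> try rfl
    exact hM (Fin.succ_pos _)

end Bordered

/-! ### Derivatives of words and the first row of a triangular matrix. -/

section Derivative

variable [DecidableEq X]

/-- `∑ a(u) v`, where the sum is over all factorizations `u j v` of a word. -/
def derivWord (a : X → K) (j : X) : List X → (List X →₀ K)
  | [] => 0
  | i :: w => (if i = j then Finsupp.single w 1 else 0) + a i • derivWord a j w

/-- The linear extension of `derivWord`. -/
def wordDeriv (a : X → K) (j : X) : (List X →₀ K) →ₗ[K] (List X →₀ K) :=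
  Finsupp.linearCombination K (derivWord a j)

@[simp] theorem wordDeriv_single (a : X → K) (j : X) (w : List X) (r : K) :
    wordDeriv a j (Finsupp.single w r) = r • derivWord a j w :=
  Finsupp.linearCombination_single ..

/-- Expanding a product of bordered matrices, the first row passes from the scalar corner to the
lower block at exactly one letter `j`. Each factorization `u j v` thus contributes `a(u) c_j B(v)`.
-/
theorem evalWords_bordered [Fintype X] {k : ℕ} (a : X → K) (c : X → Fin k → K)
    (B : X → Matrix (Fin k) (Fin k) K) (f : List X →₀ K) :
    evalWords K (fun i => bordered (a i) (c i) (B i)) f = bordered (evalWords K a f)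
      (fun s => ∑ j, ∑ t, c j t * evalWords K B (wordDeriv a j f) t s) (evalWords K B f) := by
  induction f using Finsupp.induction_linear with
  | zero =>
    simp only [map_zero]
    apply matrix_ext_succ <;> intros <;> simp
  | add f g hf hg =>
    simp only [map_add, hf, hg, bordered_add, Matrix.add_apply, mul_add, Finset.sum_add_distrib]
    rfl
  | single w r =>
    have h : (w.map fun i => bordered (a i) (c i) (B i)).prod = bordered (w.map a).prod
        (fun s => ∑ j, ∑ t, c j t * evalWords K B (derivWord a j w) t s) (w.map B).prod := by
      induction w with
      | nil =>
        simp only [List.map_nil, List.prod_nil, derivWord, map_zero, Matrix.zero_apply, mul_zero,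
          Finset.sum_const_zero]
        exact bordered_one.symm
      | cons i w ih =>
        simp only [List.map_cons, List.prod_cons, ih, bordered_mul]
        congr 1
        funext s
        simp only [derivWord, map_add, map_smul, Matrix.add_apply, Matrix.smul_apply, smul_eq_mul,
          mul_add, Finset.sum_add_distrib, Finset.mul_sum]
        rw [add_comm]
        congr 1
        · rw [Finset.sum_eq_single i]
          · simp
          · intro j _ hj
            simp [hj.symm]
          · simp
        · refine Finset.sum_congr rfl fun j _ => Finset.sum_congr rfl fun t _ => ?_
          ring
    simp only [evalWords_single, h, smul_bordered, wordDeriv_single, map_smul, smul_eq_mul]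
    congr 1
    funext s
    simp only [Pi.smul_apply, smul_eq_mul, Finset.mul_sum, Matrix.smul_apply]
    refine Finset.sum_congr rfl fun j _ => Finset.sum_congr rfl fun t _ => ?_
    ring

end Derivative

theorem mem_wordIdentities_upperTriangular {k : ℕ} {f : List X →₀ K} :
    f ∈ wordIdentities K X (UpperTriangular K k) ↔
      ∀ A : X → Matrix (Fin k) (Fin k) K, (∀ i, (A i).BlockTriangular id) →
        evalWords K A f = 0 := by
  have h : ∀ (A : X → UpperTriangular K k) (g : List X →₀ K),
      (evalWords K A g : Matrix (Fin k) (Fin k) K) =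
        evalWords K (fun i => (A i : Matrix (Fin k) (Fin k) K)) g := by
    intro A g
    induction g using Finsupp.induction_linear with
    | zero => simp
    | add f g hf hg => simp [hf, hg]
    | single w r =>
      rw [evalWords_single, evalWords_single, Subalgebra.coe_smul]
      congr 1
      change (UpperTriangular K k).val _ = _
      rw [map_list_prod, List.map_map]
      rfl
  rw [mem_wordIdentities]
  constructor
  · intro hf A hA
    rw [← h fun i => (⟨A i, hA i⟩ : UpperTriangular K k), hf]
    rfl
  · intro hf A
    refine Subtype.ext ?_
    rw [h, hf _ fun i => (A i).2]
    rfl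

theorem wordIdentities_upperTriangular_zero :
    wordIdentities K X (UpperTriangular K 0) = ⊤ := by
  rw [eq_top_iff]
  intro f _
  rw [mem_wordIdentities_upperTriangular]
  intro A _
  exact Subsingleton.elim _ _

variable [DecidableEq X] [Fintype X]

theorem wordIdentities_upperTriangular_succ_le (k : ℕ) :
    wordIdentities K X (UpperTriangular K (k + 1)) ≤ wordIdentities K X (UpperTriangular K k) := by
  intro f hf
  rw [mem_wordIdentities_upperTriangular] at hf ⊢
  intro B hB
  have h := hf (fun i => bordered 0 0 (B i)) fun i => bordered_blockTriangular _ _ (hB i)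
  have h1 := evalWords_bordered (0 : X → K) 0 B f
  ext t s
  have h2 := congrFun (congrFun (h1.symm.trans h) t.succ) s.succ
  simpa using h2

/-- The scalar corner and the corner row give the two conditions, as `a` and `c` are arbitrary.
Vanishing on the lower block `U_k` needs no condition of its own, since it follows from the others
by induction on `k`. -/
theorem mem_wordIdentities_upperTriangular_succ {k : ℕ} {f : List X →₀ K} :
    f ∈ wordIdentities K X (UpperTriangular K (k + 1)) ↔ ∀ a : X → K, evalWords K a f = 0 ∧
      ∀ j, wordDeriv a j f ∈ wordIdentities K X (UpperTriangular K k) := by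
  constructor
  · intro hf a
    rw [mem_wordIdentities_upperTriangular] at hf
    constructor
    · have h := hf (fun i => bordered (a i) 0 0) fun i =>
        bordered_blockTriangular _ _ (Matrix.blockTriangular_zero)
      have h1 := evalWords_bordered a (0 : X → Fin k → K) 0 f
      exact congrFun (congrFun (h1.symm.trans h) 0) 0
    · intro j
      rw [mem_wordIdentities_upperTriangular]
      intro B hB
      ext t s
      -- A unit vector at `t`, placed at the letter `j` only, isolates the entry `(t, s)` of the
      -- value of the `j`-th derivative.
      have h := hf (fun i => bordered (a i) (if i = j then Pi.single t 1 else 0) (B i)) fun i =>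
        bordered_blockTriangular _ _ (hB i)
      have h1 := evalWords_bordered a (fun i => if i = j then Pi.single t 1 else 0) B f
      have h2 := congrFun (congrFun (h1.symm.trans h) 0) s.succ
      rw [bordered_zero_succ, Finset.sum_eq_single j (by intro i _ hi; simp [hi]) (by simp),
        Finset.sum_eq_single t (by intro t' _ ht; simp [ht]) (by simp)] at h2
      simpa using h2
  · have key : ∀ m, f ∈ wordIdentities K X (UpperTriangular K m) →
        (∀ a : X → K, evalWords K a f = 0 ∧
          ∀ j, wordDeriv a j f ∈ wordIdentities K X (UpperTriangular K m)) →
        f ∈ wordIdentities K X (UpperTriangular K (m + 1)) := by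
      intro m hm hf
      rw [mem_wordIdentities_upperTriangular] at hm ⊢
      intro A hA
      choose a c B hB hA using fun i => exists_eq_bordered (hA i)
      obtain rfl : A = fun i => bordered (a i) (c i) (B i) := funext hA
      rw [evalWords_bordered, hm B hB, (hf a).1]
      apply matrix_ext_succ <;> intros <;> try rfl
      rw [bordered_zero_succ]
      refine Finset.sum_eq_zero fun j _ => Finset.sum_eq_zero fun t _ => ?_
      have h := (hf a).2 j
      rw [mem_wordIdentities_upperTriangular] at h
      rw [h B hB, Matrix.zero_apply, mul_zero]
    intro hf
    refine key k ?_ hf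
    induction k with
    | zero => rw [wordIdentities_upperTriangular_zero]; trivial
    | succ k ih =>
      -- Derivatives that are identities of the larger algebra are identities of the smaller one, so
      -- the induction hypothesis supplies the membership required by `key`.
      have hf' : ∀ a : X → K, evalWords K a f = 0 ∧
          ∀ j, wordDeriv a j f ∈ wordIdentities K X (UpperTriangular K k) := fun a =>
        ⟨(hf a).1, fun j => wordIdentities_upperTriangular_succ_le k ((hf a).2 j)⟩
      exact key k (ih hf') hf'

end WordPolynomials

/-! ### The dimensions of the homogeneous components -/

section Components

variable {K X : Type*} [Field K]

variable (K) in
/-- The span of the words with content in a given set. -/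
def wordsIn (s : Finset (X →₀ ℕ)) : Submodule K (List X →₀ K) :=
  Finsupp.supported K K {w | content w ∈ s}

theorem single_mem_wordsIn {s : Finset (X →₀ ℕ)} {w : List X} (h : content w ∈ s) (r : K) :
    Finsupp.single w r ∈ wordsIn K s :=
  Finsupp.single_mem_supported K r h

theorem map_mem_of_wordsIn {M : Type*} [AddCommGroup M] [Module K M] {s : Finset (X →₀ ℕ)}
    (T : (List X →₀ K) →ₗ[K] M) (N : Submodule K M)
    (h : ∀ w, content w ∈ s → T (Finsupp.single w 1) ∈ N) {f : List X →₀ K}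
    (hf : f ∈ wordsIn K s) : T f ∈ N := by
  rw [wordsIn, Finsupp.supported_eq_span_single] at hf
  have h1 : Submodule.span K ((fun w => Finsupp.single w (1 : K)) '' {w | content w ∈ s}) ≤
      N.comap T := by
    rw [Submodule.span_le]
    rintro _ ⟨w, hw, rfl⟩
    exact h w hw
  exact h1 hf

theorem map_eq_of_wordsIn {M : Type*} [AddCommGroup M] [Module K M] {s : Finset (X →₀ ℕ)}
    (T T' : (List X →₀ K) →ₗ[K] M)
    (h : ∀ w, content w ∈ s → T (Finsupp.single w 1) = T' (Finsupp.single w 1))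
    {f : List X →₀ K} (hf : f ∈ wordsIn K s) : T f = T' f := by
  have := map_mem_of_wordsIn (T - T') ⊥ (fun w hw => by simp [h w hw]) hf
  rw [Submodule.mem_bot, LinearMap.sub_apply, sub_eq_zero] at this
  exact this

theorem component_mem_wordsIn (α : X →₀ ℕ) (f : List X →₀ K) :
    component K α f ∈ wordsIn K {α} := by
  induction f using Finsupp.induction_linear with
  | zero => rw [map_zero]; exact zero_mem _
  | add f g hf hg => rw [map_add]; exact add_mem hf hg
  | single w r =>
    by_cases h : content w = α
    · rw [component_single_of_eq h]
      exact single_mem_wordsIn (Finset.mem_singleton.2 h) r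
    · rw [component_single_of_ne h]
      exact zero_mem _

theorem component_eq_self {α : X →₀ ℕ} {f : List X →₀ K} (hf : f ∈ wordsIn K {α}) :
    component K α f = f :=
  map_eq_of_wordsIn (component K α) LinearMap.id
    (fun _ hw => component_single_of_eq (Finset.mem_singleton.1 hw) 1) hf

theorem component_eq_zero {α : X →₀ ℕ} {s : Finset (X →₀ ℕ)} (hα : α ∉ s) {f : List X →₀ K}
    (hf : f ∈ wordsIn K s) : component K α f = 0 :=
  map_eq_of_wordsIn (component K α) 0
    (fun w hw => component_single_of_ne (by rintro rfl; exact hα hw) 1) hf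

theorem sum_component_of_mem {s : Finset (X →₀ ℕ)} {f : List X →₀ K} (hf : f ∈ wordsIn K s) :
    ∑ α ∈ s, component K α f = f :=
  sum_component s fun _ hw => hf hw

theorem exists_content (γ : X →₀ ℕ) : ∃ u : List X, content u = γ := by
  classical
  induction γ using Finsupp.induction with
  | zero => exact ⟨[], rfl⟩
  | single_add i n γ _ _ ih =>
    obtain ⟨u, rfl⟩ := ih
    refine ⟨List.replicate n i ++ u, ?_⟩
    rw [content_append, content, List.map_replicate, List.sum_replicate, Finsupp.smul_single]
    simp

instance [Finite X] (s : Finset (X →₀ ℕ)) : Module.Finite K (wordsIn K s) := by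
  have : Finite {w : List X | content w ∈ s} := by
    refine Set.Finite.subset (s.finite_toSet.biUnion fun α _ =>
      List.finite_length_eq X α.degree) fun w hw => ?_
    rw [Set.mem_iUnion₂]
    exact ⟨content w, hw, (degree_content w).symm⟩
  exact Module.Finite.equiv (Finsupp.supportedEquivFinsupp (M := K) (R := K)
    {w : List X | content w ∈ s}).symm

theorem wordsIn_insert [DecidableEq X] (α : X →₀ ℕ) (s : Finset (X →₀ ℕ)) :
    wordsIn K (insert α s) = wordsIn K {α} ⊔ wordsIn K s := by
  rw [wordsIn, wordsIn, wordsIn, ← Finsupp.supported_union]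
  congr 1
  ext w
  simp

/-- The dimension of the component of content `α` modulo the identities of the algebra of upper
triangular matrices. -/
def componentDim (K : Type*) {X : Type*} [Field K] (R : Type*) [Ring R] [Algebra K R]
    (α : X →₀ ℕ) : ℕ :=
  Module.finrank K ((wordsIn K {α}).map (wordIdentities K X R).mkQ)

variable (K) in
theorem componentDim_zero (α : X →₀ ℕ) : componentDim K (UpperTriangular K 0) α = 0 := by
  have h : (wordIdentities K X (UpperTriangular K 0)).mkQ = 0 := by
    rw [← LinearMap.ker_eq_top, Submodule.ker_mkQ, wordIdentities_upperTriangular_zero]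
  rw [componentDim, h, Submodule.map_zero, finrank_bot]

variable {R : Type*} [Ring R] [Algebra K R]

theorem finrank_map_wordsIn [Infinite K] [Finite X] (s : Finset (X →₀ ℕ)) :
    Module.finrank K ((wordsIn K s).map (wordIdentities K X R).mkQ) =
      ∑ α ∈ s, componentDim K R α := by
  classical
  induction s using Finset.induction_on with
  | empty =>
    have : wordsIn K (∅ : Finset (X →₀ ℕ)) = ⊥ := by
      rw [wordsIn]
      simp
    rw [this, Submodule.map_bot, finrank_bot, Finset.sum_empty]
  | insert α s hα ih =>
    rw [Finset.sum_insert hα, ← ih, wordsIn_insert, Submodule.map_sup, componentDim,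
      ← Submodule.finrank_sup_add_finrank_inf_eq]
    -- The sum of the components stays direct modulo identities because the identities are graded by
    -- content.
    have h : (wordsIn K {α}).map (wordIdentities K X R).mkQ ⊓
        (wordsIn K s).map (wordIdentities K X R).mkQ = ⊥ := by
      rw [eq_bot_iff]
      rintro _ ⟨⟨f, hf, rfl⟩, ⟨g, hg, hfg⟩⟩
      rw [Submodule.mkQ_apply, Submodule.mkQ_apply, Submodule.Quotient.eq] at hfg
      have h1 := component_mem hfg α
      rw [map_sub, component_eq_zero hα hg, component_eq_self hf, zero_sub, neg_mem_iff] at h1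
      rw [Submodule.mem_bot, Submodule.mkQ_apply, Submodule.Quotient.mk_eq_zero]
      exact h1
    rw [h, finrank_bot, add_zero]

theorem finrank_wordsIn_eq [Finite X] (α : X →₀ ℕ) :
    Module.finrank K (wordsIn K {α}) = componentDim K R α +
      Module.finrank K (wordsIn K {α} ⊓ wordIdentities K X R : Submodule K (List X →₀ K)) := by
  have h := LinearMap.finrank_range_add_finrank_ker (K := K) (V := wordsIn K {α})
    (V₂ := (List X →₀ K) ⧸ wordIdentities K X R) ((wordIdentities K X R).mkQ.domRestrict (wordsIn K {α}))
  rw [← h, LinearMap.range_domRestrict, componentDim, add_right_inj, LinearMap.ker_domRestrict,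
    Submodule.ker_mkQ, ← Submodule.finrank_map_subtype_eq, Submodule.map_comap_subtype]

end Components

/-! ### The recursion for the dimensions of the components -/

section Recursion

variable {K X : Type*} [Field K]

theorem appendWord_cons (i : X) (u : List X) (f : List X →₀ K) :
    appendWord K (i :: u) f = appendWord K [i] (appendWord K u f) := by
  induction f using Finsupp.induction_linear with
  | zero => simp
  | add f g hf hg => simp only [map_add, hf, hg]
  | single w r => simp

theorem evalWords_eq_smul (a : X → K) {α : X →₀ ℕ} {f : List X →₀ K}
    (hf : f ∈ wordsIn K {α}) :
    evalWords K a f = (α.prod fun i n => a i ^ n) • evalWords K (1 : X → K) f := by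
  refine map_eq_of_wordsIn (evalWords K a)
    ((α.prod fun i n => a i ^ n) • evalWords K (1 : X → K)) (fun w hw => ?_) hf
  rw [← Finset.mem_singleton.1 hw, LinearMap.smul_apply, evalWords_single, evalWords_single,
    one_smul, one_smul]
  clear hw
  induction w with
  | nil => simp
  | cons i w ih =>
    rw [List.map_cons, List.prod_cons, ih, content_cons,
      Finsupp.prod_add_index' (by simp) (by intro a b c; exact pow_add _ _ _),
      Finsupp.prod_single_index (by simp), pow_one, List.map_cons, List.prod_cons]
    simp [mul_assoc]

theorem wordsIn_mono {s t : Finset (X →₀ ℕ)} (h : s ⊆ t) : wordsIn K s ≤ wordsIn K t :=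
  Finsupp.supported_mono fun _ hw => h hw

variable [DecidableEq X]

theorem wordDeriv_cons (a : X → K) (i j : X) (f : List X →₀ K) :
    wordDeriv a j (appendWord K [i] f) = (if i = j then f else 0) + a i • wordDeriv a j f := by
  induction f using Finsupp.induction_linear with
  | zero => simp
  | add f g hf hg =>
    simp only [map_add, hf, hg, smul_add]
    split_ifs
    · abel
    · abel
  | single w r =>
    rw [appendWord_single, wordDeriv_single, wordDeriv_single, List.singleton_append, derivWord,
      smul_add, smul_comm r]
    split_ifs <;> simp

theorem derivWord_mem (a : X → K) (j : X) (w : List X) :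
    derivWord a j w ∈ Finsupp.supported K K {v | Finsupp.single j 1 + content v ≤ content w} := by
  induction w with
  | nil => exact zero_mem _
  | cons i w ih =>
    rw [derivWord]
    refine add_mem ?_ (Submodule.smul_mem _ _ ?_)
    · split_ifs with h
      · refine Finsupp.single_mem_supported K 1 ?_
        rw [Set.mem_ofPred_eq, content_cons, h]
      · exact zero_mem _
    · refine Finsupp.supported_mono ?_ ih
      intro v hv
      rw [Set.mem_ofPred_eq] at hv ⊢
      rw [content_cons]
      exact hv.trans le_add_self

theorem component_derivWord_eq_zero (a : X → K) (j : X) (w : List X) {β : X →₀ ℕ}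
    (h : ¬ Finsupp.single j 1 + β ≤ content w) : component K β (derivWord a j w) = 0 := by
  classical
  ext v
  rw [component_apply]
  split_ifs with hv
  · by_contra h0
    have h1 := derivWord_mem a j w (Finsupp.mem_support_iff.2 h0)
    rw [Set.mem_ofPred_eq, hv] at h1
    exact h h1
  · rfl

/-- In a factorization `u j v` the content of `v` determines that of `u`, hence the scalar `a(u)`.
On homogeneous elements the derivatives for all `a` are therefore controlled by the one with `a =
1`. -/
theorem component_derivWord (a : X → K) (j : X) (w : List X) (β : X →₀ ℕ) :
    component K β (derivWord a j w) =
      ((content w - (Finsupp.single j 1 + β)).prod fun i n => a i ^ n) •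
        component K β (derivWord 1 j w) := by
  induction w with
  | nil => simp [derivWord]
  | cons i w ih =>
    rw [derivWord, derivWord, map_add, map_add, map_smul, map_smul, Pi.one_apply, one_smul,
      smul_add, content_cons]
    congr 1
    · split_ifs with hij
      · by_cases hw : content w = β
        · rw [hij, hw, tsub_self, Finsupp.prod_zero_index, one_smul]
        · rw [component_single_of_ne hw, smul_zero]
      · rw [map_zero, smul_zero]
    -- Where the truncated subtraction would be wrong, both components vanish.
    · by_cases h : Finsupp.single j 1 + β ≤ content w
      · rw [ih, smul_smul, add_tsub_assoc_of_le h,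
          Finsupp.prod_add_index' (by simp) (by intro a b c; exact pow_add _ _ _),
          Finsupp.prod_single_index (by simp), pow_one]
      · rw [component_derivWord_eq_zero a j w h, component_derivWord_eq_zero 1 j w h, smul_zero,
          smul_zero]

theorem component_wordDeriv (a : X → K) (j : X) {α : X →₀ ℕ} {f : List X →₀ K}
    (hf : f ∈ wordsIn K {α}) (β : X →₀ ℕ) : component K β (wordDeriv a j f) =
      ((α - (Finsupp.single j 1 + β)).prod fun i n => a i ^ n) •
        component K β (wordDeriv 1 j f) := by
  refine map_eq_of_wordsIn (component K β ∘ₗ wordDeriv a j)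
    (((α - (Finsupp.single j 1 + β)).prod fun i n => a i ^ n) •
      (component K β ∘ₗ wordDeriv 1 j)) (fun w hw => ?_) hf
  rw [← Finset.mem_singleton.1 hw, LinearMap.smul_apply, LinearMap.comp_apply,
    LinearMap.comp_apply, wordDeriv_single, wordDeriv_single, one_smul, one_smul,
    component_derivWord]

/-- The contents of the words `v` such that `u j v` has content at most `α` for some `u`. -/
def contentsBelow (α : X →₀ ℕ) (j : X) : Finset (X →₀ ℕ) :=
  (Finset.Iic α).filter fun β => Finsupp.single j 1 + β ≤ α

theorem mem_contentsBelow {α β : X →₀ ℕ} {j : X} :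
    β ∈ contentsBelow α j ↔ Finsupp.single j 1 + β ≤ α := by
  rw [contentsBelow, Finset.mem_filter, Finset.mem_Iic, and_iff_right_iff_imp]
  exact fun h => le_add_self.trans h

variable (K X) in
/-- The identities of the algebra of upper triangular matrices. -/
abbrev triIdentities (k : ℕ) : Submodule K (List X →₀ K) :=
  wordIdentities K X (UpperTriangular K k)

/-- Each prepended letter changes the derivative by at most a left multiple of `f`, which is again
an identity. -/
theorem wordDeriv_appendWord_sub_mem {k : ℕ} {f : List X →₀ K} (hf : f ∈ triIdentities K X k)
    (u : List X) (j : X) :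
    wordDeriv 1 j (appendWord K u f) - wordDeriv 1 j f ∈ triIdentities K X k := by
  induction u with
  | nil =>
    have h : appendWord K ([] : List X) f = f := by
      rw [appendWord, Finsupp.lmapDomain_apply]
      exact Finsupp.mapDomain_id
    rw [h, sub_self]
    exact zero_mem _
  | cons i u ih =>
    rw [appendWord_cons, wordDeriv_cons, Pi.one_apply, one_smul, add_sub_assoc]
    refine add_mem ?_ ih
    split_ifs
    · exact appendWord_mem hf u
    · exact zero_mem _

theorem wordDeriv_mem_wordsIn {α : X →₀ ℕ} {f : List X →₀ K} (hf : f ∈ wordsIn K {α}) (j : X) :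
    wordDeriv 1 j f ∈ wordsIn K (contentsBelow α j) := by
  refine map_mem_of_wordsIn (wordDeriv 1 j) _ (fun w hw => ?_) hf
  rw [wordDeriv_single, one_smul]
  refine Finsupp.supported_mono (fun v hv => ?_) (derivWord_mem 1 j w)
  rw [Set.mem_ofPred_eq] at hv ⊢
  rwa [mem_contentsBelow, ← Finset.mem_singleton.1 hw]

theorem appendWord_mem_wordsIn {α : X →₀ ℕ} {j : X} {f : List X →₀ K}
    (hf : f ∈ wordsIn K (contentsBelow α j)) :
    appendWord K [j] f ∈ wordsIn K (Finset.Iic α) := by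
  refine map_mem_of_wordsIn (appendWord K [j]) _ (fun w hw => ?_) hf
  rw [appendWord_single]
  refine single_mem_wordsIn ?_ 1
  rw [Finset.mem_Iic, List.singleton_append, content_cons]
  exact mem_contentsBelow.1 hw

variable (K) in
/-- The words `v` such that `u j v` has content at most `α`, modulo identities. -/
abbrev chainSpace (k : ℕ) (α : X →₀ ℕ) (j : X) :
    Submodule K ((List X →₀ K) ⧸ triIdentities K X k) :=
  (wordsIn K (contentsBelow α j)).map (triIdentities K X k).mkQ

variable (K) in
/-- The map `f ↦ (∂_j f)` on the identities of content `α`. -/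
def derivQ (k : ℕ) (α : X →₀ ℕ) :
    (wordsIn K {α} ⊓ triIdentities K X k : Submodule K (List X →₀ K)) →ₗ[K]
      (j : X) → chainSpace K k α j :=
  LinearMap.pi fun j => LinearMap.codRestrict _
    ((triIdentities K X k).mkQ ∘ₗ wordDeriv 1 j ∘ₗ Submodule.subtype _)
    fun f => Submodule.mem_map_of_mem (wordDeriv_mem_wordsIn f.2.1 j)

theorem coe_derivQ (k : ℕ) (α : X →₀ ℕ)
    (f : (wordsIn K {α} ⊓ triIdentities K X k : Submodule K (List X →₀ K))) (j : X) :
    (derivQ K k α f j : (List X →₀ K) ⧸ triIdentities K X k) =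
      (triIdentities K X k).mkQ (wordDeriv 1 j f) := rfl

variable [Fintype X]

theorem mem_triIdentities_succ_of_mem_wordsIn [Infinite K] {k : ℕ} {α : X →₀ ℕ}
    {f : List X →₀ K} (hf : f ∈ wordsIn K {α}) :
    f ∈ triIdentities K X (k + 1) ↔ evalWords K (1 : X → K) f = 0 ∧
      ∀ j, wordDeriv 1 j f ∈ triIdentities K X k := by
  classical
  rw [mem_wordIdentities_upperTriangular_succ]
  refine ⟨fun h => h 1, fun h a => ⟨by rw [evalWords_eq_smul a hf, h.1, smul_zero], fun j => ?_⟩⟩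
  rw [← sum_component ((wordDeriv a j f).support.image content)
    fun w hw => Finset.mem_image_of_mem _ hw]
  refine sum_mem fun β _ => ?_
  rw [component_wordDeriv a j hf]
  exact Submodule.smul_mem _ _ (component_mem (h.2 j) β)

theorem evalWords_one_eq_zero {k : ℕ} {f : List X →₀ K} (hf : f ∈ triIdentities K X (k + 1)) :
    evalWords K (1 : X → K) f = 0 :=
  (mem_wordIdentities_upperTriangular_succ.1 hf 1).1

/-- The Fox formula. For a word, the sum runs over its letters, each giving the suffix that starts
at the letter minus the suffix after it; it telescopes to the word minus the empty word. -/
theorem sum_appendWord_wordDeriv_sub (f : List X →₀ K) :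
    ∑ j, (appendWord K [j] (wordDeriv 1 j f) - wordDeriv 1 j f) =
      f - Finsupp.single [] (evalWords K (1 : X → K) f) := by
  induction f using Finsupp.induction_linear with
  | zero => simp
  | add f g hf hg =>
    simp only [map_add, add_sub_add_comm, Finset.sum_add_distrib, hf, hg, Finsupp.single_add]
  | single w r =>
    have h : ∑ j, (appendWord K [j] (derivWord 1 j w) - derivWord 1 j w) =
        Finsupp.single w 1 - Finsupp.single [] (1 : K) := by
      induction w with
      | nil => simp [derivWord]
      | cons i w ih =>
        simp only [derivWord, Pi.one_apply, one_smul, map_add, add_sub_add_comm,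
          Finset.sum_add_distrib, ih]
        rw [Finset.sum_eq_single i (by intro j _ hj; simp [hj.symm]) (by simp), if_pos rfl,
          appendWord_single, List.singleton_append, sub_add_sub_cancel]
    have h1 := congrArg (r • ·) h
    simp only [Finset.smul_sum, smul_sub, Finsupp.smul_single, smul_eq_mul, mul_one] at h1
    simp only [wordDeriv_single, map_smul, h1, evalWords_single]
    congr 2
    rw [List.prod_eq_one (by simp), smul_eq_mul, mul_one]

variable (K) in
/-- Left multiplication by a variable, modulo identities. -/
def leftMulQ (k : ℕ) (j : X) : ((List X →₀ K) ⧸ triIdentities K X k) →ₗ[K]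
    ((List X →₀ K) ⧸ triIdentities K X k) :=
  (triIdentities K X k).mapQ _ (appendWord K [j]) fun _ hf => appendWord_mem hf [j]

variable (K) in
/-- The map `(e_j) ↦ ∑ (x_j e_j - e_j)`. -/
def boundary (k : ℕ) (α : X →₀ ℕ) :
    ((j : X) → chainSpace K k α j) →ₗ[K] ((List X →₀ K) ⧸ triIdentities K X k) :=
  ∑ j, (leftMulQ K k j - LinearMap.id) ∘ₗ (chainSpace K k α j).subtype ∘ₗ LinearMap.proj j

theorem boundary_apply (k : ℕ) (α : X →₀ ℕ) (e : (j : X) → chainSpace K k α j) :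
    boundary K k α e = ∑ j, (leftMulQ K k j (e j) - (e j : (List X →₀ K) ⧸ _)) := by
  simp [boundary, LinearMap.sum_apply]

theorem boundary_mk (k : ℕ) (α : X →₀ ℕ) {e : (j : X) → chainSpace K k α j}
    {f : X → List X →₀ K} (h : ∀ j, (triIdentities K X k).mkQ (f j) = e j) :
    boundary K k α e = (triIdentities K X k).mkQ (∑ j, (appendWord K [j] (f j) - f j)) := by
  rw [boundary_apply, map_sum]
  refine Finset.sum_congr rfl fun j _ => ?_
  rw [← h j, map_sub]
  rfl

theorem exists_sum_appendWord_sub {α : X →₀ ℕ} {f : List X →₀ K}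
    (hf : f ∈ wordsIn K (Finset.Iic α)) :
    ∃ e : X → List X →₀ K, (∀ j, e j ∈ wordsIn K (contentsBelow α j)) ∧
      ∑ j, (appendWord K [j] (e j) - e j) = f - Finsupp.single [] (evalWords K (1 : X → K) f) :=
  ⟨fun j => wordDeriv 1 j f, fun j => by
    refine map_mem_of_wordsIn (wordDeriv 1 j) _ (fun w hw => ?_) hf
    rw [wordDeriv_single, one_smul]
    refine Finsupp.supported_mono (fun v hv => ?_) (derivWord_mem 1 j w)
    rw [Set.mem_ofPred_eq] at hv ⊢
    exact mem_contentsBelow.2 (hv.trans (Finset.mem_Iic.1 hw)), sum_appendWord_wordDeriv_sub f⟩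

/-- By the Fox formula the image is complemented by the class of the empty word: the coefficient sum
`ε` kills the image and is 1 on that class. The index `k + 1` is needed for `ε` to descend, as `U_0`
satisfies every identity. -/
theorem finrank_range_boundary (k : ℕ) (α : X →₀ ℕ) :
    Module.finrank K (LinearMap.range (boundary K (k + 1) α)) + 1 = Module.finrank K
      ((wordsIn K (Finset.Iic α)).map (triIdentities K X (k + 1)).mkQ) := by
  set J := triIdentities K X (k + 1) with hJ
  let ε : ((List X →₀ K) ⧸ J) →ₗ[K] K :=
    J.liftQ (evalWords K (1 : X → K)) fun f hf => evalWords_one_eq_zero hf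
  have hε : ∀ f, ε (J.mkQ f) = evalWords K (1 : X → K) f := fun f => rfl
  have hε1 : ε (J.mkQ (Finsupp.single [] 1)) = 1 := by
    rw [hε, evalWords_single]
    simp
  have happ : ∀ (j : X) (f : List X →₀ K), evalWords K (1 : X → K) (appendWord K [j] f) =
      evalWords K (1 : X → K) f := by
    intro j f
    rw [evalWords_appendWord]
    simp
  have hr : ∀ x ∈ LinearMap.range (boundary K (k + 1) α), ε x = 0 ∧
      x ∈ (wordsIn K (Finset.Iic α)).map J.mkQ := by
    rintro _ ⟨e, rfl⟩
    choose f hf hfe using fun j => (e j).2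
    rw [boundary_mk _ _ hfe]
    constructor
    · rw [hε, map_sum]
      refine Finset.sum_eq_zero fun j _ => ?_
      rw [map_sub, happ, sub_self]
    · refine Submodule.mem_map_of_mem (sum_mem fun j _ => sub_mem (appendWord_mem_wordsIn (hf j)) ?_)
      exact wordsIn_mono (Finset.filter_subset _ _) (hf j)
  have h0 : (Finsupp.single [] 1 : List X →₀ K) ∈ wordsIn K (Finset.Iic α) :=
    single_mem_wordsIn (Finset.mem_Iic.2 (by simp)) 1
  have hsup : (wordsIn K (Finset.Iic α)).map J.mkQ =
      LinearMap.range (boundary K (k + 1) α) ⊔ Submodule.span K {J.mkQ (Finsupp.single [] 1)} := by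
    refine le_antisymm ?_ (sup_le (fun x hx => (hr x hx).2) ?_)
    · rintro _ ⟨f, hf, rfl⟩
      obtain ⟨e, he, hef⟩ := exists_sum_appendWord_sub hf
      have h1 : f = (∑ j, (appendWord K [j] (e j) - e j)) +
          evalWords K (1 : X → K) f • Finsupp.single [] 1 := by
        rw [hef, Finsupp.smul_single, smul_eq_mul, mul_one, sub_add_cancel]
      rw [h1, map_add, map_smul]
      refine Submodule.add_mem_sup ⟨fun j => ⟨J.mkQ (e j), Submodule.mem_map_of_mem (he j)⟩,
        boundary_mk _ _ fun j => rfl⟩ (Submodule.smul_mem _ _ (Submodule.mem_span_singleton_self _))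
    · rw [Submodule.span_singleton_le_iff_mem]
      exact Submodule.mem_map_of_mem h0
  have hinf : LinearMap.range (boundary K (k + 1) α) ⊓
      Submodule.span K {J.mkQ (Finsupp.single [] 1)} = ⊥ := by
    rw [eq_bot_iff]
    rintro x ⟨hx, hx'⟩
    obtain ⟨c, rfl⟩ := Submodule.mem_span_singleton.1 hx'
    have := (hr _ hx).1
    rw [map_smul, hε1, smul_eq_mul, mul_one] at this
    rw [this, zero_smul]
    exact zero_mem _
  have hne : J.mkQ (Finsupp.single [] 1) ≠ 0 := by
    intro h
    rw [h, map_zero] at hε1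
    exact zero_ne_one hε1
  have h := Submodule.finrank_sup_add_finrank_inf_eq (LinearMap.range (boundary K (k + 1) α))
    (Submodule.span K {J.mkQ (Finsupp.single [] 1)})
  rw [hinf, finrank_bot, finrank_span_singleton hne, ← hsup, add_zero] at h
  exact h.symm

variable [Infinite K]

/-- One inclusion is the Fox formula for an identity. Conversely, a cycle lifts to `g = ∑ (x_j f_j -
f_j)`, an identity with derivatives `f_j`. It may be inhomogeneous, which left multiplication of its
components repairs without changing the derivatives modulo identities. -/
theorem range_derivQ (k : ℕ) (α : X →₀ ℕ) :
    LinearMap.range (derivQ K (k + 1) α) = LinearMap.ker (boundary K (k + 1) α) := by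
  set J := triIdentities K X (k + 1) with hJ
  apply le_antisymm
  · rintro _ ⟨f, rfl⟩
    rw [LinearMap.mem_ker, boundary_mk _ _ fun j => (coe_derivQ (k + 1) α f j).symm,
      sum_appendWord_wordDeriv_sub, evalWords_one_eq_zero f.2.2, Finsupp.single_zero, sub_zero,
      Submodule.mkQ_apply, Submodule.Quotient.mk_eq_zero]
    exact f.2.2
  · intro e he
    choose f hf hfe using fun j => (e j).2
    rw [LinearMap.mem_ker, boundary_mk _ _ hfe, Submodule.mkQ_apply,
      Submodule.Quotient.mk_eq_zero] at he
    set g := ∑ j, (appendWord K [j] (f j) - f j) with hg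
    have hgα : g ∈ wordsIn K (Finset.Iic α) := sum_mem fun j _ =>
      sub_mem (appendWord_mem_wordsIn (hf j)) (wordsIn_mono (Finset.filter_subset _ _) (hf j))
    have hgD : ∀ i, wordDeriv 1 i g = f i := by
      intro i
      rw [hg, map_sum, Finset.sum_eq_single i]
      · rw [map_sub, wordDeriv_cons, if_pos rfl, Pi.one_apply, one_smul, add_sub_cancel_right]
      · intro j _ hj
        rw [map_sub, wordDeriv_cons, if_neg hj, Pi.one_apply, one_smul, zero_add, sub_self]
      · simp
    choose u hu using fun β : X →₀ ℕ => exists_content (α - β)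
    -- Each component of content `β` is brought to content `α` by a prefix of content `α - β`.
    let F := ∑ β ∈ Finset.Iic α, appendWord K (u β) (component K β g)
    have hF1 : F ∈ wordsIn K {α} := by
      refine sum_mem fun β hβ => ?_
      refine map_mem_of_wordsIn (appendWord K (u β)) _ (fun w hw => ?_)
        (component_mem_wordsIn β g)
      rw [appendWord_single]
      refine single_mem_wordsIn ?_ 1
      rw [content_append, hu, Finset.mem_singleton.1 hw, Finset.mem_singleton]
      exact tsub_add_cancel_of_le (Finset.mem_Iic.1 hβ)
    have hF2 : F ∈ J := sum_mem fun β _ => appendWord_mem (component_mem he β) _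
    refine ⟨⟨F, hF1, hF2⟩, ?_⟩
    funext j
    refine Subtype.ext ?_
    rw [coe_derivQ, ← hfe j, Submodule.mkQ_apply, Submodule.mkQ_apply, Submodule.Quotient.eq,
      ← hgD j]
    have h2 : wordDeriv 1 j g = ∑ β ∈ Finset.Iic α, wordDeriv 1 j (component K β g) := by
      rw [← map_sum, sum_component_of_mem hgα]
    change wordDeriv 1 j F - _ ∈ _
    rw [h2, map_sum, ← Finset.sum_sub_distrib]
    exact sum_mem fun β _ => wordDeriv_appendWord_sub_mem (component_mem he β) _ _

theorem finrank_range_derivQ (k : ℕ) (α : X →₀ ℕ) :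
    Module.finrank K (LinearMap.range (derivQ K (k + 1) α)) +
      componentDim K (UpperTriangular K (k + 1)) α =
        componentDim K (UpperTriangular K (k + 2)) α := by
  have h1 : Module.finrank K (wordsIn K {α}) = componentDim K (UpperTriangular K (k + 1)) α +
      Module.finrank K (wordsIn K {α} ⊓ triIdentities K X (k + 1) : Submodule K (List X →₀ K)) :=
    finrank_wordsIn_eq α
  have h2 : Module.finrank K (wordsIn K {α}) = componentDim K (UpperTriangular K (k + 2)) α +
      Module.finrank K (wordsIn K {α} ⊓ triIdentities K X (k + 2) : Submodule K (List X →₀ K)) :=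
    finrank_wordsIn_eq α
  have h3 := LinearMap.finrank_range_add_finrank_ker (K := K)
    (V := (wordsIn K {α} ⊓ triIdentities K X (k + 1) : Submodule K (List X →₀ K)))
    (V₂ := (j : X) → chainSpace K (k + 1) α j) (derivQ K (k + 1) α)
  -- An identity of `U_{k+1}` already has coefficient sum 0, so lying in the kernel is the only
  -- remaining condition for `U_{k+2}`.
  have h4 : (LinearMap.ker (derivQ K (k + 1) α)).map (Submodule.subtype _) =
      wordsIn K {α} ⊓ triIdentities K X (k + 2) := by
    ext f
    have hker : ∀ f, f ∈ LinearMap.ker (derivQ K (k + 1) α) ↔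
        ∀ j, wordDeriv 1 j (f : List X →₀ K) ∈ triIdentities K X (k + 1) := by
      intro f
      rw [LinearMap.mem_ker, funext_iff]
      refine forall_congr' fun j => ?_
      rw [← Submodule.Quotient.mk_eq_zero, ← Submodule.mkQ_apply, ← coe_derivQ]
      exact Subtype.ext_iff
    constructor
    · rintro ⟨f, hf, rfl⟩
      refine ⟨f.2.1, (mem_triIdentities_succ_of_mem_wordsIn f.2.1).2
        ⟨evalWords_one_eq_zero f.2.2, (hker f).1 hf⟩⟩
    · intro hf
      refine ⟨⟨f, hf.1, wordIdentities_upperTriangular_succ_le _ hf.2⟩, ?_, rfl⟩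
      exact (hker _).2 ((mem_triIdentities_succ_of_mem_wordsIn hf.1).1 hf.2).2
  rw [← h4, Submodule.finrank_map_subtype_eq] at h2
  omega

variable (K) in
/-- The recursion for the dimensions of the components of the relatively free algebras. -/
theorem componentDim_succ_succ (k : ℕ) (α : X →₀ ℕ) :
    componentDim K (UpperTriangular K (k + 2)) α +
        ∑ β ∈ Finset.Iic α, componentDim K (UpperTriangular K (k + 1)) β =
      componentDim K (UpperTriangular K (k + 1)) α +
        ∑ j, ∑ β ∈ contentsBelow α j, componentDim K (UpperTriangular K (k + 1)) β + 1 := by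
  have h1 := finrank_range_derivQ (K := K) k α
  have h2 := finrank_range_boundary (K := K) k α
  have h3 := LinearMap.finrank_range_add_finrank_ker (boundary K (k + 1) α)
  rw [← range_derivQ, Module.finrank_pi_fintype] at h3
  simp only [finrank_map_wordsIn] at h2 h3
  omega

variable (K) in
theorem componentDim_one (α : X →₀ ℕ) : componentDim K (UpperTriangular K 1) α = 1 := by
  -- Modulo the identities of `U_1`, all words of one content coincide, so any single word spans.
  obtain ⟨u, hu⟩ := exists_content α
  have hu' : (Finsupp.single u 1 : List X →₀ K) ∈ wordsIn K {α} :=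
    single_mem_wordsIn (Finset.mem_singleton.2 hu) 1
  have hmem : ∀ f ∈ wordsIn K {α}, f ∈ triIdentities K X 1 ↔ evalWords K (1 : X → K) f = 0 := by
    intro f hf
    rw [mem_triIdentities_succ_of_mem_wordsIn hf, and_iff_left_iff_imp]
    intro _ j
    rw [triIdentities, wordIdentities_upperTriangular_zero]
    trivial
  have hε : ∀ w : List X, evalWords K (1 : X → K) (Finsupp.single w 1) = 1 := by
    intro w
    rw [evalWords_single, one_smul]
    exact List.prod_eq_one (by simp)
  have h : (wordsIn K {α}).map (triIdentities K X 1).mkQ =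
      Submodule.span K {(triIdentities K X 1).mkQ (Finsupp.single u 1)} := by
    apply le_antisymm
    · rintro _ ⟨f, hf, rfl⟩
      refine map_mem_of_wordsIn (triIdentities K X 1).mkQ _ (fun w hw => ?_) hf
      have : (triIdentities K X 1).mkQ (Finsupp.single w 1) =
          (triIdentities K X 1).mkQ (Finsupp.single u 1) := by
        rw [Submodule.mkQ_apply, Submodule.mkQ_apply, Submodule.Quotient.eq,
          hmem _ (sub_mem (single_mem_wordsIn hw 1) hu'), map_sub, hε, hε, sub_self]
      rw [this]
      exact Submodule.mem_span_singleton_self _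
    · rw [Submodule.span_singleton_le_iff_mem]
      exact Submodule.mem_map_of_mem hu'
  rw [componentDim, h, finrank_span_singleton]
  rw [Submodule.mkQ_apply, ne_eq, Submodule.Quotient.mk_eq_zero, hmem _ hu', hε]
  exact one_ne_zero

end Recursion

/-! ### Restitution and polarization -/

section Restitution

variable {K : Type*} [Field K]

section Free

variable {X : Type*}

variable (K X) in
/-- The coordinates of the elements of the free algebra in the basis of words. -/
def toWords : FreeAlgebra K X ≃ₗ[K] (List X →₀ K) := (FreeAlgebra.basisFreeMonoid K X).repr

theorem toWords_symm_single (w : List X) :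
    (toWords K X).symm (Finsupp.single w 1) = (w.map (FreeAlgebra.ι K)).prod := by
  have h : (toWords K X).symm (Finsupp.single w 1) =
      FreeAlgebra.equivMonoidAlgebraFreeMonoid.symm
        (MonoidAlgebra.single (FreeMonoid.ofList w) (1 : K)) := rfl
  rw [h]
  change MonoidAlgebra.lift K _ _ (FreeMonoid.lift (FreeAlgebra.ι K)) _ = _
  rw [MonoidAlgebra.lift_single, one_smul, FreeMonoid.lift_apply]
  rfl

theorem toWords_prod_map (w : List X) :
    toWords K X (w.map (FreeAlgebra.ι K)).prod = Finsupp.single w 1 := by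
  rw [← toWords_symm_single, LinearEquiv.apply_symm_apply]

theorem toWords_prod_ofFn {n : ℕ} (u : Fin n → X) :
    toWords K X (List.ofFn fun i => FreeAlgebra.ι K (u i)).prod =
      Finsupp.single (List.ofFn u) 1 := by
  rw [← toWords_prod_map, List.map_ofFn]
  rfl

variable {R : Type*} [Ring R] [Algebra K R]

theorem evalWords_toWords (φ : FreeAlgebra K X →ₐ[K] R) (p : FreeAlgebra K X) :
    evalWords K (fun i => φ (FreeAlgebra.ι K i)) (toWords K X p) = φ p := by
  obtain ⟨f, rfl⟩ := (toWords K X).symm.surjective p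
  rw [LinearEquiv.apply_symm_apply]
  induction f using Finsupp.induction_linear with
  | zero => simp
  | add f g hf hg => simp only [map_add, hf, hg]
  | single w r =>
    have h : Finsupp.single w r = r • Finsupp.single w (1 : K) := by simp
    rw [h, map_smul, map_smul, map_smul, toWords_symm_single, evalWords_single, one_smul,
      map_list_prod, List.map_map]
    rfl

theorem mem_identities_iff {p : FreeAlgebra K X} :
    p ∈ identities K R X ↔ toWords K X p ∈ wordIdentities K X R := by
  rw [mem_wordIdentities, identities, Submodule.mem_iInf]
  constructor
  · intro h A
    have h1 := h (FreeAlgebra.lift K A)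
    rw [LinearMap.mem_ker, AlgHom.toLinearMap_apply, ← evalWords_toWords] at h1
    simpa using h1
  · intro h φ
    rw [LinearMap.mem_ker, AlgHom.toLinearMap_apply, ← evalWords_toWords]
    exact h _

theorem map_mem_identities {Y : Type*} (φ : FreeAlgebra K X →ₐ[K] FreeAlgebra K Y)
    {p : FreeAlgebra K X} (hp : p ∈ identities K R X) : φ p ∈ identities K R Y := by
  simp only [identities, Submodule.mem_iInf, LinearMap.mem_ker, AlgHom.toLinearMap_apply] at hp ⊢
  exact fun ψ => hp (ψ.comp φ)

end Free

variable {n : ℕ}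

variable (K) in
/-- The substitution `x_i ↦ y_{w(i)}`. -/
def restitution {X : Type*} (w : Fin n → X) : FreeAlgebra K (Fin n) →ₐ[K] FreeAlgebra K X :=
  FreeAlgebra.lift K fun i => FreeAlgebra.ι K (w i)

variable (K) in
/-- The substitution `y_a ↦ ∑ x_i` over the `i` with `w(i) = a`. -/
def polarization {X : Type*} [DecidableEq X] (w : Fin n → X) :
    FreeAlgebra K X →ₐ[K] FreeAlgebra K (Fin n) :=
  FreeAlgebra.lift K fun a => ∑ i with w i = a, FreeAlgebra.ι K i

variable (K) in
/-- The multilinear monomial `x_{σ(1)} ⋯ x_{σ(n)}`. -/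
def permMonomial (σ : Equiv.Perm (Fin n)) : FreeAlgebra K (Fin n) :=
  (List.ofFn fun i => FreeAlgebra.ι K (σ i)).prod

theorem permMonomial_mem (σ : Equiv.Perm (Fin n)) : permMonomial K σ ∈ multilinearPart K n :=
  Submodule.subset_span ⟨σ, rfl⟩

theorem restitution_permMonomial {X : Type*} (w : Fin n → X) (σ : Equiv.Perm (Fin n)) :
    restitution K w (permMonomial K σ) = (List.ofFn fun i => FreeAlgebra.ι K (w (σ i))).prod := by
  rw [permMonomial, map_list_prod, List.map_ofFn]
  congr 2
  funext i
  simp [restitution]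

theorem permVars_permMonomial (g σ : Equiv.Perm (Fin n)) :
    permVars K n g (permMonomial K σ) = permMonomial K (g * σ) := by
  change FreeAlgebra.lift K _ _ = _
  rw [permMonomial, map_list_prod, List.map_ofFn]
  congr 2
  funext i
  simp

theorem restitution_permVars {X : Type*} {w : Fin n → X} {g : Equiv.Perm (Fin n)}
    (hg : w ∘ g = w) (p : FreeAlgebra K (Fin n)) :
    restitution K w (permVars K n g p) = restitution K w p := by
  have h : (restitution K w).comp (FreeAlgebra.lift K (FreeAlgebra.ι K ∘ g)) =
      restitution K w := by
    ext i
    have := congrFun hg i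
    simp only [Function.comp_apply] at this
    simp [restitution, this]
  exact DFunLike.congr_fun h p

theorem bijective_of_sum_single_eq {r : Fin n → Fin n}
    (h : ∑ i, Finsupp.single (r i) 1 = ∑ i, (Finsupp.single i 1 : Fin n →₀ ℕ)) :
    Function.Bijective r := by
  rw [← Finite.surjective_iff_bijective]
  intro j
  by_contra! hj
  have h1 := DFunLike.congr_fun h j
  rw [Finsupp.finsetSum_apply, Finsupp.finsetSum_apply, Finset.sum_eq_zero,
    Finset.sum_eq_single j (by intro i _ hi; simp [hi]) (by simp)] at h1
  · simp at h1
  · intro i _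
    simp [hj i]

/-- Together the two substitutions replace `x_i` by the sum of the `x_j` with `w j = w i`. On a
multilinear monomial the multilinear terms of the result come from bijective choices, i.e. from the
permutations stabilizing `w`. -/
theorem component_polarization_restitution {X : Type*} [DecidableEq X] (w : Fin n → X)
    {p : FreeAlgebra K (Fin n)} (hp : p ∈ multilinearPart K n) :
    component K (∑ i, Finsupp.single i 1)
        (toWords K (Fin n) (polarization K w (restitution K w p))) =
      ∑ g ∈ Finset.univ.filter fun g : Equiv.Perm (Fin n) => w ∘ g = w,
        toWords K (Fin n) (permVars K n g p) := by
  classical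
  have hspan : multilinearPart K n = Submodule.span K (Set.range (permMonomial K)) := rfl
  rw [hspan] at hp
  induction hp using Submodule.span_induction with
  | zero => simp
  | add p q _ _ hp hq => simp only [map_add, hp, hq, Finset.sum_add_distrib]
  | smul r p _ hp => simp only [map_smul, hp, Finset.smul_sum]
  | mem p hp =>
    obtain ⟨σ, rfl⟩ := hp
    have h1 : polarization K w (restitution K w (permMonomial K σ)) =
        ∑ r ∈ Fintype.piFinset fun i => Finset.univ.filter fun j => w j = w (σ i),
          (List.ofFn fun i => FreeAlgebra.ι K (r i)).prod := by
      rw [restitution_permMonomial, map_list_prod, List.map_ofFn]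
      have h2 := (MultilinearMap.mkPiAlgebraFin K n (FreeAlgebra K (Fin n))).map_sum_finset
        (fun _ j => FreeAlgebra.ι K j) fun i => Finset.univ.filter fun j => w j = w (σ i)
      simp only [MultilinearMap.mkPiAlgebraFin_apply] at h2
      rw [← h2]
      congr 2
      funext i
      simp [polarization]
    simp only [h1, permVars_permMonomial]
    rw [map_sum, map_sum]
    have h3 : ∀ r : Fin n → Fin n, component K (∑ i, Finsupp.single i 1)
        (toWords K (Fin n) (List.ofFn fun i => FreeAlgebra.ι K (r i)).prod) =
        if ∑ i, Finsupp.single (r i) 1 = ∑ i, (Finsupp.single i 1 : Fin n →₀ ℕ) then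
          Finsupp.single (List.ofFn r) 1 else 0 := by
      intro r
      rw [toWords_prod_ofFn]
      split_ifs with h
      · exact component_single_of_eq (by rw [content_ofFn, h]) 1
      · exact component_single_of_ne (by rwa [content_ofFn]) 1
    simp only [h3]
    rw [← Finset.sum_filter]
    symm
    refine Finset.sum_bij (fun g _ i => g (σ i)) ?_ ?_ ?_ ?_
    · intro g hg
      simp only [Finset.mem_filter, Finset.mem_univ, true_and] at hg
      simp only [Finset.mem_filter, Fintype.mem_piFinset, Finset.mem_univ, true_and]
      exact ⟨fun i => congrFun hg (σ i),
        Equiv.sum_comp (g * σ) fun i => (Finsupp.single i 1 : Fin n →₀ ℕ)⟩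
    · intro g _ g' _ h
      ext i
      have := congrFun h (σ.symm i)
      simp only [Equiv.apply_symm_apply] at this
      rw [this]
    · intro r hr
      simp only [Finset.mem_filter, Fintype.mem_piFinset, Finset.mem_univ, true_and] at hr
      refine ⟨σ.symm.trans (Equiv.ofBijective r (bijective_of_sum_single_eq hr.2)), ?_, ?_⟩
      · simp only [Finset.mem_filter, Finset.mem_univ, true_and]
        funext i
        have := hr.1 (σ.symm i)
        rw [Equiv.apply_symm_apply] at this
        exact this
      · funext i
        simp
    · intro g _
      exact toWords_prod_ofFn _

variable {R : Type*} [Ring R] [Algebra K R]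

theorem sum_permVars_mem_identities [Infinite K] {X : Type*} [DecidableEq X] (w : Fin n → X)
    {p : FreeAlgebra K (Fin n)} (hp : p ∈ multilinearPart K n)
    (h : restitution K w p ∈ identities K R X) :
    ∑ g ∈ Finset.univ.filter fun g : Equiv.Perm (Fin n) => w ∘ g = w,
        permVars K n g p ∈ identities K R (Fin n) := by
  rw [mem_identities_iff, map_sum, ← component_polarization_restitution w hp]
  exact component_mem (mem_identities_iff.1 (map_mem_identities _ h)) _

variable (K R) in
/-- Restitution modulo identities. -/
def restitutionQ {X : Type*} (w : Fin n → X) :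
    (multilinearPart K n ⧸ multilinearIdentities K R n) →ₗ[K]
      ((List X →₀ K) ⧸ wordIdentities K X R) :=
  (multilinearIdentities K R n).liftQ ((wordIdentities K X R).mkQ ∘ₗ (toWords K X).toLinearMap ∘ₗ
    (restitution K w).toLinearMap ∘ₗ (multilinearPart K n).subtype) (by
      intro p hp
      rw [LinearMap.mem_ker, LinearMap.comp_apply, Submodule.mkQ_apply,
        Submodule.Quotient.mk_eq_zero]
      exact mem_identities_iff.1 (map_mem_identities _ hp))

theorem restitutionQ_mk {X : Type*} (w : Fin n → X) (p : multilinearPart K n) :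
    restitutionQ K R w (Submodule.Quotient.mk p) =
      Submodule.Quotient.mk (toWords K X (restitution K w p)) := rfl

theorem cocharacterRep_mk (g : Equiv.Perm (Fin n)) (p : multilinearPart K n) :
    cocharacterRep K R n g (Submodule.Quotient.mk p) = Submodule.Quotient.mk
      ⟨permVars K n g p, multilinearPart_le_comap K n g p.2⟩ := rfl

theorem restitutionQ_cocharacterRep {X : Type*} {w : Fin n → X} {g : Equiv.Perm (Fin n)}
    (hg : w ∘ g = w) (m : multilinearPart K n ⧸ multilinearIdentities K R n) :
    restitutionQ K R w (cocharacterRep K R n g m) = restitutionQ K R w m := by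
  induction m using Submodule.Quotient.induction_on with
  | _ p => rw [cocharacterRep_mk, restitutionQ_mk, restitutionQ_mk, restitution_permVars hg]

theorem sum_cocharacterRep_eq_zero [Infinite K] {X : Type*} [DecidableEq X] {w : Fin n → X}
    {m : multilinearPart K n ⧸ multilinearIdentities K R n} (h : restitutionQ K R w m = 0) :
    ∑ g ∈ Finset.univ.filter fun g : Equiv.Perm (Fin n) => w ∘ g = w,
        cocharacterRep K R n g m = 0 := by
  induction m using Submodule.Quotient.induction_on with
  | _ p =>
    rw [restitutionQ_mk, Submodule.Quotient.mk_eq_zero, ← mem_identities_iff] at h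
    simp only [cocharacterRep_mk]
    simp only [← Submodule.mkQ_apply]
    rw [← map_sum, Submodule.mkQ_apply, Submodule.Quotient.mk_eq_zero]
    have h1 := sum_permVars_mem_identities w p.2 h
    rw [multilinearIdentities, Submodule.mem_comap, map_sum]
    exact h1

instance : Module.Finite K (multilinearPart K n) :=
  FiniteDimensional.span_of_finite K (Set.finite_range _)

variable {d : ℕ}

theorem comp_eq_iff_smul_eq {α : Fin d →₀ ℕ} (w : Words n α) (g : Equiv.Perm (Fin n)) :
    w.1 ∘ g = w.1 ↔ g • w = w := by
  rw [Subtype.ext_iff, words_smul_coe]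
  constructor
  · intro h
    funext x
    have := congrFun h (g⁻¹ x)
    rw [Function.comp_apply, ← Equiv.Perm.mul_apply, mul_inv_cancel, Equiv.Perm.one_apply] at this
    exact this.symm
  · intro h
    funext x
    have := congrFun h (g x)
    rw [Function.comp_apply, ← Equiv.Perm.mul_apply, inv_mul_cancel, Equiv.Perm.one_apply] at this
    exact this.symm

theorem exists_smul_eq {α : Fin d →₀ ℕ} (w u : Words n α) :
    ∃ g : Equiv.Perm (Fin n), g • w = u := by
  obtain ⟨σ, hσ⟩ := exists_comp_eq_of_card_fiber (u := u.1) (v := w.1) fun i => by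
    rw [← wordContent_apply, ← wordContent_apply, u.2, w.2]
  exact ⟨σ⁻¹, Subtype.ext (by rw [words_smul_coe, inv_inv, hσ])⟩

/-- The intertwining map with `u ↦ ∑ g m` over the `g` with `g w = u`. -/
def orbitMap {V : Type*} [AddCommGroup V] [Module K V]
    (ρ : Representation K (Equiv.Perm (Fin n)) V) {α : Fin d →₀ ℕ} (w : Words n α) (m : V) :
    Representation.IntertwiningMap (wordRep K n α) ρ :=
  ⟨(Finsupp.linearCombination K fun u : Words n α =>
      ∑ g : Equiv.Perm (Fin n) with g • w = u, ρ g m) ∘ₗ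
      (MonoidAlgebra.coeffLinearEquiv K).toLinearMap, by
    intro h
    refine MonoidAlgebra.lhom_ext' fun u => LinearMap.ext_ring ?_
    change Finsupp.linearCombination K _
      (MonoidAlgebra.coeff (wordRep K n α h (MonoidAlgebra.single u 1))) =
      ρ h (Finsupp.linearCombination K _ (MonoidAlgebra.coeff (MonoidAlgebra.single u 1)))
    rw [wordRep_single, MonoidAlgebra.coeff_single, MonoidAlgebra.coeff_single,
      Finsupp.linearCombination_single, Finsupp.linearCombination_single, one_smul, one_smul,
      map_sum]
    symm
    refine Finset.sum_equiv (Equiv.mulLeft h) (fun g => ?_) fun g _ => ?_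
    · simp [mul_smul]
    · rw [Equiv.coe_mulLeft, map_mul, Module.End.mul_apply]⟩

theorem orbitMap_single {V : Type*} [AddCommGroup V] [Module K V]
    (ρ : Representation K (Equiv.Perm (Fin n)) V) {α : Fin d →₀ ℕ} (w : Words n α) (m : V) :
    orbitMap ρ w m (MonoidAlgebra.single w 1) =
      ∑ g : Equiv.Perm (Fin n) with g • w = w, ρ g m := by
  change Finsupp.linearCombination K _ (MonoidAlgebra.coeff (MonoidAlgebra.single w 1)) = _
  rw [MonoidAlgebra.coeff_single, Finsupp.linearCombination_single, one_smul]

variable (K R) in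
-- An intertwining map out of the transitive word module is determined by the image of one word `w`,
-- a vector fixed by the stabilizer of `w`. Restitution along `w` embeds these vectors into the
-- quotient of the free algebra, with image the component of content `α`.
theorem finrank_intertwiningMap_cocharacterRep [CharZero K] {α : Fin d →₀ ℕ}
    (hα : α.degree = n) : Module.finrank K
      (Representation.IntertwiningMap (wordRep K n α) (cocharacterRep K R n)) =
        componentDim K R α := by
  classical
  obtain ⟨w', hw'⟩ := exists_word hα
  let w : Words n α := ⟨w', hw'⟩
  let T : Representation.IntertwiningMap (wordRep K n α) (cocharacterRep K R n) →ₗ[K]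
      ((List (Fin d) →₀ K) ⧸ wordIdentities K (Fin d) R) :=
    { toFun := fun f => restitutionQ K R w.1 (f (MonoidAlgebra.single w 1))
      map_add' := fun f g => map_add (restitutionQ K R w.1) _ _
      map_smul' := fun r f => map_smul (restitutionQ K R w.1) r _ }
  have hTf : ∀ f, T f = restitutionQ K R w.1 (f (MonoidAlgebra.single w 1)) := fun f => rfl
  have hcard : ((Finset.univ.filter fun g : Equiv.Perm (Fin n) => g • w = w).card : K) ≠ 0 :=
    Nat.cast_ne_zero.2 (Finset.card_ne_zero_of_mem
      (Finset.mem_filter.2 ⟨Finset.mem_univ 1, one_smul _ w⟩))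
  have hT : Function.Injective T := by
    rw [injective_iff_map_eq_zero]
    intro f hf
    have hact : ∀ g, cocharacterRep K R n g (f (MonoidAlgebra.single w 1)) =
        f (MonoidAlgebra.single (g • w) 1) := by
      intro g
      rw [← f.isIntertwining, wordRep_single]
    -- If the restitution vanishes, so does the sum over the stabilizer. By invariance that sum is
    -- the vector times the stabilizer order, which is invertible.
    have h1 := sum_cocharacterRep_eq_zero (hTf f ▸ hf)
    simp only [comp_eq_iff_smul_eq] at h1
    have h2 : ∀ g ∈ Finset.univ.filter fun g : Equiv.Perm (Fin n) => g • w = w,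
        cocharacterRep K R n g (f (MonoidAlgebra.single w 1)) =
          f (MonoidAlgebra.single w 1) := by
      intro g hg
      rw [hact, (Finset.mem_filter.1 hg).2]
    rw [Finset.sum_congr rfl h2, Finset.sum_const, ← Nat.cast_smul_eq_nsmul K, smul_eq_zero] at h1
    have h3 := h1.resolve_left hcard
    refine Representation.IntertwiningMap.ext
      (MonoidAlgebra.lhom_ext' fun u => LinearMap.ext_ring ?_)
    obtain ⟨g, rfl⟩ := exists_smul_eq w u
    change f (MonoidAlgebra.single (g • w) 1) = 0
    rw [← hact, h3, map_zero]
  have hmono : ∀ σ, restitutionQ K R w.1 (Submodule.Quotient.mk ⟨_, permMonomial_mem σ⟩) =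
      Submodule.Quotient.mk (Finsupp.single (List.ofFn (w.1 ∘ σ)) 1) := by
    intro σ
    rw [restitutionQ_mk, restitution_permMonomial]
    exact congrArg _ (toWords_prod_ofFn _)
  have hcont : ∀ σ : Equiv.Perm (Fin n), content (List.ofFn (w.1 ∘ σ)) = α := by
    intro σ
    rw [content_ofFn, ← wordContent_eq_sum, wordContent_comp, w.2]
  have hrange : LinearMap.range T = (wordsIn K {α}).map (wordIdentities K (Fin d) R).mkQ := by
    apply le_antisymm
    · rintro _ ⟨f, rfl⟩
      rw [hTf]
      induction f (MonoidAlgebra.single w 1) using Submodule.Quotient.induction_on with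
      | _ p =>
        rw [restitutionQ_mk]
        refine Submodule.mem_map_of_mem (f := (wordIdentities K (Fin d) R).mkQ) ?_
        have h4 : multilinearPart K n ≤ (wordsIn K {α}).comap
            ((toWords K (Fin d)).toLinearMap ∘ₗ (restitution K w.1).toLinearMap) := by
          refine Submodule.span_le.2 ?_
          rintro _ ⟨σ, rfl⟩
          change toWords K (Fin d) (restitution K w.1 (permMonomial K σ)) ∈ wordsIn K {α}
          rw [restitution_permMonomial, toWords_prod_ofFn]
          exact single_mem_wordsIn (Finset.mem_singleton.2 (hcont σ)) 1
        exact h4 p.2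
    · rintro _ ⟨f, hf, rfl⟩
      refine map_mem_of_wordsIn (wordIdentities K (Fin d) R).mkQ _ (fun v hv => ?_) hf
      rw [Finset.mem_singleton] at hv
      have hlen : v.length = n := by rw [← degree_content, hv, hα]
      subst hlen
      obtain ⟨g, hg⟩ := exists_smul_eq w ⟨v.get, by
        rw [wordContent_eq_sum, ← content_ofFn, List.ofFn_get, hv]⟩
      have hv' : v = List.ofFn (w.1 ∘ ⇑g⁻¹) := by
        rw [← words_smul_coe, hg, List.ofFn_get]
      -- The orbit map sends `w` to a sum over its stabilizer, all of whose terms restitute to the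
      -- same word `v`, whence the factor.
      have h5 : T (orbitMap (cocharacterRep K R v.length) w
          (Submodule.Quotient.mk ⟨_, permMonomial_mem g⁻¹⟩)) =
          ((Finset.univ.filter fun g : Equiv.Perm (Fin v.length) => g • w = w).card : K) •
            (wordIdentities K (Fin d) R).mkQ (Finsupp.single v 1) := by
        rw [hTf, orbitMap_single, map_sum, Finset.sum_congr rfl fun h hh =>
          restitutionQ_cocharacterRep
            ((comp_eq_iff_smul_eq w h).2 (Finset.mem_filter.1 hh).2) _,
          Finset.sum_const, hmono, ← hv', ← Nat.cast_smul_eq_nsmul K]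
        rfl
      have h6 := Submodule.smul_mem (LinearMap.range T)
        ((Finset.univ.filter fun g : Equiv.Perm (Fin v.length) => g • w = w).card : K)⁻¹
        (h5 ▸ LinearMap.mem_range_self T _)
      rwa [smul_smul, inv_mul_cancel₀ hcard, one_smul] at h6
  rw [componentDim, ← hrange, LinearMap.finrank_range_of_inj hT]

end Restitution

/-! ### The Hilbert series and the multiplicity series -/

section HilbertSeries

variable {d : ℕ} (K : Type*) [Field K]

/-- The Hilbert series of the relatively free algebra of rank `d`. -/
def hilbertSeries (R : Type*) [Ring R] [Algebra K R] (d : ℕ) : MvPowerSeries (Fin d) ℂ :=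
  fun a => componentDim K R a

theorem coeff_hilbertSeries (R : Type*) [Ring R] [Algebra K R] (a : Fin d →₀ ℕ) :
    coeff a (hilbertSeries K R d) = componentDim K R a := rfl

theorem hilbertSeries_zero : hilbertSeries K (UpperTriangular K 0) d = 0 := by
  ext a
  rw [coeff_hilbertSeries, componentDim_zero, Nat.cast_zero, map_zero]

theorem coeff_X_mul_mul_geomProd (f : MvPowerSeries (Fin d) ℂ) (j : Fin d) (a : Fin d →₀ ℕ) :
    coeff a (X j * (f * geomProd d)) = ∑ b ∈ contentsBelow a j, coeff b f := by
  rw [X, coeff_monomial_mul, one_mul, coeff_mul_geomProd]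
  split_ifs with h
  · refine Finset.sum_congr ?_ fun _ _ => rfl
    ext b
    rw [Finset.mem_Iic, mem_contentsBelow, le_tsub_iff_left h]
  · symm
    refine Finset.sum_eq_zero fun b hb => ?_
    exact absurd (le_self_add.trans (mem_contentsBelow.1 hb)) h

/-- In `componentDim_succ_succ`, sums over `Iic` are products with `geomProd`, sums over
`contentsBelow` carry an extra `X j`, and the constant 1 is `geomProd` itself. The step from `U_0`
is separate because the boundary argument starts at `U_1`. -/
theorem hilbertSeries_succ [Infinite K] (k : ℕ) :
    hilbertSeries K (UpperTriangular K (k + 1)) d = hilbertSeries K (UpperTriangular K k) d +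
      geomProd d + (∑ i, X i - 1) * (hilbertSeries K (UpperTriangular K k) d * geomProd d) := by
  cases k with
  | zero =>
    rw [hilbertSeries_zero, zero_mul, mul_zero, add_zero, zero_add, zero_add]
    ext a
    rw [coeff_hilbertSeries, componentDim_one, coeff_geomProd, Nat.cast_one]
  | succ k =>
    ext a
    have h := congrArg (Nat.cast (R := ℂ)) (componentDim_succ_succ K k a)
    push_cast at h
    rw [sub_mul, one_mul, Finset.sum_mul, map_add, map_add, map_sub, map_sum, coeff_geomProd,
      coeff_mul_geomProd]
    simp only [coeff_X_mul_mul_geomProd, coeff_hilbertSeries]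
    linear_combination h

theorem isSymmetricSeries_sum_X :
    IsSymmetricSeries (∑ i : Fin d, (X i : MvPowerSeries (Fin d) ℂ)) := by
  rw [isSymmetricSeries_iff]
  intro σ
  rw [map_sum]
  simp only [rename_X]
  exact Equiv.sum_comp σ fun i => (X i : MvPowerSeries (Fin d) ℂ)

theorem IsSymmetricSeries.pow {f : MvPowerSeries (Fin d) ℂ} (hf : IsSymmetricSeries f) (q : ℕ) :
    IsSymmetricSeries (f ^ q) := by
  induction q with
  | zero => rw [pow_zero]; exact isSymmetricSeries_one
  | succ q ih => rw [pow_succ]; exact ih.mul hf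

theorem isSymmetricSeries_hilbertSeries [Infinite K] (k : ℕ) :
    IsSymmetricSeries (hilbertSeries K (UpperTriangular K k) d) := by
  induction k with
  | zero =>
    rw [hilbertSeries_zero]
    exact fun σ a => by rw [map_zero, map_zero]
  | succ k ih =>
    have h := ih.mul isSymmetricSeries_geomProd
    rw [hilbertSeries_succ, sub_mul, one_mul, sub_eq_add_neg, ← neg_one_smul ℂ]
    exact (ih.add isSymmetricSeries_geomProd).add
      ((isSymmetricSeries_sum_X.mul h).add (h.smul (-1)))

theorem hilbertSeries_eq_sum [Infinite K] (k : ℕ) :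
    hilbertSeries K (UpperTriangular K k) d = ∑ j ∈ Finset.Icc 1 k,
      (k.choose j : MvPowerSeries (Fin d) ℂ) * (∑ i, X i - 1) ^ (j - 1) * geomProd d ^ j := by
  set s : MvPowerSeries (Fin d) ℂ := ∑ i, X i - 1 with hs
  -- The constant term of `s` is `-1`, so `s` can be cancelled after passing to `1 + s B_k`.
  have hs0 : s ≠ 0 := by
    intro h
    have h1 := congrArg (constantCoeff (σ := Fin d) (R := ℂ)) h
    simp [hs] at h1
  -- The recursion is equivalent to `1 + s B_{k+1} = (1 + s B_k)(1 + s G)`.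
  have h1 : 1 + s * hilbertSeries K (UpperTriangular K k) d = (s * geomProd d + 1) ^ k := by
    induction k with
    | zero => rw [hilbertSeries_zero, mul_zero, add_zero, pow_zero]
    | succ k ih =>
      rw [hilbertSeries_succ, pow_succ, ← ih]
      ring
  rw [add_pow, Finset.range_eq_Ico, Finset.sum_eq_sum_Ico_succ_bot (Nat.succ_pos k)] at h1
  simp only [one_pow, mul_one, pow_zero, Nat.choose_zero_right, Nat.cast_one, add_right_inj] at h1
  refine mul_left_cancel₀ hs0 ?_
  rw [h1, Finset.mul_sum]
  refine Finset.sum_congr (by ext j; simp) fun j hj => ?_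
  obtain ⟨m, rfl⟩ := Nat.exists_eq_add_of_le' (Finset.mem_Icc.1 hj).1
  rw [Nat.add_sub_cancel, mul_pow]
  ring

/-- Both coefficients at `μ` are the same alternating sum: one of dimensions of intertwining spaces,
the other of coefficients of the Hilbert series, matched by restitution. -/
theorem algMultiplicitySeries_eq [CharZero K] (k : ℕ) :
    algMultiplicitySeries K (UpperTriangular K k) d =
      multiplicitySeries (hilbertSeries K (UpperTriangular K k) d) := by
  refine partitionSeries_ext fun μ hμ => ?_
  rw [coeff_multiplicitySeries (isSymmetricSeries_hilbertSeries K k) hμ,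
    coeff_mul_vandermondeSeries]
  have h1 : coeff (expo μ) (algMultiplicitySeries K (UpperTriangular K k) d :
      MvPowerSeries (Fin d) ℂ) = (cocharacterMultiplicity K (UpperTriangular K k) μ : ℂ) :=
    if_pos hμ
  have h2 := finrank_intertwiningMap_eq_altCoeff hμ
    (cocharacterRep K (UpperTriangular K k) (∑ i, μ i))
  have h3 := congrArg (Int.castAddHom ℂ) h2
  rw [map_altCoeff] at h3
  simp only [Int.coe_castAddHom, Int.cast_natCast] at h3
  rw [h1, cocharacterMultiplicity, h3]
  refine altCoeff_congr fun a ha => ?_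
  rw [finrank_intertwiningMap_cocharacterRep K _ ha, coeff_hilbertSeries]

theorem schurSeries_sum {ι : Type*} (s : Finset ι) (h : ι → partitionSeries d) :
    schurSeries (∑ i ∈ s, h i) = ∑ i ∈ s, schurSeries (h i) := by
  classical
  induction s using Finset.induction_on with
  | empty =>
    rw [Finset.sum_empty, Finset.sum_empty, ← zero_smul ℂ (0 : partitionSeries d),
      schurSeries_smul, zero_smul]
  | insert i s hi ih => rw [Finset.sum_insert hi, Finset.sum_insert hi, schurSeries_add, ih]

theorem sum_spechtDegree_smul_schurSeries [CharZero K] (q : ℕ) :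
    ∑ l : partitionsOf d q, (spechtDegree K l.1 : ℂ) •
        schurSeries (partitionMonomial l.1 (antitone_of_mem_partitionsOf l.2)) =
      (∑ i : Fin d, (X i : MvPowerSeries (Fin d) ℂ)) ^ q := by
  classical
  simp only [← schurSeries_smul]
  rw [← schurSeries_sum, ← schurSeries_multiplicitySeries (isSymmetricSeries_sum_X.pow q)]
  congr 1
  refine partitionSeries_ext fun μ hμ => ?_
  rw [coeff_multiplicitySeries (isSymmetricSeries_sum_X.pow q) hμ]
  have h1 : ∀ l : partitionsOf d q, coeff (expo μ) ((spechtDegree K l.1 : ℂ) •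
      (partitionMonomial l.1 (antitone_of_mem_partitionsOf l.2) : MvPowerSeries (Fin d) ℂ)) =
      if l.1 = μ then (spechtDegree K μ : ℂ) else 0 := by
    intro l
    change coeff (expo μ) ((spechtDegree K l.1 : ℂ) • monomial (expo l.1) 1) = _
    rw [map_smul, coeff_monomial, smul_eq_mul]
    by_cases h : l.1 = μ
    · rw [if_pos (congrArg _ h.symm), if_pos h, h, mul_one]
    · rw [if_neg fun h' => h (Finsupp.equivFunOnFinite.symm.injective h').symm, if_neg h, mul_zero]
  rw [AddSubmonoidClass.coe_finsetSum, map_sum]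
  simp only [Submodule.coe_smul, h1]
  rw [Finset.sum_coe_sort (partitionsOf d q)
    fun l => if l = μ then (spechtDegree K μ : ℂ) else 0, Finset.sum_ite_eq']
  split_ifs with h
  · rw [spechtDegree_eq_coeff K hμ, (mem_partitionsOf.1 h).1]
  -- If `μ` is not a partition of `q`, no word of length `q` has a content of degree `|μ|`, so every
  -- term vanishes.
  · rw [coeff_mul_vandermondeSeries]
    have h2 : altCoeff μ (fun a => coeff a ((∑ i : Fin d, (X i : MvPowerSeries (Fin d) ℂ)) ^ q)) =
        altCoeff μ fun _ => 0 := by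
      refine altCoeff_congr fun a ha => ?_
      have : IsEmpty (Words q a) := ⟨fun w => h (mem_partitionsOf.2 ⟨by
        rw [← ha, ← w.2, degree_wordContent], hμ⟩)⟩
      rw [coeff_sum_X_pow, Fintype.card_eq_zero, Nat.cast_zero]
    rw [h2]
    simp [altCoeff]

/-- The Schur expansion is injective, and under it `Y^j` is multiplication by `geomProd ^ j`. The
claim becomes the closed form of the Hilbert series with `s^(j-1)` expanded binomially. -/
theorem algMultiplicitySeries_upperTriangular [CharZero K] (k : ℕ) :
    algMultiplicitySeries K (UpperTriangular K k) d =
      ∑ j ∈ Finset.Icc 1 k, ∑ q ∈ Finset.range j, ∑ l : partitionsOf d q,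
        ((-1 : ℂ) ^ (j - q - 1) * (k.choose j : ℂ) * ((j - 1).choose q : ℂ) *
            (spechtDegree K l.1 : ℂ)) •
          youngOperator^[j] (partitionMonomial l.1 (antitone_of_mem_partitionsOf l.2)) := by
  refine schurSeries_injective ?_
  rw [algMultiplicitySeries_eq, schurSeries_multiplicitySeries
    (isSymmetricSeries_hilbertSeries K k), hilbertSeries_eq_sum, schurSeries_sum]
  refine Finset.sum_congr rfl fun j hj => ?_
  obtain ⟨m, rfl⟩ := Nat.exists_eq_add_of_le' (Finset.mem_Icc.1 hj).1
  rw [schurSeries_sum, Nat.add_sub_cancel, sub_eq_add_neg, add_pow, Finset.mul_sum, Finset.sum_mul]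
  refine Finset.sum_congr rfl fun q hq => ?_
  rw [schurSeries_sum]
  simp only [schurSeries_smul, schurSeries_youngOperator_iterate, mul_smul]
  rw [← Finset.smul_sum, ← Finset.smul_sum, ← Finset.smul_sum]
  simp only [← smul_mul_assoc]
  rw [← Finset.sum_mul, sum_spechtDegree_smul_schurSeries, Nat.sub_right_comm, Nat.add_sub_cancel]
  simp only [Algebra.smul_def, map_pow, map_neg, map_one, map_natCast]
  ring

end HilbertSeries

end

theorem mainTheorem4 (K : Type*) [Field K] [CharZero K] (k d : ℕ) (hk : 1 ≤ k) (hd : 1 ≤ d) :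
    -- `Y` is a linear operator which sends `M(g)` to the multiplicity series of the Young-derived
    (IsLinearMap ℂ (youngOperator : partitionSeries d → partitionSeries d) ∧
      ∀ g : MvPowerSeries (Fin d) ℂ, IsSymmetricSeries g →
        youngOperator (multiplicitySeries g) = multiplicitySeries (g * geomProd d)) ∧
    -- the multiplicity series of `U_k`
    algMultiplicitySeries K (UpperTriangular K k) d =
      ∑ j ∈ Finset.Icc 1 k, ∑ q ∈ Finset.range j, ∑ l : partitionsOf d q,
        ((-1 : ℂ) ^ (j - q - 1) * (k.choose j : ℂ) * ((j - 1).choose q : ℂ) *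
            (spechtDegree K l.1 : ℂ)) •
          youngOperator^[j] (partitionMonomial l.1 (antitone_of_mem_partitionsOf l.2)) ∧
    -- the explicit formula by which `Y` is computed
    ∀ h : partitionSeries d,
      (youngOperator h : MvPowerSeries (Fin d) ℂ) =
        geomProd d * ∑ E ∈ (Finset.univ.filter fun i : Fin d => 0 < i.val).powerset,
          (∏ i ∈ E, -(MvPowerSeries.X i : MvPowerSeries (Fin d) ℂ)) * shiftSubst E h := by
  exact ⟨⟨isLinearMap_youngOperator, fun _ hg => youngOperator_multiplicitySeries hg⟩,
    algMultiplicitySeries_upperTriangular K k, youngOperator_explicit⟩
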